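/- Let $M$ be a smooth $m$-dimensional manifold without boundary (for instance a compact connected Riemannian manifold or $\mathbb R^m$), let $G\subseteq SU(N)$, and let $E\to M$ be a smooth vector bundle with fibre $\mathbb C^N$ and structure group $G$, given by local trivializations $\psi_a\colon E|_{W_a}\cong W_a\times\mathbb C^N$ over an open cover $(W_a)$ of $M$ with smooth $G$-valued transition functions $\psi_{ab}$, $\psi_a\psi_b^{-1}(x,\xi)=(x,\psi_{ab}(x)\xi)$. Let $A$ be a connection in $E$, that is, a family of smooth $\mathrm{Lie}(G)$-valued 1-forms $A^a=A^a_\mu dx^\mu$ on $W_a$ with $A^b=\psi_{ab}^{-1}A^a\psi_{ab}+\psi_{ab}^{-1}d\psi_{ab}$ on $W_a\cap W_b$. Its curvature $F$ is the $\mathrm{End}(E)$-valued 2-form given over $W_a$ by $F^a_{\mu\nu}=\partial_\mu A^a_\nu-\partial_\nu A^a_\mu+[A^a_\mu,A^a_\nu]$. Let $\Omega$ be the Hilbert manifold of $H^1$-curves $\gamma\colon[0,1]\to M$ (continuous curves that in every chart, on every compact subinterval mapped into its domain, are absolutely continuous with square integrable derivative). Its tangent space at $\gamma$ is the space $H^1_\gamma(TM)$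 of $H^1$ vector fields along $\gamma$. A map $p\mapsto\Gamma_p$ from a normed space to $\Omega$ is Fréchet differentiable at $p_0$, with derivative $p\mapsto X_p\in H^1_\gamma(TM)$, $\gamma=\Gamma_{p_0}$, if for every chart $\varphi$ of $M$ and every compact interval $I\subseteq[0,1]$ that $\gamma$ maps into the domain of $\varphi$, the curves $\Gamma_p$ with $p$ close to $p_0$ also map $I$ into this domain and $p\mapsto\varphi\circ\Gamma_p|_I\in H^1(I,\mathbb R^m)$ is Fréchet differentiable at $p_0$ with derivative $p\mapsto d\varphi(X_p)|_I$. A function $f$ on $\Omega$ with values in a finite-dimensional normed space has at $\gamma$ the first derivative $X\mapsto d_Xf(\gamma)$ if for every such $\Gamma$ with $\Gamma_{p_0}=\gamma$ the map $p\mapsto f(\Gamma_p)$ is Fréchet differentiable at $p_0$ with derivative $p\mapsto d_{X_p}f(\gamma)$. For $\gamma\in\Omega$ and $s,t\in[0,1]$ let $U_{t,s}(\gamma)\colon E_{\gamma(s)}\to E_{\gamma(t)}$ be the parallel transport generated by $A$: the multiplicative family ($U_{t,s}U_{s,r}=U_{t,r}$) whose matrix $U^a_{t,s}=\psi_aU_{t,s}\psi_a^{-1}$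 is, over any interval that $\gamma$ maps into $W_a$, an $H^1$ function of each of $t$ and $s$ satisfying almost everywhere $$\tfrac{d}{dt}U^a_{t,s}=-A^a_\mu(\gamma(t))\dot\gamma^\mu(t)U^a_{t,s},\qquad \tfrac{d}{ds}U^a_{t,s}=U^a_{t,s}A^a_\mu(\gamma(s))\dot\gamma^\mu(s),\qquad U^a_{s,s}=\mathrm{Id}.$$ Then such a parallel transport exists along every $\gamma\in\Omega$, and for all $\gamma\in\Omega$ and $0\le c\le d\le 1$ the following holds. In any local trivializations $\psi_a$ of $E$ near $\gamma(c)$ and $\psi_b$ near $\gamma(d)$, the parallel transport $U_{d,c}$, regarded as the matrix valued function $\sigma\mapsto\psi_bU_{d,c}(\sigma)\psi_a^{-1}$ of $\sigma\in\Omega$ near $\gamma$, has a first derivative at $\gamma$, given for $X\in H^1_\gamma(TM)$ by $$d_XU_{d,c}(\gamma)=-\int_c^dU_{d,t}(\gamma)F_{\mu\nu}(\gamma(t))X^\mu(t)\dot\gamma^\nu(t)U_{t,c}(\gamma)\,dt-A_\mu(\gamma(d))X^\mu(d)U_{d,c}(\gamma)+U_{d,c}(\gamma)A_\mu(\gamma(c))X^\mu(c),$$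 where all terms are expressed as matrices in these trivializations ($A=A^b$ at $\gamma(d)$ and $A=A^a$ at $\gamma(c)$), and the integrand is integrable on $[c,d]$ for every $X\in H^1_\gamma(TM)$. -/

import Mathlib

open Set Filter Topology MeasureTheory
open scoped Manifold ContDiff Matrix.Norms.L2Operator

noncomputable section

namespace CurveTransport

/-! ### The Sobolev class `H¹` on a compact interval -/

/-- `f ∈ H¹([a,b], V)`: absolutely continuous with square integrable derivative
(`V` is a finite dimensional normed space in all uses below). -/
def IsH1On {V : Type*} [NormedAddCommGroup V] [NormedSpace ℝ V] (a b : ℝ) (f : ℝ → V) : Prop :=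
  AbsolutelyContinuousOnInterval f a b ∧ MemLp (deriv f) 2 (volume.restrict (Icc a b))

/-- The Hilbert norm `(∫_a^b ‖f‖² + ∫_a^b ‖f'‖²)^{1/2}` of `f ∈ H¹([a,b], V)`. -/
def h1Norm {V : Type*} [NormedAddCommGroup V] [NormedSpace ℝ V] (a b : ℝ) (f : ℝ → V) : ℝ :=
  Real.sqrt ((∫ t in a..b, ‖f t‖ ^ 2) + ∫ t in a..b, ‖deriv f t‖ ^ 2)

section Curves

variable {d : ℕ} {M : Type*} [TopologicalSpace M] [ChartedSpace (EuclideanSpace ℝ (Fin d)) M]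

/-- The charts `(φ, W)` of the smooth manifold `M` (all charts of its smooth structure). -/
def charts (d : ℕ) (M : Type*) [TopologicalSpace M]
    [ChartedSpace (EuclideanSpace ℝ (Fin d)) M] :
    Set (OpenPartialHomeomorph M (EuclideanSpace ℝ (Fin d))) :=
  IsManifold.maximalAtlas (𝓡 d) ∞ M

/-- `H¹`-curves `[0,1] → M`: continuous, and of class `H¹` in every chart, on every compact
interval that the curve maps into the domain of the chart. Curves are written as functions on `ℝ`
of which only the values on `[0,1]` matter. -/
def IsH1Curve (d : ℕ) {M : Type*} [TopologicalSpace M]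
    [ChartedSpace (EuclideanSpace ℝ (Fin d)) M] (γ : ℝ → M) : Prop :=
  ContinuousOn γ (Icc 0 1) ∧
  ∀ φ ∈ charts d M, ∀ a b : ℝ, 0 ≤ a → a ≤ b → b ≤ 1 → MapsTo γ (Icc a b) φ.source →
    IsH1On a b (fun t => φ (γ t))

/-- The set `Ω` of all `H¹`-curves in `M`. -/
def CurveSpace (d : ℕ) (M : Type*) [TopologicalSpace M]
    [ChartedSpace (EuclideanSpace ℝ (Fin d)) M] : Type _ :=
  {γ : ℝ → M // IsH1Curve d γ}

/-- The velocity `γ̇(t) ∈ T_{γ(t)}M` (it exists for almost every `t ∈ [0,1]` when `γ ∈ Ω`). -/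
def velocity (d : ℕ) {M : Type*} [TopologicalSpace M]
    [ChartedSpace (EuclideanSpace ℝ (Fin d)) M] (γ : ℝ → M) (t : ℝ) : TangentSpace (𝓡 d) (γ t) :=
  mfderiv 𝓘(ℝ, ℝ) (𝓡 d) γ t (1 : ℝ)

/-- The coordinate expression `t ↦ (X^μ(t))_μ` in the chart `φ` of a vector field `X` along `γ`. -/
def fieldCoord (φ : OpenPartialHomeomorph M (EuclideanSpace ℝ (Fin d))) (γ : ℝ → M)
    (X : ∀ t : ℝ, TangentSpace (𝓡 d) (γ t)) (t : ℝ) : EuclideanSpace ℝ (Fin d) :=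
  mfderiv (𝓡 d) (𝓡 d) φ (γ t) (X t)

/-- `X ∈ H¹_γ(TM) = T_γ Ω`: the vector field `X` along `γ` is of class `H¹`. -/
def IsH1Field (γ : ℝ → M) (X : ∀ t : ℝ, TangentSpace (𝓡 d) (γ t)) : Prop :=
  ∀ φ ∈ charts d M, ∀ a b : ℝ, 0 ≤ a → a ≤ b → b ≤ 1 → MapsTo γ (Icc a b) φ.source →
    IsH1On a b (fieldCoord φ γ X)

/-- Fréchet differentiability of a map from a normed space into the Hilbert manifold `Ω`.
The map `Γ : P → Ω` with `Γ p₀ = γ` is differentiable at `p₀`, with derivative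
`P → T_γ Ω = H¹_γ(TM)`, `p ↦ X p`: whenever `γ` maps the interval `[a,b]` into the domain of a
chart `φ` of `M`, so do the nearby curves `Γ p`, and `p ↦ φ ∘ Γ p|_[a,b] ∈ H¹([a,b], ℝ^d)` is
Fréchet differentiable at `p₀` with derivative the bounded linear map
`p ↦ dφ(X p)|_[a,b]`. For `P = ℝ` this is a curve in `Ω` with tangent vector `X 1` at `γ`; for
`P = H¹_γ(TM)` and `X = id` the inverse charts `ξ ↦ exp_γ ξ` of `Ω` (defined for small `ξ`, and
continued by the constant `γ`) are of this kind. -/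
structure HasVariationAt {P : Type*} [NormedAddCommGroup P] [NormedSpace ℝ P]
    (γ : CurveSpace d M) (Γ : P → CurveSpace d M)
    (X : P →ₗ[ℝ] (∀ t : ℝ, TangentSpace (𝓡 d) (γ.1 t))) (p₀ : P) : Prop where
  base : Γ p₀ = γ
  tangent : ∀ p, IsH1Field γ.1 (X p)
  bounded : ∀ φ ∈ charts d M, ∀ a b : ℝ, 0 ≤ a → a ≤ b → b ≤ 1 →
    MapsTo γ.1 (Icc a b) φ.source →
    ∃ C : ℝ, ∀ p, h1Norm a b (fieldCoord φ γ.1 (X p)) ≤ C * ‖p‖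
  mapsTo : ∀ φ ∈ charts d M, ∀ a b : ℝ, 0 ≤ a → a ≤ b → b ≤ 1 →
    MapsTo γ.1 (Icc a b) φ.source →
    ∀ᶠ p in 𝓝 p₀, MapsTo (Γ p).1 (Icc a b) φ.source
  isLittleO : ∀ φ ∈ charts d M, ∀ a b : ℝ, 0 ≤ a → a ≤ b → b ≤ 1 →
    MapsTo γ.1 (Icc a b) φ.source →
    (fun p => h1Norm a b
      (fun t => φ ((Γ p).1 t) - φ (γ.1 t) - fieldCoord φ γ.1 (X (p - p₀)) t))
      =o[𝓝 p₀] (fun p => p - p₀)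

/-- The function `f` on (a neighbourhood of `γ` in) the Hilbert manifold `Ω` has at `γ` the first
derivative `X ↦ d_X f(γ) = L X`, `X ∈ T_γ Ω = H¹_γ(TM)`: along every map `Γ` from a normed space
into `Ω` which is Fréchet differentiable at `p₀` with `Γ p₀ = γ`, the composition `f ∘ Γ` is
Fréchet differentiable at `p₀`, and its derivative is given by the chain rule. With the inverse
chart `exp_γ` as `Γ` this contains Fréchet differentiability in the chart at `γ` (so `P : Type` is
no restriction: the model space `H¹_γ(TM)` lives there), and with `P = ℝ` it contains the
directional derivative along every differentiable curve in `Ω` with tangent vector `X`. -/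
def HasFirstDerivAt {V : Type*} [NormedAddCommGroup V] [NormedSpace ℝ V]
    (f : CurveSpace d M → V) (γ : CurveSpace d M)
    (L : (∀ t : ℝ, TangentSpace (𝓡 d) (γ.1 t)) → V) : Prop :=
  ∀ (P : Type) [NormedAddCommGroup P] [NormedSpace ℝ P] (Γ : P → CurveSpace d M)
    (X : P →ₗ[ℝ] (∀ t : ℝ, TangentSpace (𝓡 d) (γ.1 t))) (p₀ : P),
    HasVariationAt γ Γ X p₀ →
    ∃ D : P →L[ℝ] V, (∀ p, D p = L (X p)) ∧ HasFDerivAt (fun p => f (Γ p)) D p₀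

end Curves

/-! ### Vector bundles with structure group `G ⊆ SU(N)` and connections -/

/-- Complex `N × N` matrices, the endomorphisms of `ℂ^N`. -/
abbrev Mat (N : ℕ) : Type := Matrix (Fin N) (Fin N) ℂ

/-- The Lie algebra of `G ⊆ SU(N)`: the matrices whose one-parameter group lies in `G`. -/
def lieAlg {N : ℕ} (G : Subgroup (Matrix.specialUnitaryGroup (Fin N) ℂ)) : Set (Mat N) :=
  {B | ∀ s : ℝ, ∃ h ∈ G, (h : Mat N) = NormedSpace.exp (s • B)}

/-- The structure of a smooth vector bundle over `M` with fibre `ℂ^N` and structure group `G` on a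
family `E x`, `x ∈ M`, of complex vector spaces: local trivializations
`ψ_a : E x ≅ ℂ^N`, `x ∈ W_a`, over an open cover `(W_a)` of `M`, with smooth `G`-valued transition
functions `ψ_ab = ψ_a ψ_b⁻¹` on `W_a ∩ W_b`. Only the values of `ψ_a` over `W_a` matter. -/
structure GBundle (d : ℕ) {M : Type*} [TopologicalSpace M]
    [ChartedSpace (EuclideanSpace ℝ (Fin d)) M] {N : ℕ}
    (G : Subgroup (Matrix.specialUnitaryGroup (Fin N) ℂ))
    (E : M → Type*) [∀ x, AddCommGroup (E x)] [∀ x, Module ℂ (E x)] where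
  ι : Type*
  W : ι → Set M
  isOpen_W : ∀ a, IsOpen (W a)
  cover : ∀ x, ∃ a, x ∈ W a
  ψ : ι → ∀ x, E x ≃ₗ[ℂ] (Fin N → ℂ)
  transition_mem : ∀ a b, ∀ x ∈ W a ∩ W b, ∃ h ∈ G,
    (h : Mat N) = LinearMap.toMatrix' ((ψ a x).toLinearMap ∘ₗ (ψ b x).symm.toLinearMap)
  transition_smooth : ∀ a b, ContMDiffOn (𝓡 d) 𝓘(ℝ, Mat N) ∞
    (fun x => LinearMap.toMatrix' ((ψ a x).toLinearMap ∘ₗ (ψ b x).symm.toLinearMap))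
    (W a ∩ W b)

section Bundles

variable {d : ℕ} {M : Type*} [TopologicalSpace M] [ChartedSpace (EuclideanSpace ℝ (Fin d)) M]
  {N : ℕ} {G : Subgroup (Matrix.specialUnitaryGroup (Fin N) ℂ)}
  {E : M → Type*} [∀ x, AddCommGroup (E x)] [∀ x, Module ℂ (E x)]

/-- The transition function `ψ_ab`: `ψ_a (ψ_b⁻¹(x, ξ)) = (x, ψ_ab(x) ξ)`. -/
def GBundle.transition (B : GBundle d G E) (a b : B.ι) (x : M) : Mat N :=
  LinearMap.toMatrix' ((B.ψ a x).toLinearMap ∘ₗ (B.ψ b x).symm.toLinearMap)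

/-- The matrix `ψ_b T ψ_a⁻¹` of a linear map `T : E x → E y` in the trivializations `ψ_a` at `x`
and `ψ_b` at `y`. -/
def GBundle.matrixOf (B : GBundle d G E) (b a : B.ι) {y x : M} (T : E x →ₗ[ℂ] E y) : Mat N :=
  LinearMap.toMatrix' ((B.ψ b y).toLinearMap ∘ₗ T ∘ₗ (B.ψ a x).symm.toLinearMap)

/-- The expression of a matrix valued 1-form `θ` on `M` in the chart `φ`: the 1-form
`y ↦ (v ↦ θ_μ(y) v^μ)` on the target of the chart. -/
def formCoord (φ : OpenPartialHomeomorph M (EuclideanSpace ℝ (Fin d)))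
    (θ : ∀ x : M, TangentSpace (𝓡 d) x →L[ℝ] Mat N) (y : EuclideanSpace ℝ (Fin d)) :
    EuclideanSpace ℝ (Fin d) →L[ℝ] Mat N :=
  (θ (φ.symm y)).comp (mfderiv (𝓡 d) (𝓡 d) φ.symm y)

/-- A connection in the bundle: smooth `Lie(G)`-valued 1-forms `A^a` on the sets `W_a`, related by
`A^b = ψ_ab⁻¹ A^a ψ_ab + ψ_ab⁻¹ dψ_ab` on `W_a ∩ W_b`. Only the values of `A^a` over `W_a`
matter. -/
structure Connection (B : GBundle d G E) where
  A : B.ι → ∀ x : M, TangentSpace (𝓡 d) x →L[ℝ] Mat N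
  smooth : ∀ a, ∀ φ ∈ charts d M,
    ContDiffOn ℝ ∞ (formCoord φ (A a)) (φ.target ∩ φ.symm ⁻¹' B.W a)
  mem_lieAlg : ∀ a, ∀ x ∈ B.W a, ∀ v : TangentSpace (𝓡 d) x, A a x v ∈ lieAlg G
  compat : ∀ a b, ∀ x ∈ B.W a ∩ B.W b, ∀ v : TangentSpace (𝓡 d) x,
    A b x v = (B.transition a b x)⁻¹ * A a x v * B.transition a b x
      + (B.transition a b x)⁻¹ * mvfderiv (𝓡 d) (B.transition a b) x v

/-- The local curvature 2-form `F^a(x)(u, v) = F^a_{μν}(x) u^μ v^ν`, where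
`F^a_{μν} = ∂_μ A^a_ν - ∂_ν A^a_μ + [A^a_μ, A^a_ν]` in the preferred chart at `x`. -/
def Connection.localCurvature {B : GBundle d G E} (A : Connection B) (a : B.ι) (x : M)
    (u v : TangentSpace (𝓡 d) x) : Mat N :=
  let φ := chartAt (EuclideanSpace ℝ (Fin d)) x
  let u' : EuclideanSpace ℝ (Fin d) := mfderiv (𝓡 d) (𝓡 d) φ x u
  let v' : EuclideanSpace ℝ (Fin d) := mfderiv (𝓡 d) (𝓡 d) φ x v
  fderiv ℝ (formCoord φ (A.A a)) (φ x) u' v' - fderiv ℝ (formCoord φ (A.A a)) (φ x) v' u'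
    + (A.A a x u * A.A a x v - A.A a x v * A.A a x u)

/-- The curvature `F(x)(u, v) = F_{μν}(x) u^μ v^ν` as an endomorphism of the fibre `E x`:
`F(x) = ψ_a⁻¹ F^a(x) ψ_a` for (any) `a` with `x ∈ W_a`. -/
def Connection.curvature {B : GBundle d G E} (A : Connection B) (x : M)
    (u v : TangentSpace (𝓡 d) x) : E x →ₗ[ℂ] E x :=
  let a := (B.cover x).choose
  (B.ψ a x).symm.toLinearMap ∘ₗ Matrix.toLin' (A.localCurvature a x u v)
    ∘ₗ (B.ψ a x).toLinearMap

/-- `U t s : E_{γ(s)} → E_{γ(t)}`, `s, t ∈ [0,1]`, is the parallel transport along `γ` generated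
by the connection: it is multiplicative, and over each interval that `γ` maps into some `W_a` its
matrix `U^a_{t,s}` is an `H¹` solution of
`d/dt U^a_{t,s} = -A^a_μ(γ(t)) γ̇^μ(t) U^a_{t,s}`, `d/ds U^a_{t,s} = U^a_{t,s} A^a_μ(γ(s)) γ̇^μ(s)`,
`U^a_{s,s} = Id`. -/
structure Connection.IsParallelTransport {B : GBundle d G E} (A : Connection B) (γ : ℝ → M)
    (U : ∀ t s : ℝ, E (γ s) →ₗ[ℂ] E (γ t)) : Prop where
  comp : ∀ t ∈ Icc (0 : ℝ) 1, ∀ s ∈ Icc (0 : ℝ) 1, ∀ r ∈ Icc (0 : ℝ) 1,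
    U t s ∘ₗ U s r = U t r
  init : ∀ s ∈ Icc (0 : ℝ) 1, U s s = LinearMap.id
  deriv_fst : ∀ a : B.ι, ∀ s₀ t₀ : ℝ, 0 ≤ s₀ → s₀ ≤ t₀ → t₀ ≤ 1 →
    MapsTo γ (Icc s₀ t₀) (B.W a) → ∀ s ∈ Icc s₀ t₀,
    IsH1On s₀ t₀ (fun t => B.matrixOf a a (U t s)) ∧
    ∀ᵐ t ∂(volume.restrict (Icc s₀ t₀)), HasDerivAt (fun t => B.matrixOf a a (U t s))
      (-(A.A a (γ t) (velocity d γ t)) * B.matrixOf a a (U t s)) t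
  deriv_snd : ∀ a : B.ι, ∀ s₀ t₀ : ℝ, 0 ≤ s₀ → s₀ ≤ t₀ → t₀ ≤ 1 →
    MapsTo γ (Icc s₀ t₀) (B.W a) → ∀ t ∈ Icc s₀ t₀,
    IsH1On s₀ t₀ (fun s => B.matrixOf a a (U t s)) ∧
    ∀ᵐ s ∂(volume.restrict (Icc s₀ t₀)), HasDerivAt (fun s => B.matrixOf a a (U t s))
      (B.matrixOf a a (U t s) * A.A a (γ s) (velocity d γ s)) s

open Classical in
/-- The parallel transport `U_{t,s}(γ) : E_{γ(s)} → E_{γ(t)}` along `γ` generated by the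
connection (for `s, t ∈ [0,1]`, where it is unique). -/
def Connection.parallelTransport {B : GBundle d G E} (A : Connection B) (γ : ℝ → M) :
    ∀ t s : ℝ, E (γ s) →ₗ[ℂ] E (γ t) :=
  if h : ∃ U : ∀ t s : ℝ, E (γ s) →ₗ[ℂ] E (γ t), A.IsParallelTransport γ U then h.choose
  else fun _ _ => 0

end Bundles

end CurveTransport

end

noncomputable section

namespace CurveTransport

/-! ### Absolutely continuous functions with a given derivative -/

section AC

variable {V W : Type*} [NormedAddCommGroup V] [NormedSpace ℝ V] [NormedAddCommGroup W]
  [NormedSpace ℝ W]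

/-! On a short interval `[s,e]` that the curve maps into one chart lying over one trivialization,
the transport is the solution of a linear equation in a matrix algebra. Write `x` for the curve, `ξ`
for the variation and `α` for the connection form in coordinates. Then `Z(t) = U_{t,s}` solves `Z' =
-aZ` with `a = α(x)x'`, and its inverse `W(t) = U_{s,t}` solves `W' = Wa`. If `Y` solves the
equation with a perturbed coefficient `a₁`, then `WY` solves `v' = -bv` with `b = W(a₁ - a)Z`. Hence
`WY = 1 - ∫ b` up to an error quadratic in the `L¹` norm of `b` (`norm_sub_linear_approx_le`,
`norm_solution_sub_variation_le`). No regularity beyond `L¹` is needed for the coefficient.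

Since `H¹` controls both the supremum of a function and the `L¹` norm of its derivative, the
coefficient is a Fréchet differentiable function of the curve with values in `L¹`. Its derivative is
`δ = dα(ξ)x' + α(ξ')` (`H1Family.coeff_isLittleO`), so `Y(e)` has derivative `-Z(e) ∫ WδZ`. The
product rule gives `WδZ = W F(ξ, x') Z + (W α(ξ) Z)'`. Integrating turns the variation into the
curvature integral and the two boundary terms (`integral_coeff_variation_eq`,
`H1Family.hasFDerivAt_solution`).

To globalize, the formula is shown to be stable under two operations. In a product of transports
over adjacent intervals the Leibniz rule makes the boundary terms at the common point cancel
(`HasTransportDeriv.trans`). Under a change of trivialization at an end point, the derivative of the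
transition function is absorbed by the transformation law of the connection
(`HasTransportDeriv.change_trivialization`). For the curvature integrand to be the same in all
pictures, `dα + α ∧ α` must be covariant under gauge transformations and chart changes
(`curvForm_gauge`, `curvForm_pullback`). A subdivision of the interval (`interval_induction`)
finishes the proof.

Existence of the transport follows the same pattern: Picard iteration gives invertible solutions on
short intervals, these are horizontal frames, frames are glued after a constant change of basis, and
`U_{t,s} = T_t T_s⁻¹`. -/

/-- Absolute continuity passes to functions with smaller increments. -/
theorem ac_of_dist_le {X Y : Type*} [PseudoMetricSpace X] [PseudoMetricSpace Y]
    {f : ℝ → X} {h : ℝ → Y} {a b : ℝ} (K : ℝ)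
    (hh : AbsolutelyContinuousOnInterval h a b)
    (hf : ∀ x ∈ uIcc a b, ∀ y ∈ uIcc a b, dist (f x) (f y) ≤ K * dist (h x) (h y)) :
    AbsolutelyContinuousOnInterval f a b := by
  have h1 := Tendsto.const_mul K hh
  rw [mul_zero] at h1
  refine squeeze_zero' (Eventually.of_forall fun t => Finset.sum_nonneg fun i _ => dist_nonneg)
    ?_ h1
  have : ∀ᶠ E in AbsolutelyContinuousOnInterval.totalLengthFilter ⊓
      𝓟 (AbsolutelyContinuousOnInterval.disjWithin a b),
      E ∈ AbsolutelyContinuousOnInterval.disjWithin a b :=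
    mem_inf_of_right (mem_principal_self _)
  filter_upwards [this] with E hE
  rw [Finset.mul_sum]
  exact Finset.sum_le_sum fun i hi => hf _ (hE.1 i hi).1 _ (hE.1 i hi).2

theorem ac_prodMk {X Y : Type*} [PseudoMetricSpace X] [PseudoMetricSpace Y]
    {f : ℝ → X} {g : ℝ → Y} {a b : ℝ} (hf : AbsolutelyContinuousOnInterval f a b)
    (hg : AbsolutelyContinuousOnInterval g a b) :
    AbsolutelyContinuousOnInterval (fun t => (f t, g t)) a b := by
  have h1 := Tendsto.add hf hg
  rw [add_zero] at h1
  refine squeeze_zero (fun t => Finset.sum_nonneg fun i _ => dist_nonneg) (fun t => ?_) h1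
  rw [← Finset.sum_add_distrib]
  refine Finset.sum_le_sum fun i _ => ?_
  rw [Prod.dist_eq]
  exact max_le_add_of_nonneg dist_nonneg dist_nonneg

/-- A `C¹` map is locally Lipschitz, hence Lipschitz on the compact image of `f`, so the increments
of the composition are dominated by those of `f`. -/
theorem ac_comp_contDiffOn {f : ℝ → V} {F : V → W} {O : Set V} {a b : ℝ}
    (hf : AbsolutelyContinuousOnInterval f a b) (hO : IsOpen O) (hF : ContDiffOn ℝ 1 F O)
    (hm : ∀ t ∈ uIcc a b, f t ∈ O) :
    AbsolutelyContinuousOnInterval (fun t => F (f t)) a b := by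
  have hK : IsCompact (f '' uIcc a b) := isCompact_uIcc.image_of_continuousOn hf.continuousOn
  have hL : LocallyLipschitzOn (f '' uIcc a b) F := by
    rintro _ ⟨t, ht, rfl⟩
    obtain ⟨K, s, hs, hl⟩ :=
      ((hF.contDiffAt (hO.mem_nhds (hm t ht)))).exists_lipschitzOnWith
    exact ⟨K, s, mem_nhdsWithin_of_mem_nhds hs, hl⟩
  obtain ⟨K, hK⟩ := hL.exists_lipschitzOnWith_of_compact hK
  exact ac_of_dist_le K hf fun x hx y hy =>
    hK.dist_le_mul _ (mem_image_of_mem _ hx) _ (mem_image_of_mem _ hy)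

theorem ac_congr {X : Type*} [PseudoMetricSpace X] {f g : ℝ → X} {a b : ℝ}
    (hf : AbsolutelyContinuousOnInterval f a b) (hfg : ∀ t ∈ uIcc a b, f t = g t) :
    AbsolutelyContinuousOnInterval g a b :=
  ac_of_dist_le 1 hf fun x hx y hy => by rw [hfg x hx, hfg y hy, one_mul]

theorem ac_ae_differentiableAt [FiniteDimensional ℝ V] {f : ℝ → V} {a b : ℝ}
    (hf : AbsolutelyContinuousOnInterval f a b) :
    ∀ᵐ t, t ∈ uIcc a b → DifferentiableAt ℝ f t :=
  hf.boundedVariationOn.ae_differentiableAt_of_mem_uIcc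

theorem ac_const {X : Type*} [PseudoMetricSpace X] (c : X) (a b : ℝ) :
    AbsolutelyContinuousOnInterval (fun _ => c) a b := by
  simpa [AbsolutelyContinuousOnInterval] using tendsto_const_nhds

/-- Functions are controlled only on the closed interval, so two-sided derivatives can be
transferred only at interior points. The end points are discarded as a null set. -/
theorem ae_mem_Ioo_of_mem_Icc (a b : ℝ) : ∀ᵐ t : ℝ, t ∈ Icc a b → t ∈ Ioo a b := by
  have h₁ : ∀ᵐ x : ℝ, x ≠ a := by simp [ae_iff, measure_singleton]
  have h₂ : ∀ᵐ x : ℝ, x ≠ b := by simp [ae_iff, measure_singleton]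
  filter_upwards [h₁, h₂] with t h1 h2 ht
  exact ⟨lt_of_le_of_ne ht.1 (Ne.symm h1), lt_of_le_of_ne ht.2 h2⟩

/-- `f` is absolutely continuous on `[a,b]` with integrable almost everywhere derivative `f'`. -/
structure ACDeriv (a b : ℝ) (f f' : ℝ → V) : Prop where
  ac : AbsolutelyContinuousOnInterval f a b
  int : IntervalIntegrable f' volume a b
  hasDeriv : ∀ᵐ t, t ∈ Icc a b → HasDerivAt f (f' t) t

/-- Reduces the vector valued primitive to the scalar primitive of `‖g‖`, whose increments are
larger. -/
theorem ac_intervalIntegral {g : ℝ → V} {a b : ℝ}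
    (hg : IntervalIntegrable g volume a b) :
    AbsolutelyContinuousOnInterval (fun t => ∫ s in a..t, g s) a b := by
  refine ac_of_dist_le 1
    (hg.norm.absolutelyContinuousOnInterval_intervalIntegral (c := a) left_mem_uIcc) ?_
  intro x hx y hy
  have hi : ∀ z ∈ uIcc a b, IntervalIntegrable g volume a z := fun z hz =>
    hg.mono_set (uIcc_subset_uIcc left_mem_uIcc hz)
  rw [dist_eq_norm, dist_eq_norm, one_mul, intervalIntegral.integral_interval_sub_left (hi x hx)
    (hi y hy), intervalIntegral.integral_interval_sub_left (hi x hx).norm (hi y hy).norm]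
  exact intervalIntegral.norm_integral_le_abs_integral_norm

namespace ACDeriv

variable {a b : ℝ} {f f' : ℝ → V}

theorem mono (h : ACDeriv a b f f') {c d : ℝ} (hac : a ≤ c) (hcd : c ≤ d) (hdb : d ≤ b) :
    ACDeriv c d f f' := by
  have hs : uIcc c d ⊆ uIcc a b := by
    rw [uIcc_of_le hcd, uIcc_of_le (hac.trans (hcd.trans hdb))]; exact Icc_subset_Icc hac hdb
  refine ⟨h.ac.mono hs, h.int.mono_set hs, ?_⟩
  filter_upwards [h.hasDeriv] with t ht htt
  exact ht ⟨hac.trans htt.1, htt.2.trans hdb⟩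

theorem continuousOn (h : ACDeriv a b f f') : ContinuousOn f (uIcc a b) := h.ac.continuousOn

theorem congr_deriv (h : ACDeriv a b f f') (hab : a ≤ b) {g' : ℝ → V}
    (hg : ∀ᵐ t, t ∈ Icc a b → f' t = g' t) : ACDeriv a b f g' := by
  refine ⟨h.ac, ?_, ?_⟩
  · refine h.int.congr_ae ?_
    rw [uIoc_of_le hab, EventuallyEq, ae_restrict_iff' measurableSet_Ioc]
    filter_upwards [hg] with t ht htt using ht (Ioc_subset_Icc_self htt)
  · filter_upwards [h.hasDeriv, hg] with t h1 h2 ht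
    rw [← h2 ht]; exact h1 ht

/-- The difference of `f` and the primitive of `f'` is absolutely continuous with almost everywhere
vanishing derivative, hence constant. -/
theorem integral_eq [CompleteSpace V] (h : ACDeriv a b f f') (hab : a ≤ b) {t : ℝ}
    (ht : t ∈ Icc a b) :
    ∫ s in a..t, f' s = f t - f a := by
  have hg : AbsolutelyContinuousOnInterval (fun x => f x - ∫ s in a..x, f' s) a b :=
    h.ac.sub (ac_intervalIntegral h.int)
  have h0 : ∀ᵐ x, x ∈ uIcc a b → HasDerivAt (fun x => f x - ∫ s in a..x, f' s) 0 x := by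
    filter_upwards [h.hasDeriv, h.int.ae_hasDerivAt_integral] with x h1 h2 hx
    have := (h1 (by rwa [uIcc_of_le hab] at hx)).sub (h2 hx a left_mem_uIcc)
    rwa [sub_self] at this
  obtain ⟨C, hC⟩ := hg.const_of_ae_hasDerivAt_zero h0
  have h1 := hC a left_mem_uIcc
  have h2 := hC t (by rwa [uIcc_of_le hab])
  simp only [intervalIntegral.integral_same, sub_zero] at h1
  rw [← h1] at h2
  rw [← h2]; abel

/-- The converse half, by Lebesgue differentiation. Working with the integral equation makes gluing
and fixed point arguments possible without discussing derivatives. -/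
theorem of_integral [CompleteSpace V] (hab : a ≤ b) (hf' : IntervalIntegrable f' volume a b)
    (h : ∀ t ∈ Icc a b, f t = f a + ∫ s in a..t, f' s) : ACDeriv a b f f' := by
  have hac : AbsolutelyContinuousOnInterval (fun t => f a + ∫ s in a..t, f' s) a b :=
    (ac_const (f a) a b).add (ac_intervalIntegral hf')
  refine ⟨ac_congr hac fun t ht => (h t (by rwa [uIcc_of_le hab] at ht)).symm, hf', ?_⟩
  filter_upwards [hf'.ae_hasDerivAt_integral, ae_mem_Ioo_of_mem_Icc a b] with t h1 h2 ht
  have h3 := (h1 (by rwa [uIcc_of_le hab]) a left_mem_uIcc).const_add (f a)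
  refine h3.congr_of_eventuallyEq ?_
  filter_upwards [isOpen_Ioo.mem_nhds (h2 ht)] with s hs
  exact h s (Ioo_subset_Icc_self hs)

theorem glue [CompleteSpace V] {m : ℝ} (ham : a ≤ m) (hmb : m ≤ b) (h1 : ACDeriv a m f f')
    (h2 : ACDeriv m b f f') : ACDeriv a b f f' := by
  refine of_integral (ham.trans hmb) (h1.int.trans h2.int) fun t ht => ?_
  rcases le_total t m with h | h
  · rw [h1.integral_eq ham ⟨ht.1, h⟩]; abel
  · have e1 := h1.integral_eq ham ⟨ham, le_rfl⟩
    have e2 := h2.integral_eq hmb ⟨h, ht.2⟩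
    rw [← intervalIntegral.integral_add_adjacent_intervals h1.int
      ((h2.mono le_rfl h ht.2).int), e1, e2]
    abel

theorem congr (h : ACDeriv a b f f') (hab : a ≤ b) {g : ℝ → V}
    (hfg : ∀ t ∈ Icc a b, f t = g t) : ACDeriv a b g f' := by
  refine ⟨ac_congr h.ac (by rwa [uIcc_of_le hab]), h.int, ?_⟩
  filter_upwards [h.hasDeriv, ae_mem_Ioo_of_mem_Icc a b] with t h1 h2 ht
  refine (h1 ht).congr_of_eventuallyEq ?_
  filter_upwards [isOpen_Ioo.mem_nhds (h2 ht)] with s hs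
  exact (hfg s (Ioo_subset_Icc_self hs)).symm

end ACDeriv

/-! ### Products of continuous and integrable functions -/

theorem continuousOn_clm_apply_intervalIntegrable {c : ℝ → V →L[ℝ] W} {g : ℝ → V} {a b : ℝ}
    (hc : ContinuousOn c (uIcc a b)) (hg : IntervalIntegrable g volume a b) :
    IntervalIntegrable (fun t => c t (g t)) volume a b := by
  obtain ⟨C, hC⟩ := isCompact_uIcc.exists_bound_of_continuousOn hc
  rw [intervalIntegrable_iff] at hg ⊢
  have hc' : AEStronglyMeasurable c (volume.restrict (uIoc a b)) :=
    (hc.aestronglyMeasurable_of_isCompact isCompact_uIcc measurableSet_uIcc).mono_measure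
      (Measure.restrict_mono uIoc_subset_uIcc le_rfl)
  refine Integrable.mono' (hg.norm.const_mul C)
    ((ContinuousLinearMap.id ℝ (V →L[ℝ] W)).aestronglyMeasurable_comp₂ hc'
      hg.aestronglyMeasurable) ?_
  rw [ae_restrict_iff' measurableSet_uIoc]
  refine Eventually.of_forall fun t ht => ?_
  exact (c t).le_of_opNorm_le (hC t (uIoc_subset_uIcc ht)) _

theorem ACDeriv.comp {O : Set V} {F : V → W} {a b : ℝ} {f f' : ℝ → V} (hab : a ≤ b)
    (h : ACDeriv a b f f') (hO : IsOpen O) (hF : ContDiffOn ℝ 1 F O) (hm : MapsTo f (Icc a b) O) :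
    ACDeriv a b (fun t => F (f t)) (fun t => fderiv ℝ F (f t) (f' t)) := by
  have hm' : MapsTo f (uIcc a b) O := by rwa [uIcc_of_le hab]
  refine ⟨ac_comp_contDiffOn h.ac hO hF hm', continuousOn_clm_apply_intervalIntegrable
    ((hF.continuousOn_fderiv_of_isOpen hO le_rfl).comp h.continuousOn hm') h.int, ?_⟩
  filter_upwards [h.hasDeriv] with t h1 ht
  exact ((hF.differentiableOn one_ne_zero).differentiableAt
    (hO.mem_nhds (hm ht))).hasFDerivAt.comp_hasDerivAt t (h1 ht)

theorem ACDeriv.clm_apply {a b : ℝ} {c c' : ℝ → V →L[ℝ] W} {f f' : ℝ → V} (hc : ACDeriv a b c c')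
    (hf : ACDeriv a b f f') :
    ACDeriv a b (fun t => c t (f t)) (fun t => c' t (f t) + c t (f' t)) := by
  refine ⟨?_, ?_, ?_⟩
  · have h1 : ContDiff ℝ 1 (fun p : (V →L[ℝ] W) × V => p.1 p.2) :=
      isBoundedBilinearMap_apply.contDiff
    have h2 := ac_prodMk hc.ac hf.ac
    have h3 := ac_comp_contDiffOn h2 isOpen_univ h1.contDiffOn fun _ _ => mem_univ _
    exact h3
  · refine IntervalIntegrable.add ?_
      (continuousOn_clm_apply_intervalIntegrable hc.continuousOn hf.int)
    exact continuousOn_clm_apply_intervalIntegrable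
      (c := fun t => ContinuousLinearMap.apply ℝ W (f t)) (g := c')
      ((ContinuousLinearMap.apply ℝ W).continuous.comp_continuousOn hf.continuousOn) hc.int
  · filter_upwards [hc.hasDeriv, hf.hasDeriv] with t h1 h2 ht
    exact (h1 ht).clm_apply (h2 ht)

theorem ACDeriv.mul {𝔸 : Type*} [NormedRing 𝔸] [NormedAlgebra ℝ 𝔸] {a b : ℝ} {f f' g g' : ℝ → 𝔸}
    (hf : ACDeriv a b f f') (hg : ACDeriv a b g g') :
    ACDeriv a b (fun t => f t * g t) (fun t => f' t * g t + f t * g' t) := by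
  refine ⟨?_, ?_, ?_⟩
  · have h1 : ContDiff ℝ 1 (fun p : 𝔸 × 𝔸 => p.1 * p.2) := contDiff_mul
    have h2 := ac_prodMk hf.ac hg.ac
    have h3 := ac_comp_contDiffOn h2 isOpen_univ h1.contDiffOn fun _ _ => mem_univ _
    exact h3
  · exact (hf.int.mul_continuousOn hg.continuousOn).add (hg.int.continuousOn_mul hf.continuousOn)
  · filter_upwards [hf.hasDeriv, hg.hasDeriv] with t h1 h2 ht
    exact (h1 ht).mul (h2 ht)

theorem ACDeriv.sub {a b : ℝ} {f f' g g' : ℝ → V}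
    (hf : ACDeriv a b f f') (hg : ACDeriv a b g g') :
    ACDeriv a b (fun t => f t - g t) (fun t => f' t - g' t) := by
  refine ⟨hf.ac.sub hg.ac, hf.int.sub hg.int, ?_⟩
  filter_upwards [hf.hasDeriv, hg.hasDeriv] with t h1 h2 ht
  exact (h1 ht).sub (h2 ht)

theorem acDeriv_const (c : V) (a b : ℝ) : ACDeriv a b (fun _ => c) (fun _ => 0) :=
  ⟨ac_const c a b, by simp, Eventually.of_forall fun t _ => hasDerivAt_const t c⟩

/-! ### The class `H¹` -/

theorem intervalIntegrable_of_memLp_two {F : Type*} [NormedAddCommGroup F] {g : ℝ → F} {a b : ℝ}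
    (hab : a ≤ b) (hg : MemLp g 2 (volume.restrict (Icc a b))) :
    IntervalIntegrable g volume a b := by
  rw [intervalIntegrable_iff_integrableOn_Icc_of_le hab]
  exact hg.integrable (by norm_num)

theorem IsH1On.acDeriv [FiniteDimensional ℝ V] {a b : ℝ} {f : ℝ → V} (hab : a ≤ b)
    (h : IsH1On a b f) : ACDeriv a b f (deriv f) := by
  refine ⟨h.1, intervalIntegrable_of_memLp_two hab h.2, ?_⟩
  filter_upwards [ac_ae_differentiableAt h.1] with t ht htt
  exact (ht (by rwa [uIcc_of_le hab])).hasDerivAt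

theorem ACDeriv.isH1On {a b : ℝ} {f f' : ℝ → V} (h : ACDeriv a b f f')
    (hf' : MemLp f' 2 (volume.restrict (Icc a b))) : IsH1On a b f := by
  refine ⟨h.ac, hf'.ae_eq ?_⟩
  rw [EventuallyEq, ae_restrict_iff' measurableSet_Icc]
  filter_upwards [h.hasDeriv] with t h1 ht
  exact (h1 ht).deriv.symm

theorem IsH1On.memLp_deriv {a b : ℝ} {f f' : ℝ → V} (h : IsH1On a b f)
    (hd : ∀ᵐ t, t ∈ Icc a b → HasDerivAt f (f' t) t) :
    MemLp f' 2 (volume.restrict (Icc a b)) := by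
  refine h.2.ae_eq ?_
  rw [EventuallyEq, ae_restrict_iff' measurableSet_Icc]
  filter_upwards [hd] with t h1 ht
  exact (h1 ht).deriv

theorem memLp_two_glue {F : Type*} [NormedAddCommGroup F] {a m b : ℝ} {g : ℝ → F}
    (ham : a ≤ m) (hmb : m ≤ b)
    (h1 : MemLp g 2 (volume.restrict (Icc a m))) (h2 : MemLp g 2 (volume.restrict (Icc m b))) :
    MemLp g 2 (volume.restrict (Icc a b)) := by
  have hm : AEStronglyMeasurable g (volume.restrict (Icc a b)) := by
    rw [← Icc_union_Icc_eq_Icc ham hmb]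
    exact aestronglyMeasurable_union_iff.2 ⟨h1.1, h2.1⟩
  rw [memLp_two_iff_integrable_sq_norm hm]
  have e1 := (memLp_two_iff_integrable_sq_norm h1.1).1 h1
  have e2 := (memLp_two_iff_integrable_sq_norm h2.1).1 h2
  rw [← Icc_union_Icc_eq_Icc ham hmb]
  exact IntegrableOn.union e1 e2

theorem memLp_two_clm_apply {c : ℝ → V →L[ℝ] W} {g : ℝ → V} {a b : ℝ}
    (hc : ContinuousOn c (Icc a b)) (hg : MemLp g 2 (volume.restrict (Icc a b))) :
    MemLp (fun t => c t (g t)) 2 (volume.restrict (Icc a b)) := by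
  obtain ⟨C, hC⟩ := isCompact_Icc.exists_bound_of_continuousOn hc
  have hc' : AEStronglyMeasurable c (volume.restrict (Icc a b)) :=
    hc.aestronglyMeasurable_of_isCompact isCompact_Icc measurableSet_Icc
  refine hg.of_le_mul (c := C)
    ((ContinuousLinearMap.id ℝ (V →L[ℝ] W)).aestronglyMeasurable_comp₂ hc' hg.1) ?_
  rw [ae_restrict_iff' measurableSet_Icc]
  exact Eventually.of_forall fun t ht => (c t).le_of_opNorm_le (hC t ht) _

/-! ### The Sobolev norm dominates the supremum norm -/

/-- Cauchy–Schwarz against the constant function `1`. -/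
theorem integral_norm_deriv_le_h1Norm {a b : ℝ} {f : ℝ → V} (hab : a ≤ b) (h : IsH1On a b f) :
    ∫ t in a..b, ‖deriv f t‖ ≤ Real.sqrt (b - a) * h1Norm a b f := by
  have hn : 0 ≤ ∫ t in a..b, ‖f t‖ ^ 2 :=
    intervalIntegral.integral_nonneg hab fun t _ => by positivity
  have hn' : 0 ≤ ∫ t in a..b, ‖deriv f t‖ ^ 2 :=
    intervalIntegral.integral_nonneg hab fun t _ => by positivity
  have hm : MemLp (fun t => ‖deriv f t‖) (ENNReal.ofReal 2) (volume.restrict (Ioc a b)) := by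
    have := h.2.norm.mono_measure (Measure.restrict_mono (Ioc_subset_Icc_self (a := a) (b := b))
      (le_refl (volume : Measure ℝ)))
    simpa using this
  have h1 : MemLp (fun _ : ℝ => (1 : ℝ)) (ENNReal.ofReal 2) (volume.restrict (Ioc a b)) :=
    memLp_const 1
  have key := integral_mul_le_Lp_mul_Lq_of_nonneg (μ := volume.restrict (Ioc a b))
    (p := 2) (q := 2) ((Real.holderConjugate_iff).2 ⟨by norm_num, by norm_num⟩)
    (f := fun _ => (1 : ℝ)) (g := fun t => ‖deriv f t‖) (Eventually.of_forall fun _ => zero_le_one)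
    (Eventually.of_forall fun _ => norm_nonneg _) h1 hm
  have e1 : ∫ _ in Ioc a b, (1 : ℝ) ^ (2 : ℝ) = b - a := by simp [hab]
  rw [e1, ← Real.sqrt_eq_rpow, ← Real.sqrt_eq_rpow] at key
  simp only [one_mul, Real.rpow_two] at key
  rw [← intervalIntegral.integral_of_le hab, ← intervalIntegral.integral_of_le hab] at key
  refine key.trans (mul_le_mul_of_nonneg_left ?_ (Real.sqrt_nonneg _))
  exact Real.sqrt_le_sqrt (by linarith)

/-- At a minimum point `s` of `‖f‖` the value is bounded by the `L²` mean of `f`, which gives the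
summand `1 / √(b - a)`. The variation from `s` to `t` is at most `∫ ‖f'‖`, which gives `√(b - a)`.
-/
theorem exists_norm_le_h1Norm {a b : ℝ} (hab : a < b) : ∃ C : ℝ, 0 ≤ C ∧
    ∀ {V : Type*} [NormedAddCommGroup V] [NormedSpace ℝ V] [FiniteDimensional ℝ V] {f : ℝ → V},
      IsH1On a b f → ∀ t ∈ Icc a b, ‖f t‖ ≤ C * h1Norm a b f := by
  refine ⟨1 / Real.sqrt (b - a) + Real.sqrt (b - a), by positivity, ?_⟩
  intro V _ _ _ f hf t ht
  have hba : 0 < Real.sqrt (b - a) := Real.sqrt_pos.2 (by linarith)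
  have hc : ContinuousOn f (Icc a b) := by
    simpa [uIcc_of_le hab.le] using hf.1.continuousOn
  obtain ⟨s, hs, hmin⟩ := isCompact_Icc.exists_isMinOn (nonempty_Icc.2 hab.le) hc.norm
  have hD := hf.acDeriv hab.le
  have hn' : 0 ≤ ∫ t in a..b, ‖deriv f t‖ ^ 2 :=
    intervalIntegral.integral_nonneg hab.le fun t _ => by positivity
  have hsq : (b - a) * ‖f s‖ ^ 2 ≤ ∫ t in a..b, ‖f t‖ ^ 2 := by
    have h1 : ∫ _ in a..b, ‖f s‖ ^ 2 ≤ ∫ t in a..b, ‖f t‖ ^ 2 := by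
      refine intervalIntegral.integral_mono_on hab.le (by simp) ?_ fun x hx => ?_
      · exact (ContinuousOn.intervalIntegrable (by rw [uIcc_of_le hab.le]; exact hc.norm.pow 2))
      · exact pow_le_pow_left₀ (norm_nonneg _) (hmin hx) 2
    simpa using h1
  have hs' : ‖f s‖ ≤ 1 / Real.sqrt (b - a) * h1Norm a b f := by
    rw [one_div, inv_mul_eq_div, le_div_iff₀ hba, mul_comm, h1Norm]
    refine Real.le_sqrt_of_sq_le ?_
    rw [mul_pow, Real.sq_sqrt (by linarith)]
    linarith
  have hst : ‖f t - f s‖ ≤ ∫ t in a..b, ‖deriv f t‖ := by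
    have e1 := hD.integral_eq hab.le ht
    have e2 := hD.integral_eq hab.le hs
    have hi : ∀ z ∈ Icc a b, IntervalIntegrable (deriv f) volume a z := fun z hz =>
      (hD.mono le_rfl hz.1 hz.2).int
    have e3 : f t - f s = ∫ x in s..t, deriv f x := by
      rw [← intervalIntegral.integral_interval_sub_left (hi t ht) (hi s hs), e1, e2]; abel
    rw [e3]
    refine intervalIntegral.norm_integral_le_integral_norm_uIoc.trans ?_
    rw [intervalIntegral.integral_of_le hab.le]
    refine setIntegral_mono_set ?_ (Eventually.of_forall fun _ => norm_nonneg _) ?_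
    · exact ((intervalIntegrable_iff_integrableOn_Ioc_of_le hab.le).1 hD.int).norm
    · refine LE.le.eventuallyLE ?_
      intro x hx
      exact ⟨lt_of_le_of_lt (le_min hs.1 ht.1) hx.1, hx.2.trans (max_le hs.2 ht.2)⟩
  have := integral_norm_deriv_le_h1Norm hab.le hf
  calc ‖f t‖ = ‖f s + (f t - f s)‖ := by rw [add_sub_cancel]
    _ ≤ ‖f s‖ + ‖f t - f s‖ := norm_add_le _ _
    _ ≤ _ := by rw [add_mul]; linarith

end AC

/-! ### Induction over intervals -/

/-- A property of intervals that holds for small intervals and for unions of adjacent intervals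
holds for all intervals. -/
theorem interval_induction {a b : ℝ} (hab : a ≤ b) {Q : ℝ → ℝ → Prop}
    (hloc : ∀ t ∈ Icc a b, ∃ U : Set ℝ, IsOpen U ∧ t ∈ U ∧
      ∀ s e, a ≤ s → s ≤ e → e ≤ b → Icc s e ⊆ U → Q s e)
    (hglue : ∀ s m e, a ≤ s → s ≤ m → m ≤ e → e ≤ b → Q s m → Q m e → Q s e) : Q a b := by
  choose! U hU hmem hQ using hloc
  -- Compactness gives a subdivision, eventually constant equal to `b`, each piece of which lies in
  -- one of the good open sets. The pieces are then joined from left to right.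
  obtain ⟨t, h0, hmono, ⟨n, hn⟩, hcov⟩ := exists_monotone_Icc_subset_open_cover_Icc hab
    (c := fun i : Icc a b => Subtype.val ⁻¹' U i)
    (fun i => (hU i i.2).preimage continuous_subtype_val)
    (fun x _ => mem_iUnion.2 ⟨x, hmem x x.2⟩)
  have step : ∀ k, Q (t k) (t (k + 1)) := fun k => by
    obtain ⟨i, hi⟩ := hcov k
    refine hQ i i.2 _ _ (t k).2.1 (hmono k.le_succ) (t (k + 1)).2.2 fun x hx => ?_
    exact hi (show (⟨x, (t k).2.1.trans hx.1, hx.2.trans (t (k + 1)).2.2⟩ : Icc a b) ∈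
      Icc (t k) (t (k + 1)) from ⟨hx.1, hx.2⟩)
  have main : ∀ k, Q a (t (k + 1)) := fun k => by
    induction k with
    | zero => have := step 0; rwa [h0] at this
    | succ k ih =>
      exact hglue _ _ _ le_rfl (t (k + 1)).2.1 (hmono (k + 1).le_succ) (t (k + 1 + 1)).2.2 ih
        (step (k + 1))
  have := main n
  rwa [hn (n + 1) n.le_succ] at this

/-! ### Linear differential equations with integrable coefficients -/

section ODE

variable {𝔸 : Type*} [NormedRing 𝔸] [NormedAlgebra ℝ 𝔸]

/-- The Volterra operator `u ↦ ∫ k u` has supremum norm at most the `L¹` norm of `k`. Both the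
Picard contraction and the second order estimate rest on this. -/
theorem norm_integral_mul_le {s e C : ℝ} {k u : ℝ → 𝔸} (hse : s ≤ e)
    (hk : IntervalIntegrable k volume s e) (hu : ∀ t ∈ Icc s e, ‖u t‖ ≤ C) {t : ℝ}
    (ht : t ∈ Icc s e) :
    ‖∫ τ in s..t, k τ * u τ‖ ≤ (∫ τ in s..e, ‖k τ‖) * C := by
  have hC : 0 ≤ C := (norm_nonneg _).trans (hu s ⟨le_rfl, hse⟩)
  have hkt : IntervalIntegrable k volume s t := hk.mono_set (by
    rw [uIcc_of_le ht.1, uIcc_of_le hse]; exact Icc_subset_Icc_right ht.2)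
  have h1 : ‖∫ τ in s..t, k τ * u τ‖ ≤ ∫ τ in s..t, ‖k τ‖ * C := by
    refine intervalIntegral.norm_integral_le_of_norm_le ht.1 ?_ (hkt.norm.mul_const C)
    refine Eventually.of_forall fun τ hτ => (norm_mul_le _ _).trans ?_
    exact mul_le_mul_of_nonneg_left (hu τ ⟨hτ.1.le, hτ.2.trans ht.2⟩) (norm_nonneg _)
  rw [intervalIntegral.integral_mul_const] at h1
  refine h1.trans (mul_le_mul_of_nonneg_right ?_ hC)
  exact intervalIntegral.integral_mono_interval le_rfl ht.1 ht.2
    (Eventually.of_forall fun _ => norm_nonneg _) hk.norm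

/-- Second order estimate for the solution of `v' = -b v`, `v s = 1`. -/
theorem norm_sub_linear_approx_le {s e : ℝ} {b v : ℝ → 𝔸} (hse : s ≤ e)
    (hb : IntervalIntegrable b volume s e) (hv : ContinuousOn v (Icc s e))
    (hsol : ∀ t ∈ Icc s e, v t = 1 - ∫ τ in s..t, b τ * v τ)
    (hsmall : ∫ τ in s..e, ‖b τ‖ ≤ 1 / 2) :
    ‖v e - 1 + ∫ τ in s..e, b τ‖ ≤ 2 * ‖(1 : 𝔸)‖ * (∫ τ in s..e, ‖b τ‖) ^ 2 := by
  set β := ∫ τ in s..e, ‖b τ‖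
  have hβ : 0 ≤ β := intervalIntegral.integral_nonneg hse fun _ _ => norm_nonneg _
  obtain ⟨t₀, ht₀, hmax⟩ := isCompact_Icc.exists_isMaxOn (nonempty_Icc.2 hse) hv.norm
  have hdev : ∀ t ∈ Icc s e, ‖v t - 1‖ ≤ β * ‖v t₀‖ := fun t ht => by
    rw [hsol t ht, sub_sub_cancel_left, norm_neg]
    exact norm_integral_mul_le hse hb (fun τ hτ => hmax hτ) ht
  -- At the maximum point `t₀` the deviation bound gives `‖v t₀‖ ≤ ‖1‖ + ‖v t₀‖ / 2`, since the
  -- integral of `‖b‖` is at most `1/2`.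
  have hS : ‖v t₀‖ ≤ 2 * ‖(1 : 𝔸)‖ := by
    have h1 : ‖v t₀‖ ≤ ‖(1 : 𝔸)‖ + β * ‖v t₀‖ :=
      calc ‖v t₀‖ = ‖1 + (v t₀ - 1)‖ := by rw [add_sub_cancel]
        _ ≤ _ := (norm_add_le _ _).trans (by linarith [hdev t₀ ht₀])
    nlinarith [norm_nonneg (v t₀)]
  have he : e ∈ Icc s e := ⟨hse, le_rfl⟩
  have hbv : IntervalIntegrable (fun τ => b τ * v τ) volume s e :=
    hb.mul_continuousOn (by rwa [uIcc_of_le hse])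
  -- The error of the linear approximation is again a Volterra integral, now of `v - 1`, which is
  -- already of first order. This produces the square.
  have h2 : v e - 1 + ∫ τ in s..e, b τ = -∫ τ in s..e, b τ * (v τ - 1) := by
    simp only [mul_sub, mul_one]
    rw [intervalIntegral.integral_sub hbv hb, hsol e he]; abel
  rw [h2, norm_neg]
  refine (norm_integral_mul_le hse hb hdev he).trans ?_
  calc β * (β * ‖v t₀‖) ≤ β * (β * (2 * ‖(1 : 𝔸)‖)) := by gcongr
    _ = _ := by ring

variable [CompleteSpace 𝔸]

/-- The linear equation `u' = -k u`, `u s = 1`, has an invertible solution on intervals on which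
`k` has small integral. -/
theorem exists_linear_solution (hone : ‖(1 : 𝔸)‖ ≤ 1) {s e : ℝ} {k : ℝ → 𝔸} (hse : s ≤ e)
    (hk : IntervalIntegrable k volume s e) (hsmall : ∫ τ in s..e, ‖k τ‖ ≤ 1 / 4) :
    ∃ u : ℝ → 𝔸, ACDeriv s e u (fun t => -(k t * u t)) ∧ ∀ t ∈ Icc s e, IsUnit (u t) := by
  -- Continuous functions on `[s,e]` are extended by their end values to `ℝ`, so that interval
  -- integrals of them make sense.
  let ext : C(Icc s e, 𝔸) → ℝ → 𝔸 := fun u τ => u (projIcc s e hse τ)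
  have hext : ∀ u, Continuous (ext u) := fun u => u.continuous.comp continuous_projIcc
  have hint : ∀ u, IntervalIntegrable (fun τ => k τ * ext u τ) volume s e := fun u =>
    hk.mul_continuousOn (hext u).continuousOn
  have hcont : ∀ u, Continuous (fun t : Icc s e => 1 - ∫ τ in s..t, k τ * ext u τ) := fun u => by
    refine continuous_const.sub ?_
    have h1 := intervalIntegral.continuousOn_primitive_interval' (hint u) left_mem_uIcc
    rw [uIcc_of_le hse] at h1
    exact continuousOn_iff_continuous_domRestrict.1 h1
  let Φ : C(Icc s e, 𝔸) → C(Icc s e, 𝔸) := fun u => ⟨_, hcont u⟩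
  have hΦ : ContractingWith (1 / 4) Φ := by
    refine ⟨by rw [← NNReal.coe_lt_coe]; norm_num, LipschitzWith.of_dist_le_mul fun u v => ?_⟩
    rw [ContinuousMap.dist_le (by positivity)]
    intro t
    have h1 : Φ u t - Φ v t = -∫ τ in s..t, k τ * (ext u τ - ext v τ) := by
      have hsub : ∀ w, IntervalIntegrable (fun τ => k τ * ext w τ) volume s t := fun w =>
        (hint w).mono_set (by
          rw [uIcc_of_le t.2.1, uIcc_of_le hse]; exact Icc_subset_Icc_right t.2.2)
      simp only [mul_sub]
      rw [intervalIntegral.integral_sub (hsub u) (hsub v)]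
      simp [Φ]
    rw [dist_eq_norm, h1, norm_neg]
    refine (norm_integral_mul_le hse hk (C := dist u v) (fun τ _ => ?_) t.2).trans ?_
    · rw [← dist_eq_norm]; exact ContinuousMap.dist_apply_le_dist _
    · refine mul_le_mul_of_nonneg_right (hsmall.trans ?_) dist_nonneg
      norm_num
  set u := hΦ.fixedPoint
  have hfix : ∀ t : Icc s e, u t = 1 - ∫ τ in s..t, k τ * ext u τ := fun t => by
    have h1 : Φ u = u := hΦ.fixedPoint_isFixedPt
    exact (congrArg (fun w : C(Icc s e, 𝔸) => w t) h1).symm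
  have hdev : ∀ t : Icc s e, ‖u t - 1‖ ≤ 1 / 4 * ‖u‖ := fun t => by
    rw [hfix t, sub_sub_cancel_left, norm_neg]
    refine (norm_integral_mul_le hse hk (C := ‖u‖) (fun τ _ => u.norm_coe_le_norm _) t.2).trans ?_
    exact mul_le_mul_of_nonneg_right hsmall (norm_nonneg _)
  have hnorm : ‖u‖ ≤ 1 + 1 / 4 * ‖u‖ := by
    rw [ContinuousMap.norm_le _ (by positivity)]
    intro t
    calc ‖u t‖ = ‖1 + (u t - 1)‖ := by rw [add_sub_cancel]
      _ ≤ _ := (norm_add_le _ _).trans (add_le_add hone (hdev t))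
  refine ⟨ext u, ?_, fun t ht => ?_⟩
  · refine ACDeriv.of_integral hse (hint u).neg fun t ht => ?_
    have h1 := hfix ⟨t, ht⟩
    have h2 := hfix ⟨s, le_rfl, hse⟩
    simp only [intervalIntegral.integral_same, sub_zero] at h2
    simp only [ext, projIcc_left, projIcc_of_mem hse ht, intervalIntegral.integral_neg]
    rw [h1, h2, sub_eq_add_neg]
  -- With contraction constant `1/4` the fixed point has norm at most `4/3`, so it stays within
  -- `1/3` of `1` and the Neumann series inverts it.
  · have h1 : ‖1 - ext u t‖ < 1 := by
      rw [norm_sub_rev]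
      have := hdev (projIcc s e hse t)
      simp only [ext]; linarith
    have h2 := isUnit_one_sub_of_norm_lt_one h1
    rwa [sub_sub_cancel] at h2

end ODE

/-! ### Dependence of the solution of a linear equation on its coefficient -/

section Parametric

variable {V : Type*} [NormedAddCommGroup V] [NormedSpace ℝ V]
  {𝔸 : Type*} [NormedRing 𝔸] [NormedAlgebra ℝ 𝔸]

/-- The curvature `(dα + α ∧ α)(y)(u, v)` of an algebra valued 1-form on a vector space. -/
def curvForm (α : V → V →L[ℝ] 𝔸) (y u v : V) : 𝔸 :=
  fderiv ℝ α y u v - fderiv ℝ α y v u + (α y u * α y v - α y v * α y u)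

/-- `curvForm` as a bounded bilinear map. -/
def curvCLM (α : V → V →L[ℝ] 𝔸) (y : V) : V →L[ℝ] V →L[ℝ] 𝔸 :=
  fderiv ℝ α y - (fderiv ℝ α y).flip +
    ((((ContinuousLinearMap.mul ℝ 𝔸).comp (α y)).flip.comp (α y)).flip
      - (((ContinuousLinearMap.mul ℝ 𝔸).comp (α y)).flip.comp (α y)))

theorem curvCLM_apply (α : V → V →L[ℝ] 𝔸) (y u v : V) : curvCLM α y u v = curvForm α y u v := by
  simp [curvCLM, curvForm]

theorem continuousOn_curvCLM {α : V → V →L[ℝ] 𝔸} {O : Set V} (hO : IsOpen O)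
    (hα : ContDiffOn ℝ 1 α O) : ContinuousOn (curvCLM α) O := by
  have h1 := hα.continuousOn_fderiv_of_isOpen hO le_rfl
  have h2 := hα.continuousOn
  have h3 : ContinuousOn
      (fun y => (((ContinuousLinearMap.mul ℝ 𝔸).comp (α y)).flip.comp (α y))) O :=
    ((ContinuousLinearMap.flipₗᵢ ℝ V 𝔸 𝔸).continuous.comp_continuousOn
      (continuousOn_const.clm_comp h2)).clm_comp h2
  exact (h1.sub ((ContinuousLinearMap.flipₗᵢ ℝ V V 𝔸).continuous.comp_continuousOn h1)).add
    (((ContinuousLinearMap.flipₗᵢ ℝ V V 𝔸).continuous.comp_continuousOn h3).sub h3)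

/-- First order expansion of `α(x) x'` under a perturbation of `x`. -/
theorem integral_norm_coeff_sub_le {O : Set V} {α : V → V →L[ℝ] 𝔸} {s e : ℝ} (hse : s ≤ e)
    {x x' y y' ξ ξ' : ℝ → V} (hO : IsOpen O) (hα : ContDiffOn ℝ 1 α O)
    (hx : ContinuousOn x (Icc s e)) (hy : ContinuousOn y (Icc s e)) (hξ : ContinuousOn ξ (Icc s e))
    (hxO : MapsTo x (Icc s e) O) (hyO : MapsTo y (Icc s e) O)
    (hx' : IntervalIntegrable x' volume s e) (hy' : IntervalIntegrable y' volume s e)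
    (hξ' : IntervalIntegrable ξ' volume s e) {ε L D S : ℝ} (hL : 0 ≤ L) (hε : 0 ≤ ε)
    (hα1 : ∀ t ∈ Icc s e, ‖α (x t)‖ ≤ L) (hα2 : ∀ t ∈ Icc s e, ‖fderiv ℝ α (x t)‖ ≤ L)
    (hα3 : ∀ t ∈ Icc s e, ‖α (y t) - α (x t) - fderiv ℝ α (x t) (y t - x t)‖
      ≤ ε * ‖y t - x t‖)
    (hD : ∀ t ∈ Icc s e, ‖y t - x t‖ ≤ D) (hS : ∀ t ∈ Icc s e, ‖y t - x t - ξ t‖ ≤ S) :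
    ∫ t in s..e, ‖α (y t) (y' t) - α (x t) (x' t)
        - (fderiv ℝ α (x t) (ξ t) (x' t) + α (x t) (ξ' t))‖
      ≤ (ε * D + L * S) * (∫ t in s..e, ‖x' t‖)
        + (ε + L) * D * (∫ t in s..e, ‖y' t - x' t‖)
        + L * ∫ t in s..e, ‖y' t - x' t - ξ' t‖ := by
  have hu : uIcc s e = Icc s e := uIcc_of_le hse
  have hs : s ∈ Icc s e := ⟨le_rfl, hse⟩
  have hD0 : 0 ≤ D := (norm_nonneg _).trans (hD s hs)
  have i1 : IntervalIntegrable (fun t => α (y t) (y' t)) volume s e :=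
    continuousOn_clm_apply_intervalIntegrable
      (by rw [hu]; exact hα.continuousOn.comp hy hyO) hy'
  have i2 : IntervalIntegrable (fun t => α (x t) (x' t)) volume s e :=
    continuousOn_clm_apply_intervalIntegrable
      (by rw [hu]; exact hα.continuousOn.comp hx hxO) hx'
  have i3 : IntervalIntegrable (fun t => α (x t) (ξ' t)) volume s e :=
    continuousOn_clm_apply_intervalIntegrable
      (by rw [hu]; exact hα.continuousOn.comp hx hxO) hξ'
  have i4 : IntervalIntegrable (fun t => fderiv ℝ α (x t) (ξ t) (x' t)) volume s e := by
    refine continuousOn_clm_apply_intervalIntegrable ?_ hx'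
    rw [hu]
    exact ((hα.continuousOn_fderiv_of_isOpen hO le_rfl).comp hx hxO).clm_apply hξ
  have j1 := hx'.norm.const_mul (ε * D + L * S)
  have j2 := (hy'.sub hx').norm.const_mul ((ε + L) * D)
  have j3 := ((hy'.sub hx').sub hξ').norm.const_mul L
  rw [← intervalIntegral.integral_const_mul, ← intervalIntegral.integral_const_mul,
    ← intervalIntegral.integral_const_mul, ← intervalIntegral.integral_add j1 j2,
    ← intervalIntegral.integral_add (j1.add j2) j3]
  refine intervalIntegral.integral_mono_on hse ((i1.sub i2).sub (i4.add i3)).norm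
    ((j1.add j2).add j3) fun t ht => ?_
  set A := fderiv ℝ α (x t)
  -- The four terms are the Taylor remainder of `α`, the defect of `ξ` as derivative of the
  -- position, the second order product of increments, and the defect of `ξ'` as derivative of the
  -- velocity.
  have e1 : α (y t) (y' t) - α (x t) (x' t) - (A (ξ t) (x' t) + α (x t) (ξ' t))
      = ((α (y t) - α (x t) - A (y t - x t)) (x' t) + A (y t - x t - ξ t) (x' t))
        + (α (y t) - α (x t)) (y' t - x' t) + α (x t) (y' t - x' t - ξ' t) := by
    simp only [map_sub, sub_apply]
    abel
  rw [e1]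
  have b0 : ‖α (y t) - α (x t)‖ ≤ (ε + L) * D := by
    have : α (y t) - α (x t) = (α (y t) - α (x t) - A (y t - x t)) + A (y t - x t) := by abel
    rw [this]
    refine (norm_add_le _ _).trans ?_
    have h1 := hα3 t ht
    have h2 := A.le_of_opNorm_le (hα2 t ht) (y t - x t)
    have h3 := hD t ht
    nlinarith
  have b1 : ‖(α (y t) - α (x t) - A (y t - x t)) (x' t)‖ ≤ ε * D * ‖x' t‖ :=
    ContinuousLinearMap.le_of_opNorm_le _
      ((hα3 t ht).trans (mul_le_mul_of_nonneg_left (hD t ht) hε)) _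
  have b2 : ‖A (y t - x t - ξ t) (x' t)‖ ≤ L * S * ‖x' t‖ :=
    ContinuousLinearMap.le_of_opNorm_le _ ((A.le_of_opNorm_le (hα2 t ht) _).trans
      (mul_le_mul_of_nonneg_left (hS t ht) hL)) _
  have b3 := ContinuousLinearMap.le_of_opNorm_le _ b0 (y' t - x' t)
  have b4 := ContinuousLinearMap.le_of_opNorm_le _ (hα1 t ht) (y' t - x' t - ξ' t)
  calc _ ≤ ‖(α (y t) - α (x t) - A (y t - x t)) (x' t)‖ + ‖A (y t - x t - ξ t) (x' t)‖
        + ‖(α (y t) - α (x t)) (y' t - x' t)‖ + ‖α (x t) (y' t - x' t - ξ' t)‖ :=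
        (norm_add_le _ _).trans (add_le_add ((norm_add_le _ _).trans
          (add_le_add (norm_add_le _ _) le_rfl)) le_rfl)
    _ ≤ _ := by nlinarith

/-- A `C¹` map is uniformly differentiable along compact sets. -/
theorem eventually_norm_taylor_le {F : Type*} [NormedAddCommGroup F] [NormedSpace ℝ F]
    {O K : Set V} {f : V → F} (hO : IsOpen O)
    (hf : ContDiffOn ℝ 1 f O) (hK : IsCompact K) (hKO : K ⊆ O) {ε : ℝ} (hε : 0 < ε) :
    ∃ ρ > 0, ∀ x ∈ K, ∀ y, ‖y - x‖ < ρ → y ∈ O ∧ ‖f y - f x - fderiv ℝ f x (y - x)‖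
      ≤ ε * ‖y - x‖ := by
  have key : ∀ᶠ h in 𝓝 (0 : V), ∀ x ∈ K, x + h ∈ O ∧
      ‖f (x + h) - f x - fderiv ℝ f x h‖ ≤ ε * ‖h‖ := by
    -- Compactness reduces the uniform statement to a neighbourhood of each `x₀`. Strict
    -- differentiability gives the estimate with the derivative at `x₀`, and continuity of the
    -- derivative replaces it by the derivative at the nearby point; each costs `ε / 2`.
    refine hK.eventually_forall_of_forall_eventually fun x₀ hx₀ => ?_
    have hxO : O ∈ 𝓝 x₀ := hO.mem_nhds (hKO hx₀)
    have hc : ContDiffAt ℝ 1 f x₀ := hf.contDiffAt hxO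
    have h1 := (hc.hasStrictFDerivAt one_ne_zero).isLittleO.def (half_pos hε)
    have h2 : ∀ᶠ x in 𝓝 x₀, ‖fderiv ℝ f x - fderiv ℝ f x₀‖ ≤ ε / 2 := by
      have := ((hf.continuousOn_fderiv_of_isOpen hO le_rfl).continuousAt hxO)
      have h3 := Metric.tendsto_nhds.1 this.tendsto (ε / 2) (half_pos hε)
      filter_upwards [h3] with x hx
      rw [← dist_eq_norm]; exact hx.le
    have t1 : Tendsto (fun q : V × V => q.2 + q.1) (𝓝 (0, x₀)) (𝓝 x₀) := by
      have : Tendsto (fun q : V × V => q.2 + q.1) (𝓝 (0, x₀)) (𝓝 (x₀ + 0)) :=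
        (continuous_snd.add continuous_fst).tendsto (0, x₀)
      rwa [add_zero] at this
    have t0 : Tendsto (fun q : V × V => q.2) (𝓝 (0, x₀)) (𝓝 x₀) :=
      continuous_snd.tendsto (0, x₀)
    have t2 : Tendsto (fun q : V × V => (q.2 + q.1, q.2)) (𝓝 (0, x₀)) (𝓝 (x₀, x₀)) := by
      rw [nhds_prod_eq (x := x₀)]; exact t1.prodMk t0
    filter_upwards [t2.eventually h1, t0.eventually h2, t1.eventually_mem hxO] with q e1 e2 e3
    refine ⟨e3, ?_⟩
    simp only [add_sub_cancel_left] at e1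
    have e4 : f (q.2 + q.1) - f q.2 - fderiv ℝ f q.2 q.1
        = (f (q.2 + q.1) - f q.2 - fderiv ℝ f x₀ q.1)
          - (fderiv ℝ f q.2 - fderiv ℝ f x₀) q.1 := by
      rw [sub_apply]; abel
    rw [e4]
    refine (norm_sub_le _ _).trans ?_
    have e5 := ContinuousLinearMap.le_of_opNorm_le _ e2 q.1
    linarith
  obtain ⟨ρ, hρ, h⟩ := Metric.eventually_nhds_iff.1 key
  refine ⟨ρ, hρ, fun x hx y hy => ?_⟩
  have := h (y := y - x) (by simpa using hy) x hx
  rwa [add_sub_cancel] at this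

end Parametric

/-! ### Comparison of solutions, and the curvature by integration by parts. -/

section Variation

variable {V : Type*} [NormedAddCommGroup V] [NormedSpace ℝ V]
  {𝔸 : Type*} [NormedRing 𝔸] [NormedAlgebra ℝ 𝔸]

theorem intervalIntegrable_mul_mul {R : Type*} [NormedRing R] {s e : ℝ} {W g Z : ℝ → R}
    (hse : s ≤ e)
    (hW : ContinuousOn W (Icc s e)) (hZ : ContinuousOn Z (Icc s e))
    (hg : IntervalIntegrable g volume s e) :
    IntervalIntegrable (fun t => W t * g t * Z t) volume s e := by
  rw [← uIcc_of_le hse] at hW hZ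
  exact (hg.continuousOn_mul hW).mul_continuousOn hZ

theorem integral_norm_mul_mul_le {R : Type*} [NormedRing R] {s e κ : ℝ} {W g Z : ℝ → R}
    (hse : s ≤ e)
    (hW : ContinuousOn W (Icc s e)) (hZ : ContinuousOn Z (Icc s e))
    (hg : IntervalIntegrable g volume s e) (hWκ : ∀ t ∈ Icc s e, ‖W t‖ ≤ κ)
    (hZκ : ∀ t ∈ Icc s e, ‖Z t‖ ≤ κ) :
    ∫ t in s..e, ‖W t * g t * Z t‖ ≤ κ ^ 2 * ∫ t in s..e, ‖g t‖ := by
  have hκ : 0 ≤ κ := (norm_nonneg _).trans (hWκ s ⟨le_rfl, hse⟩)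
  rw [← intervalIntegral.integral_const_mul]
  refine intervalIntegral.integral_mono_on hse (intervalIntegrable_mul_mul hse hW hZ hg).norm
    (hg.norm.const_mul _) fun t ht => ?_
  calc ‖W t * g t * Z t‖ ≤ ‖W t‖ * ‖g t‖ * ‖Z t‖ :=
        (norm_mul_le _ _).trans (mul_le_mul_of_nonneg_right (norm_mul_le _ _) (norm_nonneg _))
    _ ≤ κ * ‖g t‖ * κ := by
        gcongr
        · exact hWκ t ht
        · exact hZκ t ht
    _ = _ := by ring

/-- Comparison of the solutions `Z`, `Y` of `Z' = -aZ`, `Y' = -a₁Y` with the first order variation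
of the coefficient, where `W` is the inverse of `Z`. -/
theorem norm_solution_sub_variation_le [CompleteSpace 𝔸] {s e κ : ℝ} (hse : s ≤ e)
    {W Z Y a a₁ δ : ℝ → 𝔸}
    (hW : ACDeriv s e W (fun t => W t * a t)) (hZ : ContinuousOn Z (Icc s e))
    (hZW : ∀ t ∈ Icc s e, Z t * W t = 1) (hY : ACDeriv s e Y (fun t => -(a₁ t * Y t)))
    (hWs : W s = 1) (hYs : Y s = 1)
    (ha : IntervalIntegrable a volume s e) (ha₁ : IntervalIntegrable a₁ volume s e)
    (hδ : IntervalIntegrable δ volume s e)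
    (hWκ : ∀ t ∈ Icc s e, ‖W t‖ ≤ κ) (hZκ : ∀ t ∈ Icc s e, ‖Z t‖ ≤ κ)
    (hsmall : κ ^ 2 * (∫ t in s..e, ‖a₁ t - a t‖) ≤ 1 / 2) :
    ‖W e * Y e - 1 + ∫ t in s..e, W t * δ t * Z t‖
      ≤ 2 * ‖(1 : 𝔸)‖ * (κ ^ 2 * ∫ t in s..e, ‖a₁ t - a t‖) ^ 2
        + κ ^ 2 * ∫ t in s..e, ‖a₁ t - a t - δ t‖ := by
  have hWc : ContinuousOn W (Icc s e) := by simpa [uIcc_of_le hse] using hW.continuousOn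
  have hYc : ContinuousOn Y (Icc s e) := by simpa [uIcc_of_le hse] using hY.continuousOn
  set b : ℝ → 𝔸 := fun t => W t * (a₁ t - a t) * Z t with hb_def
  have hb : IntervalIntegrable b volume s e := intervalIntegrable_mul_mul hse hWc hZ (ha₁.sub ha)
  have hbn := integral_norm_mul_mul_le hse hWc hZ (ha₁.sub ha) hWκ hZκ
  -- `(WY)' = W(a - a₁)Y`, and inserting `ZW = 1` before `Y` makes this a linear equation for `WY`
  -- itself, with the small coefficient `b`.
  have hsol : ∀ t ∈ Icc s e, W t * Y t = 1 - ∫ τ in s..t, b τ * (W τ * Y τ) := fun t ht => by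
    have h1 := (hW.mul hY).integral_eq hse ht
    rw [hWs, hYs, one_mul] at h1
    have h2 : ∫ τ in s..t, b τ * (W τ * Y τ)
        = ∫ τ in s..t, -(W τ * a τ * Y τ + W τ * -(a₁ τ * Y τ)) := by
      refine intervalIntegral.integral_congr fun τ hτ => ?_
      rw [uIcc_of_le ht.1] at hτ
      have h3 := hZW τ ⟨hτ.1, hτ.2.trans ht.2⟩
      calc b τ * (W τ * Y τ) = W τ * (a₁ τ - a τ) * (Z τ * W τ) * Y τ := by
            simp only [hb_def, mul_assoc]
        _ = _ := by rw [h3]; noncomm_ring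
    rw [h2, intervalIntegral.integral_neg, h1]; abel
  have h1 := norm_sub_linear_approx_le hse hb (hWc.mul hYc) hsol (hbn.trans hsmall)
  have hbδ : IntervalIntegrable (fun t => W t * δ t * Z t) volume s e :=
    intervalIntegrable_mul_mul hse hWc hZ hδ
  have h2 : W e * Y e - 1 + ∫ t in s..e, W t * δ t * Z t
      = (W e * Y e - 1 + ∫ t in s..e, b t) - ∫ t in s..e, W t * (a₁ t - a t - δ t) * Z t := by
    have : ∫ t in s..e, W t * (a₁ t - a t - δ t) * Z t
        = (∫ t in s..e, b t) - ∫ t in s..e, W t * δ t * Z t := by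
      rw [← intervalIntegral.integral_sub hb hbδ]
      refine intervalIntegral.integral_congr fun τ _ => ?_
      simp only [hb_def]; noncomm_ring
    rw [this]; abel
  rw [h2]
  refine (norm_sub_le _ _).trans (add_le_add (h1.trans ?_) ?_)
  · have h0 : 0 ≤ ∫ t in s..e, ‖b t‖ :=
      intervalIntegral.integral_nonneg hse fun _ _ => norm_nonneg _
    gcongr
  · refine (intervalIntegral.norm_integral_le_integral_norm hse).trans ?_
    exact integral_norm_mul_mul_le hse hWc hZ ((ha₁.sub ha).sub hδ) hWκ hZκ

theorem intervalIntegrable_curvForm {O : Set V} {α : V → V →L[ℝ] 𝔸} {s e : ℝ} (hse : s ≤ e)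
    {x x' ξ : ℝ → V} (hO : IsOpen O) (hα : ContDiffOn ℝ 1 α O) (hx : ContinuousOn x (Icc s e))
    (hxO : MapsTo x (Icc s e) O) (hx' : IntervalIntegrable x' volume s e)
    (hξ : ContinuousOn ξ (Icc s e)) :
    IntervalIntegrable (fun t => curvForm α (x t) (ξ t) (x' t)) volume s e := by
  have : IntervalIntegrable (fun t => curvCLM α (x t) (ξ t) (x' t)) volume s e := by
    refine continuousOn_clm_apply_intervalIntegrable ?_ hx'
    rw [uIcc_of_le hse]
    exact ((continuousOn_curvCLM hO hα).comp hx hxO).clm_apply hξ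
  simpa only [curvCLM_apply] using this

/-- Integration by parts turns the variation of the coefficient into curvature. -/
theorem integral_coeff_variation_eq [CompleteSpace 𝔸] {O : Set V} {α : V → V →L[ℝ] 𝔸} {s e : ℝ}
    (hse : s ≤ e) {x x' ξ ξ' : ℝ → V} {W Z : ℝ → 𝔸} (hO : IsOpen O) (hα : ContDiffOn ℝ 1 α O)
    (hx : ACDeriv s e x x') (hξ : ACDeriv s e ξ ξ') (hxO : MapsTo x (Icc s e) O)
    (hW : ACDeriv s e W (fun t => W t * α (x t) (x' t)))
    (hZ : ACDeriv s e Z (fun t => -(α (x t) (x' t) * Z t))) :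
    ∫ t in s..e, W t * (fderiv ℝ α (x t) (ξ t) (x' t) + α (x t) (ξ' t)) * Z t
      = (∫ t in s..e, W t * curvForm α (x t) (ξ t) (x' t) * Z t)
        + (W e * α (x e) (ξ e) * Z e - W s * α (x s) (ξ s) * Z s) := by
  have hu : uIcc s e = Icc s e := uIcc_of_le hse
  have hWc : ContinuousOn W (Icc s e) := by simpa [hu] using hW.continuousOn
  have hZc : ContinuousOn Z (Icc s e) := by simpa [hu] using hZ.continuousOn
  have hxc : ContinuousOn x (Icc s e) := by simpa [hu] using hx.continuousOn
  have hξc : ContinuousOn ξ (Icc s e) := by simpa [hu] using hξ.continuousOn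
  have hαξ := (hx.comp hse hO hα hxO).clm_apply hξ
  -- The derivative of `W α(x)(ξ) Z` contains `dα(x')(ξ)`, `α(ξ')` and the commutator of `α(x')`
  -- with `α(ξ)`. Adding `W F(ξ, x') Z` cancels the first and the last and leaves `dα(ξ)(x') +
  -- α(ξ')`.
  have h1 := ((hW.mul hαξ).mul hZ)
  rw [← h1.integral_eq hse ⟨hse, le_rfl⟩, ← intervalIntegral.integral_add ?_ h1.int]
  · refine intervalIntegral.integral_congr fun t _ => ?_
    simp only [curvForm]
    noncomm_ring
  · exact intervalIntegrable_mul_mul hse hWc hZc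
      (intervalIntegrable_curvForm hse hO hα hxc hxO hx.int hξc)

end Variation

/-! ### Fréchet differentiability of solutions along families of `H¹` curves. -/

section Frechet

variable {V : Type*} [NormedAddCommGroup V] [NormedSpace ℝ V] [FiniteDimensional ℝ V]
  {𝔸 : Type*} [NormedRing 𝔸] [NormedAlgebra ℝ 𝔸]
  {P : Type*} [NormedAddCommGroup P] [NormedSpace ℝ P]

theorem IsH1On.sub {a b : ℝ} {f g : ℝ → V} (hab : a ≤ b) (hf : IsH1On a b f) (hg : IsH1On a b g) :
    IsH1On a b (fun t => f t - g t) :=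
  ((hf.acDeriv hab).sub (hg.acDeriv hab)).isH1On (hf.2.sub hg.2)

theorem ACDeriv.integral_norm_le_h1Norm {F : Type*} [NormedAddCommGroup F] [NormedSpace ℝ F]
    {a b : ℝ} {f f' : ℝ → F} (hab : a ≤ b)
    (h : ACDeriv a b f f') (hf : IsH1On a b f) :
    ∫ t in a..b, ‖f' t‖ ≤ Real.sqrt (b - a) * h1Norm a b f := by
  refine le_of_eq_of_le ?_ (integral_norm_deriv_le_h1Norm hab hf)
  refine intervalIntegral.integral_congr_ae ?_
  rw [uIoc_of_le hab]
  filter_upwards [h.hasDeriv] with t h1 ht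
  rw [(h1 (Ioc_subset_Icc_self ht)).deriv]

/-- A constant bounding the supremum norm and the `L¹` norm of the derivative by the `H¹` norm. -/
theorem exists_sobolev_const {s e : ℝ} (hse : s < e) (V : Type*) [NormedAddCommGroup V]
    [NormedSpace ℝ V] [FiniteDimensional ℝ V] : ∃ C : ℝ, 0 ≤ C ∧ ∀ f f' : ℝ → V,
      IsH1On s e f → ACDeriv s e f f' →
      (∀ t ∈ Icc s e, ‖f t‖ ≤ C * h1Norm s e f) ∧ ∫ t in s..e, ‖f' t‖ ≤ C * h1Norm s e f := by
  obtain ⟨C, hC, h⟩ := exists_norm_le_h1Norm hse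
  have hn : ∀ f : ℝ → V, 0 ≤ h1Norm s e f := fun f => Real.sqrt_nonneg _
  refine ⟨C + Real.sqrt (e - s), by positivity, fun f f' hf hf' => ⟨fun t ht => ?_, ?_⟩⟩
  · refine (h hf t ht).trans (mul_le_mul_of_nonneg_right ?_ (hn f))
    linarith [Real.sqrt_nonneg (e - s)]
  · refine (hf'.integral_norm_le_h1Norm hse.le hf).trans (mul_le_mul_of_nonneg_right ?_ (hn f))
    linarith

/-- Data of a differentiable family `y p` of `H¹` curves in a vector space, with value `x` and
derivative `ξ` at `p₀`. -/
structure H1Family (s e : ℝ) (O : Set V) (x : ℝ → V) (y : P → ℝ → V) (ξ : P →ₗ[ℝ] (ℝ → V))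
    (p₀ : P) : Prop where
  lt : s < e
  isOpen : IsOpen O
  base : IsH1On s e x
  mapsTo : MapsTo x (Icc s e) O
  near : ∀ᶠ p in 𝓝 p₀, IsH1On s e (y p)
  tangent : ∀ p, IsH1On s e (ξ p)
  bounded : ∃ C : ℝ, ∀ p, h1Norm s e (ξ p) ≤ C * ‖p‖
  isLittleO : (fun p => h1Norm s e (fun t => y p t - x t - ξ (p - p₀) t))
    =o[𝓝 p₀] (fun p => p - p₀)

namespace H1Family

variable {s e : ℝ} {O : Set V} {x : ℝ → V} {y : P → ℝ → V} {ξ : P →ₗ[ℝ] (ℝ → V)} {p₀ : P}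

theorem exists_tangent_bound (h : H1Family s e O x y ξ p₀) : ∃ K : ℝ, 0 ≤ K ∧
    ∀ p, (∀ t ∈ Icc s e, ‖ξ p t‖ ≤ K * ‖p‖) ∧ ∫ t in s..e, ‖deriv (ξ p) t‖ ≤ K * ‖p‖ := by
  obtain ⟨C₀, hC₀, hsob⟩ := exists_sobolev_const h.lt V
  obtain ⟨C, hC⟩ := h.bounded
  refine ⟨C₀ * |C|, by positivity, fun p => ?_⟩
  have h1 := hsob (ξ p) _ (h.tangent p) ((h.tangent p).acDeriv h.lt.le)
  have h2 : C₀ * h1Norm s e (ξ p) ≤ C₀ * |C| * ‖p‖ := by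
    rw [mul_assoc]
    refine mul_le_mul_of_nonneg_left ((hC p).trans ?_) hC₀
    exact mul_le_mul_of_nonneg_right (le_abs_self C) (norm_nonneg p)
  exact ⟨fun t ht => (h1.1 t ht).trans h2, h1.2.trans h2⟩

/-- The Sobolev constant turns the `H¹` remainder into bounds for the supremum and for the `L¹` norm
of the derivative. The remainder is eventually at most `‖p - p₀‖`, so adding the bounded linear term
gives the Lipschitz constant. -/
theorem exists_bounds (h : H1Family s e O x y ξ p₀) : ∃ K C₀ : ℝ, 0 ≤ K ∧ 0 ≤ C₀ ∧
    ∀ᶠ p in 𝓝 p₀, (∀ t ∈ Icc s e, ‖y p t - x t‖ ≤ K * ‖p - p₀‖) ∧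
      (∀ t ∈ Icc s e, ‖y p t - x t - ξ (p - p₀) t‖
        ≤ C₀ * h1Norm s e (fun t => y p t - x t - ξ (p - p₀) t)) ∧
      (∫ t in s..e, ‖deriv (y p) t - deriv x t‖ ≤ K * ‖p - p₀‖) ∧
      (∫ t in s..e, ‖deriv (y p) t - deriv x t - deriv (ξ (p - p₀)) t‖
        ≤ C₀ * h1Norm s e (fun t => y p t - x t - ξ (p - p₀) t)) := by
  obtain ⟨C₀, hC₀, hsob⟩ := exists_sobolev_const h.lt V
  obtain ⟨K, hK, hKb⟩ := h.exists_tangent_bound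
  have hse := h.lt.le
  refine ⟨K + C₀, C₀, by positivity, hC₀, ?_⟩
  filter_upwards [h.near, h.isLittleO.def one_pos] with p hp hN
  rw [one_mul] at hN
  replace hN := (le_abs_self _).trans hN
  set N := h1Norm s e (fun t => y p t - x t - ξ (p - p₀) t)
  have hy := hp.acDeriv hse
  have hx := h.base.acDeriv hse
  have hξ := (h.tangent (p - p₀)).acDeriv hse
  have h1 := hsob _ _ ((hp.sub hse h.base).sub hse (h.tangent (p - p₀))) ((hy.sub hx).sub hξ)
  have hb := hKb (p - p₀)
  have hN' : C₀ * N ≤ C₀ * ‖p - p₀‖ := mul_le_mul_of_nonneg_left hN hC₀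
  refine ⟨fun t ht => ?_, h1.1, ?_, h1.2⟩
  · have e1 : y p t - x t = ξ (p - p₀) t + (y p t - x t - ξ (p - p₀) t) := by abel
    rw [e1, add_mul]
    exact (norm_add_le _ _).trans (add_le_add (hb.1 t ht) ((h1.1 t ht).trans hN'))
  · have e1 : ∫ t in s..e, ‖deriv (y p) t - deriv x t‖ ≤ ∫ t in s..e,
        (‖deriv (ξ (p - p₀)) t‖ + ‖deriv (y p) t - deriv x t - deriv (ξ (p - p₀)) t‖) := by
      refine intervalIntegral.integral_mono_on hse (hy.int.sub hx.int).norm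
        (hξ.int.norm.add ((hy.int.sub hx.int).sub hξ.int).norm) fun t _ => ?_
      refine le_trans (le_of_eq ?_) (norm_add_le _ _)
      congr 1; abel
    rw [intervalIntegral.integral_add hξ.int.norm ((hy.int.sub hx.int).sub hξ.int).norm] at e1
    rw [add_mul]
    exact e1.trans (add_le_add hb.2 (h1.2.trans hN'))

theorem tendsto_norm_sub {F : Type*} [NormedAddCommGroup F] (p₀ : F) :
    Tendsto (fun p => ‖p - p₀‖) (𝓝 p₀) (𝓝 0) := by
  have : Continuous fun p : F => ‖p - p₀‖ := by fun_prop
  simpa using this.tendsto p₀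

theorem eventually_mapsTo (h : H1Family s e O x y ξ p₀) :
    ∀ᶠ p in 𝓝 p₀, MapsTo (y p) (Icc s e) O := by
  obtain ⟨K, C₀, hK, hC₀, hev⟩ := h.exists_bounds
  have hxc : ContinuousOn x (Icc s e) := by simpa [uIcc_of_le h.lt.le] using h.base.1.continuousOn
  have hKc : IsCompact (x '' Icc s e) := isCompact_Icc.image_of_continuousOn hxc
  -- Applied to the zero function: only the uniform tube of radius `ρ` around the compact image
  -- inside `O` is used.
  obtain ⟨ρ, hρ, hball⟩ := eventually_norm_taylor_le (f := fun _ : V => (0 : ℝ)) h.isOpen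
    contDiffOn_const hKc h.mapsTo.image_subset one_pos
  have h1 : Tendsto (fun p => K * ‖p - p₀‖) (𝓝 p₀) (𝓝 0) := by
    simpa using (tendsto_norm_sub p₀).const_mul K
  filter_upwards [hev, h1.eventually_lt_const hρ] with p hp hp' t ht
  exact (hball (x t) (mem_image_of_mem _ ht) (y p t) ((hp.1 t ht).trans_lt hp')).1

/-- The coefficient `α(y) y'` is differentiable at `p₀` as an `L¹` function. -/
theorem coeff_isLittleO (h : H1Family s e O x y ξ p₀) {α : V → V →L[ℝ] 𝔸}
    (hα : ContDiffOn ℝ 1 α O) :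
    (fun p => ∫ t in s..e, ‖α (y p t) (deriv (y p) t) - α (x t) (deriv x t)
        - (fderiv ℝ α (x t) (ξ (p - p₀) t) (deriv x t) + α (x t) (deriv (ξ (p - p₀)) t))‖)
      =o[𝓝 p₀] (fun p => p - p₀) := by
  obtain ⟨K, C₀, hK, hC₀, hev⟩ := h.exists_bounds
  have hse := h.lt.le
  have hc : ∀ {f : ℝ → V}, IsH1On s e f → ContinuousOn f (Icc s e) := fun hf => by
    simpa [uIcc_of_le hse] using hf.1.continuousOn
  have hxc := hc h.base
  have hKc : IsCompact (x '' Icc s e) := isCompact_Icc.image_of_continuousOn hxc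
  obtain ⟨L₁, hL₁⟩ := isCompact_Icc.exists_bound_of_continuousOn
    (hα.continuousOn.comp hxc h.mapsTo)
  obtain ⟨L₂, hL₂⟩ := isCompact_Icc.exists_bound_of_continuousOn
    ((hα.continuousOn_fderiv_of_isOpen h.isOpen le_rfl).comp hxc h.mapsTo)
  set L := max (max L₁ L₂) 0
  set X := ∫ t in s..e, ‖deriv x t‖
  have hX : 0 ≤ X := intervalIntegral.integral_nonneg hse fun _ _ => norm_nonneg _
  have hL : 0 ≤ L := le_max_right _ _
  have hq := tendsto_norm_sub p₀
  -- Collects the part of the estimate that is of lower order whatever `ε` is: multiples of the `H¹`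
  -- remainder and a term quadratic in `‖p - p₀‖`.
  have hrest : (fun p => (L * C₀ * X + L * C₀) * h1Norm s e (fun t => y p t - x t - ξ (p - p₀) t)
      + ((1 + L) * K ^ 2 * ‖p - p₀‖) * ‖p - p₀‖) =o[𝓝 p₀] (fun p => p - p₀) := by
    refine (h.isLittleO.const_mul_left _).add ?_
    have h1 : (fun p => (1 + L) * K ^ 2 * ‖p - p₀‖) =o[𝓝 p₀] (fun _ => (1 : ℝ)) := by
      rw [Asymptotics.isLittleO_one_iff]
      simpa using hq.const_mul ((1 + L) * K ^ 2)
    have h2 := h1.mul_isBigO (Asymptotics.isBigO_refl (fun p => ‖p - p₀‖) (𝓝 p₀))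
    simp only [one_mul] at h2
    exact h2.of_norm_right
  rw [Asymptotics.isLittleO_iff]
  intro c hc0
  -- Chosen so that the only remaining first order term `ε K X ‖p - p₀‖` takes at most half of `c`.
  -- The bound `ε ≤ 1` frees the other terms of `ε`.
  set ε := min 1 (c / 2 / (K * X + 1))
  have hKX : 0 < K * X + 1 := by positivity
  have hε : 0 < ε := lt_min one_pos (by positivity)
  have hεc : ε * (K * X) ≤ c / 2 := by
    have h1 : ε ≤ c / 2 / (K * X + 1) := min_le_right _ _
    rw [le_div_iff₀ hKX] at h1
    nlinarith
  obtain ⟨ρ, hρ, hball⟩ := eventually_norm_taylor_le h.isOpen hα hKc h.mapsTo.image_subset hε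
  have h1 : Tendsto (fun p => K * ‖p - p₀‖) (𝓝 p₀) (𝓝 0) := by simpa using hq.const_mul K
  filter_upwards [hev, h1.eventually_lt_const hρ, h.near, h.eventually_mapsTo,
    hrest.def (half_pos hc0)] with p hp hpρ hpH hpO hprest
  have hN : 0 ≤ h1Norm s e (fun t => y p t - x t - ξ (p - p₀) t) := Real.sqrt_nonneg _
  set N := h1Norm s e (fun t => y p t - x t - ξ (p - p₀) t)
  set q := ‖p - p₀‖
  have hq0 : 0 ≤ q := norm_nonneg _
  obtain ⟨b1, b2, b3, b4⟩ := hp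
  have key := integral_norm_coeff_sub_le hse h.isOpen hα hxc (hc hpH)
    (hc (h.tangent (p - p₀))) h.mapsTo hpO (h.base.acDeriv hse).int (hpH.acDeriv hse).int
    ((h.tangent (p - p₀)).acDeriv hse).int hL hε.le
    (fun t ht => (hL₁ t ht).trans ((le_max_left _ _).trans (le_max_left _ _)))
    (fun t ht => (hL₂ t ht).trans ((le_max_right _ _).trans (le_max_left _ _)))
    (fun t ht => (hball (x t) (mem_image_of_mem _ ht) (y p t) ((b1 t ht).trans_lt hpρ)).2)
    b1 b2
  rw [Real.norm_of_nonneg (intervalIntegral.integral_nonneg hse fun _ _ => norm_nonneg _)]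
  refine key.trans ?_
  have hprest' := (le_abs_self _).trans hprest
  have hε1 : ε ≤ 1 := min_le_left _ _
  calc (ε * (K * q) + L * (C₀ * N)) * X + (ε + L) * (K * q)
        * (∫ t in s..e, ‖deriv (y p) t - deriv x t‖)
        + L * ∫ t in s..e, ‖deriv (y p) t - deriv x t - deriv (ξ (p - p₀)) t‖
      ≤ (ε * (K * q) + L * (C₀ * N)) * X + (1 + L) * (K * q) * (K * q) + L * (C₀ * N) := by
        have b0 : 0 ≤ ∫ t in s..e, ‖deriv (y p) t - deriv x t‖ :=
          intervalIntegral.integral_nonneg hse fun _ _ => norm_nonneg _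
        gcongr
    _ = ε * (K * X) * q + ((L * C₀ * X + L * C₀) * N + ((1 + L) * K ^ 2 * q) * q) := by ring
    _ ≤ c / 2 * q + c / 2 * q := add_le_add (mul_le_mul_of_nonneg_right hεc hq0) hprest'
    _ = c * q := by ring

/-- The linearized coefficient depends boundedly on `p` in `L¹`. This makes the candidate derivative
continuous and the increment of the coefficient of order `‖p - p₀‖`. -/
theorem exists_variation_bound (h : H1Family s e O x y ξ p₀) {α : V → V →L[ℝ] 𝔸}
    (hα : ContDiffOn ℝ 1 α O) : ∃ C : ℝ, 0 ≤ C ∧ ∀ p,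
    IntervalIntegrable (fun t => fderiv ℝ α (x t) (ξ p t) (deriv x t)
      + α (x t) (deriv (ξ p) t)) volume s e ∧
    ∫ t in s..e, ‖fderiv ℝ α (x t) (ξ p t) (deriv x t) + α (x t) (deriv (ξ p) t)‖ ≤ C * ‖p‖ := by
  obtain ⟨K, hK, hb⟩ := h.exists_tangent_bound
  have hse := h.lt.le
  have hu : uIcc s e = Icc s e := uIcc_of_le hse
  have hc : ∀ {f : ℝ → V}, IsH1On s e f → ContinuousOn f (Icc s e) := fun hf => by
    simpa [hu] using hf.1.continuousOn
  have hxc := hc h.base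
  have hx := h.base.acDeriv hse
  have c1 := hα.continuousOn.comp hxc h.mapsTo
  have c2 := (hα.continuousOn_fderiv_of_isOpen h.isOpen le_rfl).comp hxc h.mapsTo
  obtain ⟨L₁, hL₁⟩ := isCompact_Icc.exists_bound_of_continuousOn c1
  obtain ⟨L₂, hL₂⟩ := isCompact_Icc.exists_bound_of_continuousOn c2
  have hs : s ∈ Icc s e := ⟨le_rfl, hse⟩
  have hL₁0 := (norm_nonneg _).trans (hL₁ s hs)
  have hL₂0 := (norm_nonneg _).trans (hL₂ s hs)
  set X := ∫ t in s..e, ‖deriv x t‖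
  have hX : 0 ≤ X := intervalIntegral.integral_nonneg hse fun _ _ => norm_nonneg _
  refine ⟨L₂ * K * X + L₁ * K, by positivity, fun p => ?_⟩
  have hξ := (h.tangent p).acDeriv hse
  have i1 : IntervalIntegrable (fun t => fderiv ℝ α (x t) (ξ p t) (deriv x t)) volume s e :=
    continuousOn_clm_apply_intervalIntegrable
      (by rw [hu]; exact c2.clm_apply (hc (h.tangent p))) hx.int
  have i2 : IntervalIntegrable (fun t => α (x t) (deriv (ξ p) t)) volume s e :=
    continuousOn_clm_apply_intervalIntegrable (by rw [hu]; exact c1) hξ.int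
  refine ⟨i1.add i2, ?_⟩
  have j1 := hx.int.norm.const_mul (L₂ * (K * ‖p‖))
  have j2 := hξ.int.norm.const_mul L₁
  calc _ ≤ ∫ t in s..e, (L₂ * (K * ‖p‖) * ‖deriv x t‖ + L₁ * ‖deriv (ξ p) t‖) := by
        refine intervalIntegral.integral_mono_on hse (i1.add i2).norm (j1.add j2) fun t ht => ?_
        refine (norm_add_le _ _).trans (add_le_add ?_ ?_)
        · refine ContinuousLinearMap.le_of_opNorm_le _
            ((ContinuousLinearMap.le_of_opNorm_le _ (hL₂ t ht) _).trans ?_) _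
          exact mul_le_mul_of_nonneg_left ((hb p).1 t ht) hL₂0
        · exact ContinuousLinearMap.le_of_opNorm_le _ (hL₁ t ht) _
    _ = L₂ * (K * ‖p‖) * X + L₁ * ∫ t in s..e, ‖deriv (ξ p) t‖ := by
        rw [intervalIntegral.integral_add j1 j2, intervalIntegral.integral_const_mul,
          intervalIntegral.integral_const_mul]
    _ ≤ L₂ * (K * ‖p‖) * X + L₁ * (K * ‖p‖) := by gcongr; exact (hb p).2
    _ = _ := by ring

/-- The derivative with respect to `p` of the solution of `Y' = -α(y p)(y p)' Y`, `Y s = 1`. -/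
theorem hasFDerivAt_solution [CompleteSpace 𝔸] (h : H1Family s e O x y ξ p₀)
    {α : V → V →L[ℝ] 𝔸} (hα : ContDiffOn ℝ 1 α O) {W Z : ℝ → 𝔸} {Y : P → ℝ → 𝔸}
    (hW : ACDeriv s e W (fun t => W t * α (x t) (deriv x t)))
    (hZ : ACDeriv s e Z (fun t => -(α (x t) (deriv x t) * Z t)))
    (hZW : ∀ t ∈ Icc s e, Z t * W t = 1) (hWs : W s = 1) (hZs : Z s = 1)
    (hY : ∀ᶠ p in 𝓝 p₀, ACDeriv s e (Y p) (fun t => -(α (y p t) (deriv (y p) t) * Y p t)) ∧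
      Y p s = 1) (hY₀ : Y p₀ e = Z e) :
    ∃ D : P →L[ℝ] 𝔸, (∀ p, D p = -(∫ t in s..e, Z e * W t
        * curvForm α (x t) (ξ p t) (deriv x t) * Z t)
        - α (x e) (ξ p e) * Z e + Z e * α (x s) (ξ p s)) ∧
      HasFDerivAt (fun p => Y p e) D p₀ := by
  have hse := h.lt.le
  have hu : uIcc s e = Icc s e := uIcc_of_le hse
  have hc : ∀ {f : ℝ → V}, IsH1On s e f → ContinuousOn f (Icc s e) := fun hf => by
    simpa [hu] using hf.1.continuousOn
  have hWc : ContinuousOn W (Icc s e) := by simpa [hu] using hW.continuousOn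
  have hZc : ContinuousOn Z (Icc s e) := by simpa [hu] using hZ.continuousOn
  have hx := h.base.acDeriv hse
  have hxc := hc h.base
  have he : e ∈ Icc s e := ⟨hse, le_rfl⟩
  obtain ⟨C, hC, hvar⟩ := h.exists_variation_bound hα
  obtain ⟨κ₁, hκ₁⟩ := isCompact_Icc.exists_bound_of_continuousOn hWc
  obtain ⟨κ₂, hκ₂⟩ := isCompact_Icc.exists_bound_of_continuousOn hZc
  set κ := max κ₁ κ₂
  have hWκ : ∀ t ∈ Icc s e, ‖W t‖ ≤ κ := fun t ht => (hκ₁ t ht).trans (le_max_left _ _)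
  have hZκ : ∀ t ∈ Icc s e, ‖Z t‖ ≤ κ := fun t ht => (hκ₂ t ht).trans (le_max_right _ _)
  set a : ℝ → 𝔸 := fun t => α (x t) (deriv x t) with ha_def
  set δ : P → ℝ → 𝔸 := fun p t =>
    fderiv ℝ α (x t) (ξ p t) (deriv x t) + α (x t) (deriv (ξ p) t) with hδ_def
  have ha : IntervalIntegrable a volume s e := continuousOn_clm_apply_intervalIntegrable
    (by rw [hu]; exact hα.continuousOn.comp hxc h.mapsTo) hx.int
  -- the derivative as a bounded linear map
  have hδi : ∀ p, IntervalIntegrable (fun t => W t * δ p t * Z t) volume s e := fun p =>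
    intervalIntegrable_mul_mul hse hWc hZc (hvar p).1
  have hξd : ∀ p, ∀ᵐ t, t ∈ Icc s e → HasDerivAt (ξ p) (deriv (ξ p) t) t := fun p =>
    ((h.tangent p).acDeriv hse).hasDeriv
  -- Linearity in `p` holds only after integration: `deriv` respects sums and multiples where the
  -- summands are differentiable, that is, almost everywhere.
  let Dl : P →ₗ[ℝ] 𝔸 :=
    { toFun := fun p => -(Z e * ∫ t in s..e, W t * δ p t * Z t)
      map_add' := fun p q => by
        rw [← neg_add, ← mul_add, ← intervalIntegral.integral_add (hδi p) (hδi q)]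
        congr 2
        refine intervalIntegral.integral_congr_ae ?_
        rw [uIoc_of_le hse]
        filter_upwards [hξd p, hξd q] with t h1 h2 ht
        have h3 := ((h1 (Ioc_subset_Icc_self ht)).add (h2 (Ioc_subset_Icc_self ht))).deriv
        simp only [hδ_def, map_add, Pi.add_apply]
        rw [h3]
        simp only [map_add, add_apply]
        noncomm_ring
      map_smul' := fun c p => by
        rw [RingHom.id_apply, smul_neg, ← mul_smul_comm, ← intervalIntegral.integral_smul]
        congr 2
        refine intervalIntegral.integral_congr_ae ?_
        rw [uIoc_of_le hse]
        filter_upwards [hξd p] with t h1 ht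
        have h3 := ((h1 (Ioc_subset_Icc_self ht)).const_smul c).deriv
        simp only [hδ_def, map_smul, Pi.smul_apply]
        rw [h3]
        simp only [map_smul, smul_apply, ← smul_add, mul_smul_comm, smul_mul_assoc] }
  let D : P →L[ℝ] 𝔸 := Dl.mkContinuous (‖Z e‖ * (κ ^ 2 * C)) fun p => by
    have h1 := integral_norm_mul_mul_le hse hWc hZc (hvar p).1 hWκ hZκ
    calc ‖Dl p‖ = ‖Z e * ∫ t in s..e, W t * δ p t * Z t‖ := norm_neg _
      _ ≤ ‖Z e‖ * ‖∫ t in s..e, W t * δ p t * Z t‖ := norm_mul_le _ _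
      _ ≤ ‖Z e‖ * ∫ t in s..e, ‖W t * δ p t * Z t‖ := by
        gcongr; exact intervalIntegral.norm_integral_le_integral_norm hse
      _ ≤ ‖Z e‖ * (κ ^ 2 * (C * ‖p‖)) := by
        gcongr; exact h1.trans (mul_le_mul_of_nonneg_left (hvar p).2 (sq_nonneg κ))
      _ = _ := by ring
  have hD : ∀ p, D p = -(Z e * ∫ t in s..e, W t * δ p t * Z t) := fun p => rfl
  refine ⟨D, fun p => ?_, ?_⟩
  · rw [hD, hδ_def]
    simp only
    rw [integral_coeff_variation_eq hse h.isOpen hα hx ((h.tangent p).acDeriv hse) h.mapsTo hW hZ,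
      hWs, hZs]
    have h1 : ∫ t in s..e, Z e * W t * curvForm α (x t) (ξ p t) (deriv x t) * Z t
        = Z e * ∫ t in s..e, W t * curvForm α (x t) (ξ p t) (deriv x t) * Z t := by
      have hi : IntervalIntegrable (fun t => W t * curvForm α (x t) (ξ p t) (deriv x t) * Z t)
          volume s e :=
        intervalIntegrable_mul_mul hse hWc hZc
          (intervalIntegrable_curvForm hse h.isOpen hα hxc h.mapsTo hx.int (hc (h.tangent p)))
      have := (ContinuousLinearMap.mul ℝ 𝔸 (Z e)).intervalIntegral_comp_comm hi
      simpa only [ContinuousLinearMap.mul_apply', ← mul_assoc] using this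
    rw [h1]
    have h2 : Z e * (W e * α (x e) (ξ p e) * Z e) = α (x e) (ξ p e) * Z e := by
      rw [← mul_assoc, ← mul_assoc, hZW e he, one_mul]
    rw [mul_add, mul_sub, h2]
    noncomm_ring
  · have hR := h.coeff_isLittleO hα
    set R : P → ℝ := fun p => ∫ t in s..e, ‖α (y p t) (deriv (y p) t) - α (x t) (deriv x t)
        - (fderiv ℝ α (x t) (ξ (p - p₀) t) (deriv x t) + α (x t) (deriv (ξ (p - p₀)) t))‖
    have hA : (fun p => R p + C * ‖p - p₀‖) =O[𝓝 p₀] (fun p => p - p₀) :=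
      hR.isBigO.add ((Asymptotics.isBigO_refl _ _).norm_left.const_mul_left C)
    have hq := tendsto_norm_sub p₀
    have hA0 : Tendsto (fun p => R p + C * ‖p - p₀‖) (𝓝 p₀) (𝓝 0) :=
      (hA.norm_right).trans_tendsto hq
    have hA0' : Tendsto (fun p => κ ^ 2 * (R p + C * ‖p - p₀‖)) (𝓝 p₀) (𝓝 0) := by
      simpa using hA0.const_mul (κ ^ 2)
    -- The increment of the coefficient is `O(‖p - p₀‖)` in `L¹` and tends to zero, so its square is
    -- of lower order; the linearization error `R` is so by `coeff_isLittleO`.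
    have htot : (fun p => ‖Z e‖ * (2 * ‖(1 : 𝔸)‖ * (κ ^ 2 * (R p + C * ‖p - p₀‖)) ^ 2
        + κ ^ 2 * R p)) =o[𝓝 p₀] (fun p => p - p₀) := by
      refine Asymptotics.IsLittleO.const_mul_left ?_ _
      refine Asymptotics.IsLittleO.add ?_ (hR.const_mul_left _)
      refine Asymptotics.IsLittleO.const_mul_left ?_ _
      simp only [sq (κ ^ 2 * _)]
      have h1 : (fun p => κ ^ 2 * (R p + C * ‖p - p₀‖)) =o[𝓝 p₀] (fun _ => (1 : ℝ)) := by
        rwa [Asymptotics.isLittleO_one_iff]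
      have h2 := h1.mul_isBigO ((hA.norm_right).const_mul_left (κ ^ 2))
      simp only [one_mul] at h2
      exact h2.of_norm_right
    rw [hasFDerivAt_iff_isLittleO]
    refine Asymptotics.IsBigO.trans_isLittleO ?_ htot
    refine Asymptotics.IsBigO.of_bound 1 ?_
    filter_upwards [hY, h.near, h.eventually_mapsTo,
      hA0'.eventually_le_const (show (0 : ℝ) < 1 / 2 by norm_num)] with p hYp hpH hpO hsm
    have hy := hpH.acDeriv hse
    have ha₁ : IntervalIntegrable (fun t => α (y p t) (deriv (y p) t)) volume s e :=
      continuousOn_clm_apply_intervalIntegrable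
        (by rw [hu]; exact hα.continuousOn.comp (hc hpH) hpO) hy.int
    have hv := hvar (p - p₀)
    have hAp : ∫ t in s..e, ‖α (y p t) (deriv (y p) t) - a t‖ ≤ R p + C * ‖p - p₀‖ := by
      have i1 := ((ha₁.sub ha).sub hv.1).norm
      have i2 := hv.1.norm
      refine le_trans ?_ (add_le_add le_rfl hv.2)
      rw [← intervalIntegral.integral_add i1 i2]
      refine intervalIntegral.integral_mono_on hse (ha₁.sub ha).norm (i1.add i2) fun t _ => ?_
      refine le_trans (le_of_eq ?_) (norm_add_le _ _)
      congr 1; simp only [ha_def]; abel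
    have hAp0 : 0 ≤ ∫ t in s..e, ‖α (y p t) (deriv (y p) t) - a t‖ :=
      intervalIntegral.integral_nonneg hse fun _ _ => norm_nonneg _
    have hκA := mul_le_mul_of_nonneg_left hAp (sq_nonneg κ)
    have key := norm_solution_sub_variation_le hse hW hZc hZW hYp.1 hWs hYp.2 ha ha₁ hv.1 hWκ hZκ
      (hκA.trans hsm)
    -- Since `Z e * W e = 1`, factoring out `Z e` turns the Fréchet remainder into exactly the
    -- quantity bounded by `key`.
    have e1 : Y p e - Y p₀ e - D (p - p₀)
        = Z e * (W e * Y p e - 1 + ∫ t in s..e, W t * δ (p - p₀) t * Z t) := by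
      rw [hD, hY₀, mul_add, mul_sub, ← mul_assoc, hZW e he, one_mul, mul_one, sub_neg_eq_add]
    rw [one_mul, e1]
    refine (norm_mul_le _ _).trans (le_trans ?_ (le_abs_self _))
    refine mul_le_mul_of_nonneg_left (key.trans ?_) (norm_nonneg _)
    have hRp : (∫ t in s..e, ‖α (y p t) (deriv (y p) t) - a t - (fderiv ℝ α (x t) (ξ (p - p₀) t)
      (deriv x t) + α (x t) (deriv (ξ (p - p₀)) t))‖) = R p := rfl
    rw [hRp]
    gcongr

end H1Family

end Frechet

/-! ### Covariance of the curvature form -/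

section Covariance

variable {V V₂ : Type*} [NormedAddCommGroup V] [NormedSpace ℝ V] [NormedAddCommGroup V₂]
  [NormedSpace ℝ V₂] {𝔸 : Type*} [NormedRing 𝔸] [NormedAlgebra ℝ 𝔸]

/-- Differentiate `gβ = αg + dg` in direction `u`, evaluate on `v`, and antisymmetrize. The second
derivative of `g` drops out by symmetry. The products of `dg` with the forms cancel against those
obtained by moving `g` through `β ∧ β` with the same law. -/
theorem curvForm_gauge {α β : V → V →L[ℝ] 𝔸} {g : V → 𝔸} {y : V} (hα : DifferentiableAt ℝ α y)
    (hβ : DifferentiableAt ℝ β y) (hg : ContDiffAt ℝ 2 g y)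
    (h : ∀ᶠ z in 𝓝 y, ∀ w, g z * β z w = α z w * g z + fderiv ℝ g z w) (u v : V) :
    g y * curvForm β y u v = curvForm α y u v * g y := by
  have hg1 : HasFDerivAt g (fderiv ℝ g y) y := (hg.differentiableAt two_ne_zero).hasFDerivAt
  have hg2 : HasFDerivAt (fderiv ℝ g) (fderiv ℝ (fderiv ℝ g) y) y :=
    ((hg.fderiv_right (m := 1) (by norm_num)).differentiableAt one_ne_zero).hasFDerivAt
  -- The differentiated law, obtained by comparing the derivatives of both sides along the line `y +
  -- t • u`.
  have key : ∀ u w, fderiv ℝ g y u * β y w + g y * fderiv ℝ β y u w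
      = fderiv ℝ α y u w * g y + α y w * fderiv ℝ g y u + fderiv ℝ (fderiv ℝ g) y u w := by
    intro u w
    have hl : HasDerivAt (fun t : ℝ => y + t • u) u 0 := by
      simpa using ((hasDerivAt_id (0 : ℝ)).smul_const u).const_add y
    have e0 : y = y + (0 : ℝ) • u := by simp
    have dg : HasDerivAt (fun t : ℝ => g (y + t • u)) (fderiv ℝ g y u) 0 :=
      HasFDerivAt.comp_hasDerivAt_of_eq 0 hg1 hl e0
    have dg2 := HasFDerivAt.comp_hasDerivAt_of_eq 0 hg2 hl e0
    have da := HasFDerivAt.comp_hasDerivAt_of_eq 0 hα.hasFDerivAt hl e0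
    have db := HasFDerivAt.comp_hasDerivAt_of_eq 0 hβ.hasFDerivAt hl e0
    have dl := dg.mul (db.clm_apply (hasDerivAt_const 0 w))
    have dr := ((da.clm_apply (hasDerivAt_const 0 w)).mul dg).add
      (dg2.clm_apply (hasDerivAt_const 0 w))
    have ht : Tendsto (fun t : ℝ => y + t • u) (𝓝 0) (𝓝 y) := by
      have := hl.continuousAt.tendsto; rwa [← e0] at this
    have := dl.unique (dr.congr_of_eventuallyEq ((ht.eventually h).mono fun t ht => ht w))
    simpa [← e0] using this
  have hs := hg.isSymmSndFDerivAt (by simp) u v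
  have k1 := key u v
  have k2 := key v u
  have e1 := h.self_of_nhds u
  have e2 := h.self_of_nhds v
  set θu := fderiv ℝ g y u
  set θv := fderiv ℝ g y v
  rw [hs] at k1
  have f1 : g y * (β y u * β y v) = (α y u * g y + θu) * β y v := by rw [← mul_assoc, e1]
  have f2 : g y * (β y v * β y u) = (α y v * g y + θv) * β y u := by rw [← mul_assoc, e2]
  have f3 : α y u * (g y * β y v) = α y u * (α y v * g y + θv) := by rw [e2]
  have f4 : α y v * (g y * β y u) = α y v * (α y u * g y + θu) := by rw [e1]
  have k3 : g y * fderiv ℝ β y u v = fderiv ℝ α y u v * g y + α y v * θu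
      + fderiv ℝ (fderiv ℝ g) y v u - θu * β y v := by rw [← k1]; abel
  have k4 : g y * fderiv ℝ β y v u = fderiv ℝ α y v u * g y + α y u * θv
      + fderiv ℝ (fderiv ℝ g) y v u - θv * β y u := by rw [← k2]; abel
  simp only [curvForm, mul_add, mul_sub, add_mul, sub_mul]
  rw [k3, k4, f1, f2]
  simp only [add_mul, mul_assoc]
  rw [f3, f4]
  simp only [mul_add]
  abel

/-- Exterior derivative and product commute with pullback; the only extra term is `β` applied to the
second derivative of `τ`, which is symmetric and cancels. -/
theorem curvForm_pullback {α : V → V →L[ℝ] 𝔸} {β : V₂ → V₂ →L[ℝ] 𝔸} {τ : V → V₂} {y : V}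
    (hβ : DifferentiableAt ℝ β (τ y)) (hτ : ContDiffAt ℝ 2 τ y)
    (h : ∀ᶠ z in 𝓝 y, ∀ w, α z w = β (τ z) (fderiv ℝ τ z w)) (hα : DifferentiableAt ℝ α y)
    (u v : V) :
    curvForm α y u v = curvForm β (τ y) (fderiv ℝ τ y u) (fderiv ℝ τ y v) := by
  have hτ1 : HasFDerivAt τ (fderiv ℝ τ y) y := (hτ.differentiableAt two_ne_zero).hasFDerivAt
  have hτ2 : HasFDerivAt (fderiv ℝ τ) (fderiv ℝ (fderiv ℝ τ) y) y :=
    ((hτ.fderiv_right (m := 1) (by norm_num)).differentiableAt one_ne_zero).hasFDerivAt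
  have key : ∀ u w, fderiv ℝ α y u w = fderiv ℝ β (τ y) (fderiv ℝ τ y u) (fderiv ℝ τ y w)
      + β (τ y) (fderiv ℝ (fderiv ℝ τ) y u w) := by
    intro u w
    have hl : HasDerivAt (fun t : ℝ => y + t • u) u 0 := by
      simpa using ((hasDerivAt_id (0 : ℝ)).smul_const u).const_add y
    have e0 : y = y + (0 : ℝ) • u := by simp
    have dτ : HasDerivAt (fun t : ℝ => τ (y + t • u)) (fderiv ℝ τ y u) 0 :=
      HasFDerivAt.comp_hasDerivAt_of_eq 0 hτ1 hl e0
    have dτ2 := HasFDerivAt.comp_hasDerivAt_of_eq 0 hτ2 hl e0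
    have da := HasFDerivAt.comp_hasDerivAt_of_eq 0 hα.hasFDerivAt hl e0
    have db := HasFDerivAt.comp_hasDerivAt_of_eq 0 hβ.hasFDerivAt dτ (by simp)
    have dl := da.clm_apply (hasDerivAt_const 0 w)
    have dr := db.clm_apply (dτ2.clm_apply (hasDerivAt_const 0 w))
    have ht : Tendsto (fun t : ℝ => y + t • u) (𝓝 0) (𝓝 y) := by
      have := hl.continuousAt.tendsto; rwa [← e0] at this
    have := dl.unique (dr.congr_of_eventuallyEq ((ht.eventually h).mono fun t ht => ht w))
    simpa [← e0] using this
  have hs := hτ.isSymmSndFDerivAt (by simp) u v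
  have e := h.self_of_nhds
  simp only [curvForm, key, hs, e]
  abel

end Covariance

/-! ### Charts -/

section Charts

variable {d : ℕ} {M : Type*} [TopologicalSpace M] [ChartedSpace (EuclideanSpace ℝ (Fin d)) M]

theorem mdifferentiable_of_mem_charts {φ : OpenPartialHomeomorph M (EuclideanSpace ℝ (Fin d))}
    (hφ : φ ∈ charts d M) : φ.MDifferentiable (𝓡 d) (𝓡 d) :=
  ⟨(contMDiffOn_of_mem_maximalAtlas hφ).mdifferentiableOn (by simp),
    (contMDiffOn_symm_of_mem_maximalAtlas hφ).mdifferentiableOn (by simp)⟩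

/-- Allows a chart and a trivialization to be used together: the preferred chart is restricted to
the trivializing set. -/
theorem exists_chart_subset [IsManifold (𝓡 d) ∞ M] (x : M) {S : Set M} (hS : IsOpen S)
    (hx : x ∈ S) :
    ∃ φ ∈ charts d M, x ∈ φ.source ∧ φ.source ⊆ S := by
  refine ⟨(chartAt (EuclideanSpace ℝ (Fin d)) x).restr S,
    restr_mem_maximalAtlas _ (IsManifold.chart_mem_maximalAtlas x) hS, ?_, ?_⟩
  · rw [OpenPartialHomeomorph.restr_source, hS.interior_eq]
    exact ⟨mem_chart_source _ x, hx⟩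
  · rw [OpenPartialHomeomorph.restr_source, hS.interior_eq]
    exact inter_subset_right

theorem mfderiv_symm_mfderiv {φ : OpenPartialHomeomorph M (EuclideanSpace ℝ (Fin d))}
    (hφ : φ ∈ charts d M) {x : M} (hx : x ∈ φ.source) (v : TangentSpace (𝓡 d) x) :
    mfderiv (𝓡 d) (𝓡 d) φ.symm (φ x) (mfderiv (𝓡 d) (𝓡 d) φ x v) = v :=
  DFunLike.congr_fun ((mdifferentiable_of_mem_charts hφ).symm_comp_deriv hx) v

variable {N : ℕ}

theorem formCoord_mfderiv {φ : OpenPartialHomeomorph M (EuclideanSpace ℝ (Fin d))}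
    (hφ : φ ∈ charts d M) (θ : ∀ x : M, TangentSpace (𝓡 d) x →L[ℝ] Mat N)
    {x : M} (hx : x ∈ φ.source) (v : TangentSpace (𝓡 d) x) :
    formCoord φ θ (φ x) (mfderiv (𝓡 d) (𝓡 d) φ x v) = θ x v := by
  -- All tangent spaces are copies of the model space. Forgetting the dependence on the point
  -- permits rewriting the base point inside `θ`.
  let θ' : M → EuclideanSpace ℝ (Fin d) →L[ℝ] Mat N := θ
  have h1 : θ' (φ.symm (φ x)) = θ' x := by rw [φ.left_inv hx]
  have h2 := mfderiv_symm_mfderiv hφ hx v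
  calc formCoord φ θ (φ x) (mfderiv (𝓡 d) (𝓡 d) φ x v)
      = θ' (φ.symm (φ x)) (mfderiv (𝓡 d) (𝓡 d) φ.symm (φ x) (mfderiv (𝓡 d) (𝓡 d) φ x v)) := rfl
    _ = θ' x (mfderiv (𝓡 d) (𝓡 d) φ.symm (φ x) (mfderiv (𝓡 d) (𝓡 d) φ x v)) := by rw [h1]
    _ = θ' x v := congrArg (θ' x) h2

/-- Near `t` the curve is `φ.symm` composed with its coordinate expression, so it is differentiable
in the manifold sense and the chain rule applies. -/
theorem mfderiv_velocity {φ : OpenPartialHomeomorph M (EuclideanSpace ℝ (Fin d))}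
    (hφ : φ ∈ charts d M) {γ : ℝ → M} {t : ℝ} (hγ : ContinuousAt γ t) (ht : γ t ∈ φ.source)
    {v : EuclideanSpace ℝ (Fin d)} (hv : HasDerivAt (fun τ => φ (γ τ)) v t) :
    mfderiv (𝓡 d) (𝓡 d) φ (γ t) (velocity d γ t) = v := by
  have hMD := mdifferentiable_of_mem_charts hφ
  have h1 : MDifferentiableAt 𝓘(ℝ, ℝ) (𝓡 d) (fun τ => φ (γ τ)) t :=
    hv.differentiableAt.mdifferentiableAt
  have h2 : MDifferentiableAt 𝓘(ℝ, ℝ) (𝓡 d) (φ.symm ∘ fun τ => φ (γ τ)) t :=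
    (hMD.mdifferentiableAt_symm (φ.map_source ht)).comp t h1
  have h3 : γ =ᶠ[𝓝 t] (φ.symm ∘ fun τ => φ (γ τ)) := by
    filter_upwards [hγ.eventually_mem (φ.open_source.mem_nhds ht)] with τ hτ
    exact (φ.left_inv hτ).symm
  have h4 : MDifferentiableAt 𝓘(ℝ, ℝ) (𝓡 d) γ t := h2.congr_of_eventuallyEq h3
  have h5 := mfderiv_comp t (hMD.mdifferentiableAt ht) h4
  have h6 : mfderiv 𝓘(ℝ, ℝ) (𝓡 d) (φ ∘ γ) t (1 : ℝ) = v := by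
    rw [mfderiv_eq_fderiv]
    exact hv.deriv
  rw [← h6, h5]
  rfl

theorem contDiffOn_comp_symm {F : Type*} [NormedAddCommGroup F] [NormedSpace ℝ F] {f : M → F}
    {S : Set M} (hf : ContMDiffOn (𝓡 d) 𝓘(ℝ, F) ∞ f S)
    {φ : OpenPartialHomeomorph M (EuclideanSpace ℝ (Fin d))} (hφ : φ ∈ charts d M) :
    ContDiffOn ℝ ∞ (fun y => f (φ.symm y)) (φ.target ∩ φ.symm ⁻¹' S) := by
  rw [← contMDiffOn_iff_contDiffOn]
  exact hf.comp ((contMDiffOn_symm_of_mem_maximalAtlas hφ).mono inter_subset_left)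
    inter_subset_right

theorem fderiv_comp_symm {F : Type*} [NormedAddCommGroup F] [NormedSpace ℝ F] {f : M → F}
    {φ : OpenPartialHomeomorph M (EuclideanSpace ℝ (Fin d))} (hφ : φ ∈ charts d M)
    {y : EuclideanSpace ℝ (Fin d)} (hy : y ∈ φ.target)
    (hf : MDifferentiableAt (𝓡 d) 𝓘(ℝ, F) f (φ.symm y)) (w : EuclideanSpace ℝ (Fin d)) :
    fderiv ℝ (fun z => f (φ.symm z)) y w
      = mvfderiv (𝓡 d) f (φ.symm y) (mfderiv (𝓡 d) (𝓡 d) φ.symm y w) := by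
  have h := mfderiv_comp y hf ((mdifferentiable_of_mem_charts hφ).mdifferentiableAt_symm hy)
  have h2 := mfderiv_eq_fderiv (𝕜 := ℝ) (f := fun z => f (φ.symm z)) (x := y)
  rw [← h2]
  exact DFunLike.congr_fun h w

end Charts

/-! ### The connection and its curvature in charts and trivializations -/

section Bundles

variable {d : ℕ} {M : Type*} [TopologicalSpace M] [ChartedSpace (EuclideanSpace ℝ (Fin d)) M]
  {N : ℕ} {G : Subgroup (Matrix.specialUnitaryGroup (Fin N) ℂ)}
  {E : M → Type*} [∀ x, AddCommGroup (E x)] [∀ x, Module ℂ (E x)]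

namespace GBundle

variable (B : GBundle d G E)

/-- The middle index is arbitrary: `ψ b y` is an isomorphism even for `y` outside `W b`. Membership
matters only for smoothness and for the connection. -/
theorem matrixOf_comp (a b c : B.ι) {x y z : M} (T : E y →ₗ[ℂ] E z) (S : E x →ₗ[ℂ] E y) :
    B.matrixOf c a (T ∘ₗ S) = B.matrixOf c b T * B.matrixOf b a S := by
  rw [matrixOf, matrixOf, matrixOf, ← LinearMap.toMatrix'_comp]
  congr 1
  ext v
  simp

theorem matrixOf_id (a b : B.ι) (x : M) :
    B.matrixOf b a (LinearMap.id : E x →ₗ[ℂ] E x) = B.transition b a x := rfl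

theorem transition_self (a : B.ι) (x : M) : B.transition a a x = 1 := by
  rw [transition, ← LinearMap.toMatrix'_id]
  congr 1
  ext v
  simp

theorem transition_mul_transition (a b c : B.ι) (x : M) :
    B.transition c b x * B.transition b a x = B.transition c a x := by
  rw [← matrixOf_id, ← matrixOf_id, ← matrixOf_comp, LinearMap.id_comp, matrixOf_id]

theorem transition_mul_transition_self (a b : B.ι) (x : M) :
    B.transition a b x * B.transition b a x = 1 := by
  rw [transition_mul_transition, transition_self]

theorem transition_inv (a b : B.ι) (x : M) : (B.transition a b x)⁻¹ = B.transition b a x :=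
  Matrix.inv_eq_left_inv (B.transition_mul_transition_self b a x)

theorem matrixOf_eq (a b a' b' : B.ι) {x y : M} (T : E x →ₗ[ℂ] E y) :
    B.matrixOf b a T = B.transition b b' y * B.matrixOf b' a' T * B.transition a' a x := by
  rw [← matrixOf_id, ← matrixOf_id, ← matrixOf_comp, ← matrixOf_comp]
  rfl

theorem mdifferentiableAt_transition {a b : B.ι} {x : M} (hx : x ∈ B.W a ∩ B.W b) :
    MDifferentiableAt (𝓡 d) 𝓘(ℝ, Mat N) (B.transition a b) x :=
  ((B.transition_smooth a b).contMDiffAt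
    (((B.isOpen_W a).inter (B.isOpen_W b)).mem_nhds hx)).mdifferentiableAt (by simp)

end GBundle

theorem two_le_infty : (2 : WithTop ℕ∞) ≤ ∞ :=
  WithTop.coe_le_coe.2 (le_top : (2 : ℕ∞) ≤ ⊤)

theorem isOpen_chart_preimage {X Y : Type*} [TopologicalSpace X] [TopologicalSpace Y]
    (φ : OpenPartialHomeomorph X Y) {S : Set X}
    (hS : IsOpen S) : IsOpen (φ.target ∩ φ.symm ⁻¹' S) :=
  φ.symm.isOpen_inter_preimage hS

theorem mem_chart_preimage {X Y : Type*} [TopologicalSpace X] [TopologicalSpace Y]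
    {φ : OpenPartialHomeomorph X Y} {S : Set X} {x : X} (hx : x ∈ φ.source) (hxS : x ∈ S) :
    φ x ∈ φ.target ∩ φ.symm ⁻¹' S :=
  ⟨φ.map_source hx, by rwa [mem_preimage, φ.left_inv hx]⟩

namespace Connection

variable {B : GBundle d G E} (A : Connection B)

/-- The compatibility of the local connection forms, without inverses. -/
theorem transition_mul_form {a b : B.ι} {x : M} (hx : x ∈ B.W a ∩ B.W b)
    (v : TangentSpace (𝓡 d) x) :
    B.transition a b x * A.A b x v
      = A.A a x v * B.transition a b x + mvfderiv (𝓡 d) (B.transition a b) x v := by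
  have h := B.transition_mul_transition_self a b x
  rw [A.compat a b x hx v, B.transition_inv, mul_add, ← mul_assoc, ← mul_assoc, ← mul_assoc, h,
    one_mul, one_mul]

theorem transition_mul_formCoord {φ : OpenPartialHomeomorph M (EuclideanSpace ℝ (Fin d))}
    (hφ : φ ∈ charts d M) {a b : B.ι} {y : EuclideanSpace ℝ (Fin d)}
    (hy : y ∈ φ.target ∩ φ.symm ⁻¹' (B.W a ∩ B.W b)) (w : EuclideanSpace ℝ (Fin d)) :
    B.transition a b (φ.symm y) * formCoord φ (A.A b) y w
      = formCoord φ (A.A a) y w * B.transition a b (φ.symm y)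
        + fderiv ℝ (fun z => B.transition a b (φ.symm z)) y w := by
  rw [fderiv_comp_symm hφ hy.1 (B.mdifferentiableAt_transition hy.2)]
  exact A.transition_mul_form hy.2 _

theorem curvForm_transition {φ : OpenPartialHomeomorph M (EuclideanSpace ℝ (Fin d))}
    (hφ : φ ∈ charts d M) {a b : B.ι} {y : EuclideanSpace ℝ (Fin d)}
    (hy : y ∈ φ.target ∩ φ.symm ⁻¹' (B.W a ∩ B.W b)) (u v : EuclideanSpace ℝ (Fin d)) :
    B.transition a b (φ.symm y) * curvForm (formCoord φ (A.A b)) y u v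
      = curvForm (formCoord φ (A.A a)) y u v * B.transition a b (φ.symm y) := by
  have hO := isOpen_chart_preimage φ ((B.isOpen_W a).inter (B.isOpen_W b))
  have hd : ∀ c, φ.symm y ∈ B.W c → DifferentiableAt ℝ (formCoord φ (A.A c)) y := fun c hc =>
    ((A.smooth c φ hφ).contDiffAt ((isOpen_chart_preimage φ (B.isOpen_W c)).mem_nhds
      ⟨hy.1, hc⟩)).differentiableAt (by simp)
  refine curvForm_gauge (g := fun z => B.transition a b (φ.symm z)) (hd a hy.2.1) (hd b hy.2.2)
    (((contDiffOn_comp_symm (B.transition_smooth a b) hφ).contDiffAt (hO.mem_nhds hy)).of_le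
      two_le_infty) ?_ u v
  filter_upwards [hO.mem_nhds hy] with z hz w
  exact A.transition_mul_formCoord hφ hz w

theorem curvForm_chart {φ₁ φ₂ : OpenPartialHomeomorph M (EuclideanSpace ℝ (Fin d))}
    (hφ₁ : φ₁ ∈ charts d M) (hφ₂ : φ₂ ∈ charts d M) {a : B.ι} {x : M} (hx₁ : x ∈ φ₁.source)
    (hx₂ : x ∈ φ₂.source) (ha : x ∈ B.W a) (u v : TangentSpace (𝓡 d) x) :
    curvForm (formCoord φ₁ (A.A a)) (φ₁ x) (mfderiv (𝓡 d) (𝓡 d) φ₁ x u)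
        (mfderiv (𝓡 d) (𝓡 d) φ₁ x v)
      = curvForm (formCoord φ₂ (A.A a)) (φ₂ x) (mfderiv (𝓡 d) (𝓡 d) φ₂ x u)
        (mfderiv (𝓡 d) (𝓡 d) φ₂ x v) := by
  set τ : EuclideanSpace ℝ (Fin d) → EuclideanSpace ℝ (Fin d) := fun y => φ₂ (φ₁.symm y)
  have hO := isOpen_chart_preimage φ₁ (φ₂.open_source.inter (B.isOpen_W a))
  have hxO : φ₁ x ∈ φ₁.target ∩ φ₁.symm ⁻¹' (φ₂.source ∩ B.W a) :=
    mem_chart_preimage hx₁ ⟨hx₂, ha⟩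
  have hd : ∀ φ ∈ charts d M, x ∈ φ.source → DifferentiableAt ℝ (formCoord φ (A.A a)) (φ x) :=
    fun φ hφ hx => ((A.smooth a φ hφ).contDiffAt
      ((isOpen_chart_preimage φ (B.isOpen_W a)).mem_nhds
        (mem_chart_preimage hx ha))).differentiableAt (by simp)
  have hφ₂' : ContMDiffOn (𝓡 d) 𝓘(ℝ, EuclideanSpace ℝ (Fin d)) ∞ φ₂ φ₂.source :=
    contMDiffOn_of_mem_maximalAtlas hφ₂
  have hτ : ContDiffAt ℝ 2 τ (φ₁ x) :=
    ((contDiffOn_comp_symm hφ₂' hφ₁).contDiffAt ((isOpen_chart_preimage φ₁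
      φ₂.open_source).mem_nhds (mem_chart_preimage hx₁ hx₂))).of_le two_le_infty
  have hdτ : ∀ y ∈ φ₁.target ∩ φ₁.symm ⁻¹' (φ₂.source ∩ B.W a), ∀ w,
      fderiv ℝ τ y w = mfderiv (𝓡 d) (𝓡 d) φ₂ (φ₁.symm y) (mfderiv (𝓡 d) (𝓡 d) φ₁.symm y w) :=
    fun y hy w => fderiv_comp_symm (f := φ₂) hφ₁ hy.1
      ((mdifferentiable_of_mem_charts hφ₂).mdifferentiableAt hy.2.1) w
  have hτx : τ (φ₁ x) = φ₂ x := by simp only [τ]; rw [φ₁.left_inv hx₁]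
  have hτd : ∀ w : TangentSpace (𝓡 d) x, fderiv ℝ τ (φ₁ x) (mfderiv (𝓡 d) (𝓡 d) φ₁ x w)
      = mfderiv (𝓡 d) (𝓡 d) φ₂ x w := fun w => by
    refine (hdτ _ hxO _).trans ?_
    let D : M → EuclideanSpace ℝ (Fin d) →L[ℝ] EuclideanSpace ℝ (Fin d) :=
      fun z => mfderiv (𝓡 d) (𝓡 d) φ₂ z
    have h1 : D (φ₁.symm (φ₁ x)) = D x := by rw [φ₁.left_inv hx₁]
    have h2 := mfderiv_symm_mfderiv hφ₁ hx₁ w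
    exact (DFunLike.congr_fun h1 _).trans (congrArg (D x) h2)
  have key := curvForm_pullback (α := formCoord φ₁ (A.A a)) (β := formCoord φ₂ (A.A a)) (τ := τ)
    (y := φ₁ x) (by rw [hτx]; exact hd φ₂ hφ₂ hx₂) hτ ?_ (hd φ₁ hφ₁ hx₁)
    (mfderiv (𝓡 d) (𝓡 d) φ₁ x u) (mfderiv (𝓡 d) (𝓡 d) φ₁ x v)
  · rw [hτx] at key
    exact key.trans (congrArg₂ (curvForm (formCoord φ₂ (A.A a)) (φ₂ x)) (hτd u) (hτd v))
  · filter_upwards [hO.mem_nhds hxO] with z hz w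
    rw [hdτ z hz]
    exact (formCoord_mfderiv hφ₂ (A.A a) hz.2.1 _).symm

variable [IsManifold (𝓡 d) ∞ M]

/-- Frees the curvature from the preferred chart, which varies with the point, so that a single
chart serves along a whole piece of the curve. -/
theorem localCurvature_eq_curvForm {φ : OpenPartialHomeomorph M (EuclideanSpace ℝ (Fin d))}
    (hφ : φ ∈ charts d M) {a : B.ι} {x : M} (hx : x ∈ φ.source) (ha : x ∈ B.W a)
    (u v : TangentSpace (𝓡 d) x) :
    A.localCurvature a x u v = curvForm (formCoord φ (A.A a)) (φ x)
      (mfderiv (𝓡 d) (𝓡 d) φ x u) (mfderiv (𝓡 d) (𝓡 d) φ x v) := by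
  have hc : chartAt (EuclideanSpace ℝ (Fin d)) x ∈ charts d M :=
    IsManifold.chart_mem_maximalAtlas x
  rw [← A.curvForm_chart hc hφ (mem_chart_source _ x) hx ha]
  exact (congrArg₂ (fun p q : Mat N => _ + (p * q - q * p))
    (formCoord_mfderiv hc (A.A a) (mem_chart_source _ x) u)
    (formCoord_mfderiv hc (A.A a) (mem_chart_source _ x) v)).symm

theorem transition_mul_localCurvature {a b : B.ι} {x : M} (ha : x ∈ B.W a) (hb : x ∈ B.W b)
    (u v : TangentSpace (𝓡 d) x) :
    B.transition a b x * A.localCurvature b x u v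
      = A.localCurvature a x u v * B.transition a b x := by
  have hc : chartAt (EuclideanSpace ℝ (Fin d)) x ∈ charts d M :=
    IsManifold.chart_mem_maximalAtlas x
  have hx := mem_chart_source (EuclideanSpace ℝ (Fin d)) x
  have h := A.curvForm_transition hc (mem_chart_preimage hx ⟨ha, hb⟩)
    (mfderiv (𝓡 d) (𝓡 d) (chartAt (EuclideanSpace ℝ (Fin d)) x) x u)
    (mfderiv (𝓡 d) (𝓡 d) (chartAt (EuclideanSpace ℝ (Fin d)) x) x v)
  rw [(chartAt (EuclideanSpace ℝ (Fin d)) x).left_inv hx] at h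
  rwa [A.localCurvature_eq_curvForm hc hx ha, A.localCurvature_eq_curvForm hc hx hb]

/-- The choice of trivialization in `curvature` is harmless, because the local curvatures are
conjugate by the transition functions. -/
theorem matrixOf_curvature {a : B.ι} {x : M} (ha : x ∈ B.W a) (u v : TangentSpace (𝓡 d) x) :
    B.matrixOf a a (A.curvature x u v) = A.localCurvature a x u v := by
  set b := (B.cover x).choose
  have hb : x ∈ B.W b := (B.cover x).choose_spec
  have h1 : B.matrixOf b b (A.curvature x u v) = A.localCurvature b x u v := by
    have : A.curvature x u v = (B.ψ b x).symm.toLinearMap ∘ₗ Matrix.toLin'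
      (A.localCurvature b x u v) ∘ₗ (B.ψ b x).toLinearMap := rfl
    rw [GBundle.matrixOf, this]
    conv_rhs => rw [← LinearMap.toMatrix'_toLin' (A.localCurvature b x u v)]
    congr 1
    ext v
    simp
  rw [B.matrixOf_eq a a b b, h1, A.transition_mul_localCurvature ha hb, mul_assoc,
    B.transition_mul_transition_self, mul_one]

end Connection

end Bundles

/-! ### Functions of class `H¹` with a given derivative -/

section H1Deriv

variable {V W : Type*} [NormedAddCommGroup V] [NormedSpace ℝ V] [NormedAddCommGroup W]
  [NormedSpace ℝ W]

/-- `f` is of class `H¹` on `[a,b]` with almost everywhere derivative `f'`. -/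
structure H1Deriv (a b : ℝ) (f f' : ℝ → V) : Prop extends ACDeriv a b f f' where
  memLp : MemLp f' 2 (volume.restrict (Icc a b))

namespace H1Deriv

variable {a b : ℝ} {f f' : ℝ → V}

theorem isH1On (h : H1Deriv a b f f') : IsH1On a b f := h.toACDeriv.isH1On h.memLp

theorem ae_restrict (h : H1Deriv a b f f') :
    ∀ᵐ t ∂(volume.restrict (Icc a b)), HasDerivAt f (f' t) t :=
  (ae_restrict_iff' measurableSet_Icc).2 h.hasDeriv

theorem of_isH1On (hab : a ≤ b) (h : IsH1On a b f)
    (hd : ∀ᵐ t, t ∈ Icc a b → HasDerivAt f (f' t) t) : H1Deriv a b f f' :=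
  have hm := h.memLp_deriv hd
  ⟨⟨h.1, intervalIntegrable_of_memLp_two hab hm, hd⟩, hm⟩

theorem mono (h : H1Deriv a b f f') {c d : ℝ} (hac : a ≤ c) (hcd : c ≤ d) (hdb : d ≤ b) :
    H1Deriv c d f f' :=
  ⟨h.toACDeriv.mono hac hcd hdb,
    h.memLp.mono_measure (Measure.restrict_mono (Icc_subset_Icc hac hdb) le_rfl)⟩

theorem congr (h : H1Deriv a b f f') (hab : a ≤ b) {g : ℝ → V}
    (hfg : ∀ t ∈ Icc a b, f t = g t) : H1Deriv a b g f' :=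
  ⟨h.toACDeriv.congr hab hfg, h.memLp⟩

theorem congr_deriv (h : H1Deriv a b f f') (hab : a ≤ b) {g' : ℝ → V}
    (hg : ∀ᵐ t, t ∈ Icc a b → f' t = g' t) : H1Deriv a b f g' :=
  ⟨h.toACDeriv.congr_deriv hab hg,
    h.memLp.ae_eq ((ae_restrict_iff' measurableSet_Icc).2 hg)⟩

theorem glue [CompleteSpace V] {m : ℝ} (ham : a ≤ m) (hmb : m ≤ b) (h1 : H1Deriv a m f f')
    (h2 : H1Deriv m b f f') : H1Deriv a b f f' :=
  ⟨h1.toACDeriv.glue ham hmb h2.toACDeriv, memLp_two_glue ham hmb h1.memLp h2.memLp⟩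

theorem comp {O : Set V} {F : V → W} (hab : a ≤ b)
    (h : H1Deriv a b f f') (hO : IsOpen O) (hF : ContDiffOn ℝ 1 F O) (hm : MapsTo f (Icc a b) O) :
    H1Deriv a b (fun t => F (f t)) (fun t => fderiv ℝ F (f t) (f' t)) := by
  refine ⟨h.toACDeriv.comp hab hO hF hm, memLp_two_clm_apply ?_ h.memLp⟩
  refine (hF.continuousOn_fderiv_of_isOpen hO le_rfl).comp ?_ hm
  simpa [uIcc_of_le hab] using h.continuousOn

end H1Deriv

variable {𝔸 : Type*} [NormedRing 𝔸] [NormedAlgebra ℝ 𝔸]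

theorem memLp_two_mul_continuousOn {a b : ℝ} {g f : ℝ → 𝔸}
    (hg : MemLp g 2 (volume.restrict (Icc a b))) (hf : ContinuousOn f (Icc a b)) :
    MemLp (fun t => g t * f t) 2 (volume.restrict (Icc a b)) :=
  memLp_two_clm_apply (c := fun t => (ContinuousLinearMap.mul ℝ 𝔸).flip (f t))
    ((ContinuousLinearMap.mul ℝ 𝔸).flip.continuous.comp_continuousOn hf) hg

theorem memLp_two_continuousOn_mul {a b : ℝ} {g f : ℝ → 𝔸}
    (hg : MemLp g 2 (volume.restrict (Icc a b))) (hf : ContinuousOn f (Icc a b)) :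
    MemLp (fun t => f t * g t) 2 (volume.restrict (Icc a b)) :=
  memLp_two_clm_apply (c := fun t => ContinuousLinearMap.mul ℝ 𝔸 (f t))
    ((ContinuousLinearMap.mul ℝ 𝔸).continuous.comp_continuousOn hf) hg

theorem H1Deriv.mul {a b : ℝ} {f f' g g' : ℝ → 𝔸} (hab : a ≤ b) (hf : H1Deriv a b f f')
    (hg : H1Deriv a b g g') :
    H1Deriv a b (fun t => f t * g t) (fun t => f' t * g t + f t * g' t) := by
  have hfc : ContinuousOn f (Icc a b) := by simpa [uIcc_of_le hab] using hf.continuousOn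
  have hgc : ContinuousOn g (Icc a b) := by simpa [uIcc_of_le hab] using hg.continuousOn
  exact ⟨hf.toACDeriv.mul hg.toACDeriv,
    (memLp_two_mul_continuousOn hf.memLp hgc).add (memLp_two_continuousOn_mul hg.memLp hfc)⟩

theorem h1Deriv_const (c : V) (a b : ℝ) : H1Deriv a b (fun _ => c) (fun _ => 0) :=
  ⟨acDeriv_const c a b, MemLp.zero⟩

theorem H1Deriv.mul_const {a b : ℝ} {f f' : ℝ → 𝔸} (hab : a ≤ b) (hf : H1Deriv a b f f') (c : 𝔸) :
    H1Deriv a b (fun t => f t * c) (fun t => f' t * c) := by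
  simpa using hf.mul hab (h1Deriv_const c a b)

theorem H1Deriv.const_mul {a b : ℝ} {f f' : ℝ → 𝔸} (hab : a ≤ b) (hf : H1Deriv a b f f') (c : 𝔸) :
    H1Deriv a b (fun t => c * f t) (fun t => c * f' t) := by
  simpa using (h1Deriv_const c a b).mul hab hf

/-- The inverse of a solution of `f' = -k f` solves `g' = g k`. -/
theorem H1Deriv.inverse_solution [CompleteSpace 𝔸] {a b : ℝ} {f g k : ℝ → 𝔸} (hab : a ≤ b)
    (hf : H1Deriv a b f (fun t => -(k t * f t))) (hfg : ∀ t ∈ Icc a b, f t * g t = 1)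
    (hgf : ∀ t ∈ Icc a b, g t * f t = 1) : H1Deriv a b g (fun t => g t * k t) := by
  have hm : MapsTo f (Icc a b) {x | IsUnit x} := fun t ht =>
    ⟨⟨f t, g t, hfg t ht, hgf t ht⟩, rfl⟩
  -- Inversion is smooth on the open set of units, so the chain rule for `H¹` functions applies to
  -- `g = f⁻¹`.
  have hC : ContDiffOn ℝ 1 (Ring.inverse : 𝔸 → 𝔸) {x | IsUnit x} := by
    rintro _ ⟨x, rfl⟩
    exact (contDiffAt_ringInverse ℝ x).contDiffWithinAt
  have hinv : ∀ t ∈ Icc a b, Ring.inverse (f t) = g t := fun t ht =>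
    Ring.inverse_unit ⟨f t, g t, hfg t ht, hgf t ht⟩
  refine ((hf.comp hab Units.isOpen hC hm).congr hab hinv).congr_deriv hab
    (Eventually.of_forall fun t ht => ?_)
  have h1 := (hasFDerivAt_ringInverse (𝕜 := ℝ)
    (⟨f t, g t, hfg t ht, hgf t ht⟩ : 𝔸ˣ)).fderiv
  simp only at h1
  rw [h1]
  simp only [neg_apply, ContinuousLinearMap.mulLeftRight_apply, Units.inv_mk, mul_neg, neg_mul,
    neg_neg]
  rw [mul_assoc, mul_assoc, hfg t ht, mul_one]

theorem exists_small_integral {F : Type*} [NormedAddCommGroup F] {a b t : ℝ} {g : ℝ → F}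
    (hab : a ≤ b)
    (hg : IntervalIntegrable g volume a b) {ε : ℝ} (hε : 0 < ε) :
    ∃ U : Set ℝ, IsOpen U ∧ t ∈ U ∧ ∀ s e, a ≤ s → s ≤ e → e ≤ b → Icc s e ⊆ U →
      ∫ τ in s..e, ‖g τ‖ ≤ ε := by
  -- Extension of `‖g‖` by zero makes the primitive continuous on all of `ℝ`, so `U` is open there
  -- even when `t` is an end point.
  set k : ℝ → ℝ := (Ioc a b).indicator fun τ => ‖g τ‖
  have hk : Integrable k := by
    rw [integrable_indicator_iff measurableSet_Ioc]
    exact ((intervalIntegrable_iff_integrableOn_Ioc_of_le hab).1 hg).norm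
  have hki : ∀ x y, IntervalIntegrable k volume x y := fun x y => hk.intervalIntegrable
  have hc : Continuous fun τ => ∫ x in t..τ, k x :=
    intervalIntegral.continuous_primitive hki t
  refine ⟨{τ | |∫ x in t..τ, k x| < ε / 2}, isOpen_lt hc.abs continuous_const, by simpa, ?_⟩
  intro s e has hse heb hU
  have h1 : |∫ x in t..s, k x| < ε / 2 := hU ⟨le_rfl, hse⟩
  have h2 : |∫ x in t..e, k x| < ε / 2 := hU ⟨hse, le_rfl⟩
  have h3 : ∫ τ in s..e, ‖g τ‖ = ∫ x in s..e, k x := by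
    refine intervalIntegral.integral_congr_ae (Eventually.of_forall fun x hx => ?_)
    rw [uIoc_of_le hse] at hx
    exact (indicator_of_mem (show x ∈ Ioc a b from
      ⟨has.trans_lt hx.1, hx.2.trans heb⟩) fun τ => ‖g τ‖).symm
  rw [h3, ← intervalIntegral.integral_interval_sub_left (hki t e) (hki t s)]
  rw [abs_lt] at h1 h2
  linarith

end H1Deriv

/-- Only an inequality, because for `N = 0` the matrix ring is trivial and `1` has norm zero. -/
theorem norm_one_mat_le (N : ℕ) : ‖(1 : Mat N)‖ ≤ 1 := by
  rcases subsingleton_or_nontrivial (Mat N) with h | h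
  · rw [Subsingleton.elim (1 : Mat N) 0, norm_zero]; exact zero_le_one
  · exact CStarRing.norm_one.le

/-! ### Existence of the parallel transport -/

section Existence

variable {d : ℕ} {M : Type*} [TopologicalSpace M] [ChartedSpace (EuclideanSpace ℝ (Fin d)) M]
  {N : ℕ} {G : Subgroup (Matrix.specialUnitaryGroup (Fin N) ℂ)}
  {E : M → Type*} [∀ x, AddCommGroup (E x)] [∀ x, Module ℂ (E x)]

theorem exists_radius_mapsTo {X : Type*} [TopologicalSpace X] {γ : ℝ → X}
    (hγ : ContinuousOn γ (Icc 0 1)) {t : ℝ} (ht : t ∈ Icc (0 : ℝ) 1) {S : Set X} (hS : IsOpen S)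
    (htS : γ t ∈ S) : ∃ r > 0, ∀ τ ∈ Icc (0 : ℝ) 1, |τ - t| ≤ r → γ τ ∈ S := by
  have h := (hγ t ht).eventually_mem (hS.mem_nhds htS)
  rw [eventually_nhdsWithin_iff, Metric.eventually_nhds_iff] at h
  obtain ⟨r, hr, h⟩ := h
  exact ⟨r / 2, half_pos hr, fun τ hτ hτt => h (by rw [Real.dist_eq]; linarith) hτ⟩

theorem exists_interval_mapsTo {X : Type*} [TopologicalSpace X] {γ : ℝ → X}
    (hγ : ContinuousOn γ (Icc 0 1)) {t : ℝ} (ht : t ∈ Icc (0 : ℝ) 1) {S : Set X} (hS : IsOpen S)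
    (htS : γ t ∈ S) : ∃ s e, 0 ≤ s ∧ s < e ∧ e ≤ 1 ∧ t ∈ Icc s e ∧ MapsTo γ (Icc s e) S := by
  obtain ⟨r, hr, hball⟩ := exists_radius_mapsTo hγ ht hS htS
  have hlt : max 0 (t - r) < min 1 (t + r) :=
    max_lt (lt_min one_pos (by linarith [ht.1])) (lt_min (by linarith [ht.2]) (by linarith))
  refine ⟨max 0 (t - r), min 1 (t + r), le_max_left _ _, hlt, min_le_left _ _,
    ⟨max_le ht.1 (by linarith), le_min ht.2 (by linarith)⟩, fun τ hτ => ?_⟩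
  refine hball τ ⟨(le_max_left _ _).trans hτ.1, hτ.2.trans (min_le_left _ _)⟩ (abs_le.2 ⟨?_, ?_⟩)
  · linarith [(le_max_right 0 (t - r)).trans hτ.1]
  · linarith [hτ.2.trans (min_le_right 1 (t + r))]

theorem ae_mfderiv_velocity {γ : ℝ → M} (hγ : IsH1Curve d γ)
    {φ : OpenPartialHomeomorph M (EuclideanSpace ℝ (Fin d))} (hφ : φ ∈ charts d M) {s e : ℝ}
    (hs : 0 ≤ s) (hse : s ≤ e) (he : e ≤ 1) (hm : MapsTo γ (Icc s e) φ.source) :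
    ∀ᵐ t, t ∈ Icc s e →
      mfderiv (𝓡 d) (𝓡 d) φ (γ t) (velocity d γ t) = deriv (fun τ => φ (γ τ)) t := by
  filter_upwards [((hγ.2 φ hφ s e hs hse he hm).acDeriv hse).hasDeriv,
    ae_mem_Ioo_of_mem_Icc s e] with t h1 h2 ht
  have h3 : Icc (0 : ℝ) 1 ∈ 𝓝 t :=
    Icc_mem_nhds (hs.trans_lt (h2 ht).1) ((h2 ht).2.trans_le he)
  exact mfderiv_velocity hφ (hγ.1.continuousAt h3) (hm ht) (h1 ht)

theorem ae_form_velocity {γ : ℝ → M} (hγ : IsH1Curve d γ)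
    {φ : OpenPartialHomeomorph M (EuclideanSpace ℝ (Fin d))} (hφ : φ ∈ charts d M) {s e : ℝ}
    (hs : 0 ≤ s) (hse : s ≤ e) (he : e ≤ 1) (hm : MapsTo γ (Icc s e) φ.source)
    (θ : ∀ x : M, TangentSpace (𝓡 d) x →L[ℝ] Mat N) :
    ∀ᵐ t, t ∈ Icc s e →
      θ (γ t) (velocity d γ t) = formCoord φ θ (φ (γ t)) (deriv (fun τ => φ (γ τ)) t) := by
  filter_upwards [ae_mfderiv_velocity hγ hφ hs hse he hm] with t h1 ht
  exact (formCoord_mfderiv hφ θ (hm ht) _).symm.trans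
    (congrArg (formCoord φ θ (φ (γ t))) (h1 ht))

/-- The matrix of a frame along a curve in a local trivialization. -/
def GBundle.frameMatrix (B : GBundle d G E) {γ : ℝ → M} (T : ∀ t, (Fin N → ℂ) ≃ₗ[ℂ] E (γ t))
    (a : B.ι) (t : ℝ) : Mat N :=
  LinearMap.toMatrix' ((B.ψ a (γ t)).toLinearMap ∘ₗ (T t).toLinearMap)

theorem GBundle.frameMatrix_transition (B : GBundle d G E) {γ : ℝ → M}
    (T : ∀ t, (Fin N → ℂ) ≃ₗ[ℂ] E (γ t)) (a b : B.ι) (t : ℝ) :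
    B.frameMatrix T b t = B.transition b a (γ t) * B.frameMatrix T a t := by
  rw [frameMatrix, transition, frameMatrix, ← LinearMap.toMatrix'_comp]
  congr 1
  ext v
  simp

namespace Connection

variable {B : GBundle d G E} (A : Connection B)

/-- The frame `T` along `γ` is horizontal on `[s,e]`. -/
def IsHorizontal (γ : ℝ → M) (s e : ℝ) (T : ∀ t, (Fin N → ℂ) ≃ₗ[ℂ] E (γ t)) : Prop :=
  ∀ a : B.ι, ∀ s₀ t₀ : ℝ, s ≤ s₀ → s₀ ≤ t₀ → t₀ ≤ e → MapsTo γ (Icc s₀ t₀) (B.W a) →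
    H1Deriv s₀ t₀ (B.frameMatrix T a)
      (fun t => -(A.A a (γ t) (velocity d γ t) * B.frameMatrix T a t))

variable {A}

theorem IsHorizontal.congr {γ : ℝ → M} {s e : ℝ} {T T' : ∀ t, (Fin N → ℂ) ≃ₗ[ℂ] E (γ t)}
    (h : A.IsHorizontal γ s e T) (hT : ∀ t ∈ Icc s e, T t = T' t) : A.IsHorizontal γ s e T' := by
  intro a s₀ t₀ hs h0 ht hm
  have hf : ∀ t ∈ Icc s₀ t₀, B.frameMatrix T a t = B.frameMatrix T' a t := fun t htt => by
    rw [GBundle.frameMatrix, GBundle.frameMatrix, hT t ⟨hs.trans htt.1, htt.2.trans ht⟩]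
  exact ((h a s₀ t₀ hs h0 ht hm).congr h0 hf).congr_deriv h0
    (Eventually.of_forall fun t htt => by rw [hf t htt])

/-- The equation acts on the frame matrix from the left, so right multiplication by a constant
matrix preserves it. -/
theorem IsHorizontal.trans_const {γ : ℝ → M} {s e : ℝ} {T : ∀ t, (Fin N → ℂ) ≃ₗ[ℂ] E (γ t)}
    (h : A.IsHorizontal γ s e T) (C : (Fin N → ℂ) ≃ₗ[ℂ] (Fin N → ℂ)) :
    A.IsHorizontal γ s e (fun t => C.trans (T t)) := by
  intro a s₀ t₀ hs h0 ht hm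
  have hf : ∀ t, B.frameMatrix (fun t => C.trans (T t)) a t
      = B.frameMatrix T a t * LinearMap.toMatrix' C.toLinearMap := fun t => by
    rw [GBundle.frameMatrix, GBundle.frameMatrix, ← LinearMap.toMatrix'_comp]
    rfl
  rw [funext hf]
  refine ((h a s₀ t₀ hs h0 ht hm).mul_const h0 _).congr_deriv h0
    (Eventually.of_forall fun t _ => ?_)
  rw [neg_mul, mul_assoc]

theorem IsHorizontal.glue {γ : ℝ → M} {s m e : ℝ} {T : ∀ t, (Fin N → ℂ) ≃ₗ[ℂ] E (γ t)}
    (h1 : A.IsHorizontal γ s m T) (h2 : A.IsHorizontal γ m e T) : A.IsHorizontal γ s e T := by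
  intro a s₀ t₀ hs h0 ht hm
  rcases le_total t₀ m with htm | htm
  · exact h1 a s₀ t₀ hs h0 htm hm
  rcases le_total m s₀ with hms | hms
  · exact h2 a s₀ t₀ hms h0 ht hm
  exact (h1 a s₀ m hs hms le_rfl (hm.mono_left (Icc_subset_Icc_right htm))).glue hms htm
    (h2 a m t₀ le_rfl htm ht (hm.mono_left (Icc_subset_Icc_left hms)))

/-- The second frame is precomposed with the constant automorphism `C` that makes it agree with the
first at `m`. -/
theorem exists_isHorizontal_glue {γ : ℝ → M} {s m e : ℝ}
    (h1 : ∃ T, A.IsHorizontal γ s m T) (h2 : ∃ T, A.IsHorizontal γ m e T) :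
    ∃ T, A.IsHorizontal γ s e T := by
  obtain ⟨T₁, h1⟩ := h1
  obtain ⟨T₂, h2⟩ := h2
  set C := (T₁ m).trans (T₂ m).symm
  classical
  refine ⟨fun t => if t ≤ m then T₁ t else C.trans (T₂ t), IsHorizontal.glue (m := m) ?_ ?_⟩
  · exact h1.congr fun t ht => (if_pos ht.2).symm
  · refine (h2.trans_const C).congr fun t ht => ?_
    rcases ht.1.eq_or_lt with rfl | hlt
    · rw [if_pos le_rfl]
      ext v
      simp [C]
    · rw [if_neg hlt.not_ge]

variable (A)

/-- Local horizontal frames in a chart and a trivialization. -/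
theorem exists_isHorizontal_of_small {γ : ℝ → M} (hγ : IsH1Curve d γ) {a : B.ι}
    {φ : OpenPartialHomeomorph M (EuclideanSpace ℝ (Fin d))} (hφ : φ ∈ charts d M)
    (hφa : φ.source ⊆ B.W a) {s e : ℝ}
    (hs : 0 ≤ s) (hse : s ≤ e) (he : e ≤ 1) (hm : MapsTo γ (Icc s e) φ.source)
    (hsmall : ∫ t in s..e, ‖formCoord φ (A.A a) (φ (γ t)) (deriv (fun τ => φ (γ τ)) t)‖ ≤ 1 / 4) :
    ∃ T, A.IsHorizontal γ s e T := by
  set x : ℝ → EuclideanSpace ℝ (Fin d) := fun τ => φ (γ τ)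
  have hx : IsH1On s e x := hγ.2 φ hφ s e hs hse he hm
  have hxD : H1Deriv s e x (deriv x) := ⟨hx.acDeriv hse, hx.2⟩
  have hxc : ContinuousOn x (Icc s e) := by simpa [uIcc_of_le hse] using hx.1.continuousOn
  set k : ℝ → Mat N := fun t => formCoord φ (A.A a) (x t) (deriv x t)
  have hcoef : ContinuousOn (fun t => formCoord φ (A.A a) (x t)) (Icc s e) :=
    (A.smooth a φ hφ).continuousOn.comp hxc fun t ht =>
      mem_chart_preimage (hm ht) (hφa (hm ht))
  have hkm : MemLp k 2 (volume.restrict (Icc s e)) := memLp_two_clm_apply hcoef hx.2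
  obtain ⟨u, hu, hunit⟩ := exists_linear_solution (norm_one_mat_le N) hse
    (intervalIntegrable_of_memLp_two hse hkm) hsmall
  have huc : ContinuousOn u (Icc s e) := by simpa [uIcc_of_le hse] using hu.continuousOn
  have huH : H1Deriv s e u (fun t => -(k t * u t)) :=
    ⟨hu, (memLp_two_mul_continuousOn hkm huc).neg⟩
  choose! w huw hwu using fun t ht => isUnit_iff_exists.1 (hunit t ht)
  classical
  -- In the trivialization `a` the frame has matrix `u`. The identity matrix used outside `[s,e]` is
  -- a dummy value.
  let T : ∀ t, (Fin N → ℂ) ≃ₗ[ℂ] E (γ t) := fun t =>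
    (if ht : t ∈ Icc s e then Matrix.toLin'OfInv (hwu t ht) (huw t ht)
      else LinearEquiv.refl ℂ _).trans (B.ψ a (γ t)).symm
  have hT : ∀ t ∈ Icc s e, B.frameMatrix T a t = u t := fun t ht => by
    have h1 : (B.ψ a (γ t)).toLinearMap ∘ₗ (T t).toLinearMap = Matrix.toLin' (u t) := by
      have h2 : T t = (Matrix.toLin'OfInv (hwu t ht) (huw t ht)).trans (B.ψ a (γ t)).symm := by
        simp only [T, dif_pos ht]
      rw [h2]
      ext v
      simp
    rw [GBundle.frameMatrix, h1, LinearMap.toMatrix'_toLin']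
  -- Horizontality is required in every trivialization `b`, although the equation was solved in `a`.
  -- The frame matrix in `b` is `ψ_ba u`, and the derivative of `ψ_ba` changes the coefficient of
  -- `a` into that of `b`.
  refine ⟨T, fun b s₀ t₀ hs₀ h0 ht₀ hmb => ?_⟩
  have hsub : Icc s₀ t₀ ⊆ Icc s e := Icc_subset_Icc hs₀ ht₀
  have hO := isOpen_chart_preimage φ ((B.isOpen_W b).inter (B.isOpen_W a))
  have hmO : MapsTo x (Icc s₀ t₀) (φ.target ∩ φ.symm ⁻¹' (B.W b ∩ B.W a)) := fun t ht =>
    mem_chart_preimage (hm (hsub ht)) ⟨hmb ht, hφa (hm (hsub ht))⟩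
  have hg := (hxD.mono hs₀ h0 ht₀).comp h0 hO
    ((contDiffOn_comp_symm (B.transition_smooth b a) hφ).of_le (by simp)) hmO
  have htr : ∀ t ∈ Icc s₀ t₀, LinearMap.toMatrix' ((B.ψ b (φ.symm (x t))).toLinearMap ∘ₗ
      (B.ψ a (φ.symm (x t))).symm.toLinearMap) = B.transition b a (γ t) := fun t ht => by
    rw [show φ.symm (x t) = γ t from φ.left_inv (hm (hsub ht))]; rfl
  refine ((hg.mul h0 (huH.mono hs₀ h0 ht₀)).congr h0 fun t ht => ?_).congr_deriv h0 ?_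
  · rw [B.frameMatrix_transition T a b t, hT t (hsub ht)]
    exact congrArg (fun q : Mat N => q * u t) (htr t ht)
  · filter_upwards [ae_form_velocity hγ hφ (hs.trans hs₀) h0 (ht₀.trans he)
      (hm.mono_left hsub) (A.A b)] with t hv ht
    have h1 := A.transition_mul_formCoord hφ (hmO ht) (deriv x t)
    have h2 : φ.symm (x t) = γ t := φ.left_inv (hm (hsub ht))
    rw [h2] at h1
    rw [hv ht, B.frameMatrix_transition T a b t, hT t (hsub ht)]
    have h3 : fderiv ℝ (fun z => B.transition b a (φ.symm z)) (x t) (deriv x t)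
        = B.transition b a (γ t) * k t
          - formCoord φ (A.A b) (x t) (deriv x t) * B.transition b a (γ t) := by
      rw [h1]; abel
    refine (congrArg₂ (fun p q : Mat N => p * u t + q * -(k t * u t)) h3 (htr t ht)).trans ?_
    noncomm_ring

variable [IsManifold (𝓡 d) ∞ M]

theorem exists_isHorizontal {γ : ℝ → M} (hγ : IsH1Curve d γ) : ∃ T, A.IsHorizontal γ 0 1 T := by
  refine interval_induction zero_le_one (Q := fun s e => ∃ T, A.IsHorizontal γ s e T) ?_
    fun s m e _ _ _ _ h1 h2 => exists_isHorizontal_glue h1 h2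
  intro t ht
  obtain ⟨a, ha⟩ := B.cover (γ t)
  obtain ⟨φ, hφ, htφ, hφa⟩ := exists_chart_subset (d := d) (γ t) (B.isOpen_W a) ha
  obtain ⟨r, hr, hball⟩ := exists_radius_mapsTo hγ.1 ht φ.open_source htφ
  set s₁ := max 0 (t - r)
  set e₁ := min 1 (t + r)
  have hs₁ : s₁ ≤ t := max_le ht.1 (by linarith)
  have he₁ : t ≤ e₁ := le_min ht.2 (by linarith)
  have hm : MapsTo γ (Icc s₁ e₁) φ.source := fun τ hτ => by
    refine hball τ ⟨(le_max_left _ _).trans hτ.1, hτ.2.trans (min_le_left _ _)⟩ (abs_le.2 ⟨?_, ?_⟩)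
    · linarith [(le_max_right 0 (t - r)).trans hτ.1]
    · linarith [hτ.2.trans (min_le_right 1 (t + r))]
  have h0 : (0 : ℝ) ≤ s₁ := le_max_left _ _
  have h1 : e₁ ≤ 1 := min_le_left _ _
  have hse := hs₁.trans he₁
  have hx : IsH1On s₁ e₁ (fun τ => φ (γ τ)) := hγ.2 φ hφ s₁ e₁ h0 hse h1 hm
  have hcoef : ContinuousOn (fun t => formCoord φ (A.A a) (φ (γ t))) (uIcc s₁ e₁) :=
    (A.smooth a φ hφ).continuousOn.comp hx.1.continuousOn fun t ht => by
      rw [uIcc_of_le hse] at ht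
      exact mem_chart_preimage (hm ht) (hφa (hm ht))
  obtain ⟨U, hU, htU, hsmall⟩ := exists_small_integral (t := t) hse
    (continuousOn_clm_apply_intervalIntegrable hcoef (hx.acDeriv hse).int)
    (show (0 : ℝ) < 1 / 4 by norm_num)
  refine ⟨U ∩ Ioo (t - r) (t + r), hU.inter isOpen_Ioo, ⟨htU, by linarith, by linarith⟩, ?_⟩
  intro s e hs hse' he hsub
  have hss : s₁ ≤ s := max_le hs (hsub ⟨le_rfl, hse'⟩).2.1.le
  have hee : e ≤ e₁ := le_min he (hsub ⟨hse', le_rfl⟩).2.2.le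
  exact A.exists_isHorizontal_of_small hγ hφ hφa hs hse' he
    (hm.mono_left (Icc_subset_Icc hss hee))
    (hsmall s e hss hse' hee fun τ hτ => (hsub hτ).1)

/-- With a horizontal frame `T`, put `U_{t,s} = T_t T_s⁻¹`: multiplicativity is then automatic, the
equation in `t` is that of the frame, and the equation in `s` is that of its inverse. -/
theorem exists_isParallelTransport {γ : ℝ → M} (hγ : IsH1Curve d γ) :
    ∃ U : ∀ t s : ℝ, E (γ s) →ₗ[ℂ] E (γ t), A.IsParallelTransport γ U := by
  obtain ⟨T, hT⟩ := A.exists_isHorizontal hγ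
  let U : ∀ t s : ℝ, E (γ s) →ₗ[ℂ] E (γ t) := fun t s =>
    (T t).toLinearMap ∘ₗ (T s).symm.toLinearMap
  let Q : B.ι → ℝ → Mat N := fun a s =>
    LinearMap.toMatrix' ((T s).symm.toLinearMap ∘ₗ (B.ψ a (γ s)).symm.toLinearMap)
  have hUQ : ∀ a t s, B.matrixOf a a (U t s) = B.frameMatrix T a t * Q a s := fun a t s => by
    rw [GBundle.frameMatrix, ← LinearMap.toMatrix'_comp]
    rfl
  have hQ1 : ∀ a t, B.frameMatrix T a t * Q a t = 1 := fun a t => by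
    rw [GBundle.frameMatrix, ← LinearMap.toMatrix'_comp, ← LinearMap.toMatrix'_id]
    congr 1
    ext v
    simp
  have hQ2 : ∀ a t, Q a t * B.frameMatrix T a t = 1 := fun a t => by
    rw [GBundle.frameMatrix, ← LinearMap.toMatrix'_comp, ← LinearMap.toMatrix'_id]
    congr 1
    ext v
    simp
  refine ⟨U, fun t _ s _ r _ => ?_, fun s _ => ?_, fun a s₀ t₀ h0 h h1 hm s _ => ?_,
    fun a s₀ t₀ h0 h h1 hm t _ => ?_⟩
  · ext v
    simp [U]
  · ext v
    simp [U]
  · have h2 := ((hT a s₀ t₀ h0 h h1 hm).mul_const h (Q a s)).congr_deriv h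
      (g' := fun t => -(A.A a (γ t) (velocity d γ t)) * (B.frameMatrix T a t * Q a s))
      (Eventually.of_forall fun t _ => by noncomm_ring)
    simp only [hUQ]
    exact ⟨h2.isH1On, h2.ae_restrict⟩
  · have h2 := (((hT a s₀ t₀ h0 h h1 hm).inverse_solution h (fun t _ => hQ1 a t)
      (fun t _ => hQ2 a t)).const_mul h (B.frameMatrix T a t)).congr_deriv h
      (g' := fun s => B.frameMatrix T a t * Q a s * A.A a (γ s) (velocity d γ s))
      (Eventually.of_forall fun s _ => by noncomm_ring)
    simp only [hUQ]
    exact ⟨h2.isH1On, h2.ae_restrict⟩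

theorem isParallelTransport_parallelTransport {γ : ℝ → M} (hγ : IsH1Curve d γ) :
    A.IsParallelTransport γ (A.parallelTransport γ) := by
  have h := A.exists_isParallelTransport hγ
  rw [parallelTransport, dif_pos h]
  exact h.choose_spec

end Connection

end Existence

/-! ### First derivatives of functions on the space of curves -/

section FirstDeriv

variable {d : ℕ} {M : Type*} [TopologicalSpace M] [ChartedSpace (EuclideanSpace ℝ (Fin d)) M]

/-- `fieldCoord` as a linear map. -/
def fieldCoordLinear (φ : OpenPartialHomeomorph M (EuclideanSpace ℝ (Fin d))) (γ : ℝ → M) :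
    (∀ t : ℝ, TangentSpace (𝓡 d) (γ t)) →ₗ[ℝ] (ℝ → EuclideanSpace ℝ (Fin d)) where
  toFun := fieldCoord φ γ
  map_add' X Y := funext fun t => map_add (mfderiv (𝓡 d) (𝓡 d) φ (γ t)) (X t) (Y t)
  map_smul' c X := funext fun t => map_smul (mfderiv (𝓡 d) (𝓡 d) φ (γ t)) c (X t)

theorem HasVariationAt.h1Family {P : Type*} [NormedAddCommGroup P] [NormedSpace ℝ P]
    {γ : CurveSpace d M} {Γ : P → CurveSpace d M}
    {X : P →ₗ[ℝ] (∀ t : ℝ, TangentSpace (𝓡 d) (γ.1 t))} {p₀ : P} (h : HasVariationAt γ Γ X p₀)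
    {φ : OpenPartialHomeomorph M (EuclideanSpace ℝ (Fin d))} (hφ : φ ∈ charts d M) {s e : ℝ}
    (hs : 0 ≤ s) (hse : s < e) (he : e ≤ 1) (hm : MapsTo γ.1 (Icc s e) φ.source)
    {O : Set (EuclideanSpace ℝ (Fin d))} (hO : IsOpen O)
    (hmO : MapsTo (fun t => φ (γ.1 t)) (Icc s e) O) :
    H1Family s e O (fun t => φ (γ.1 t)) (fun p t => φ ((Γ p).1 t))
      (fieldCoordLinear φ γ.1 ∘ₗ X) p₀ where
  lt := hse
  isOpen := hO
  base := γ.2.2 φ hφ s e hs hse.le he hm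
  mapsTo := hmO
  near := (h.mapsTo φ hφ s e hs hse.le he hm).mono fun p hp =>
    (Γ p).2.2 φ hφ s e hs hse.le he hp
  tangent p := h.tangent p φ hφ s e hs hse.le he hm
  bounded := h.bounded φ hφ s e hs hse.le he hm
  isLittleO := h.isLittleO φ hφ s e hs hse.le he hm

/-- The values of a differentiable family of `H¹` curves are differentiable. -/
theorem H1Family.hasFDerivAt_apply {V P : Type*} [NormedAddCommGroup V] [NormedSpace ℝ V]
    [FiniteDimensional ℝ V] [NormedAddCommGroup P] [NormedSpace ℝ P] {s e : ℝ} {O : Set V}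
    {x : ℝ → V} {y : P → ℝ → V} {ξ : P →ₗ[ℝ] (ℝ → V)} {p₀ : P} (h : H1Family s e O x y ξ p₀)
    (h0 : y p₀ = x) {t : ℝ} (ht : t ∈ Icc s e) :
    ∃ D : P →L[ℝ] V, (∀ p, D p = ξ p t) ∧ HasFDerivAt (fun p => y p t) D p₀ := by
  obtain ⟨K, hK, hb⟩ := h.exists_tangent_bound
  obtain ⟨K', C₀, -, hC₀, hev⟩ := h.exists_bounds
  let D : P →L[ℝ] V := (LinearMap.proj t ∘ₗ ξ).mkContinuous K fun p => (hb p).1 t ht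
  refine ⟨D, fun p => rfl, ?_⟩
  rw [hasFDerivAt_iff_isLittleO]
  refine Asymptotics.IsBigO.trans_isLittleO (Asymptotics.IsBigO.of_bound C₀ ?_) h.isLittleO
  filter_upwards [hev] with p hp
  rw [h0]
  refine (hp.2.1 t ht).trans ?_
  exact mul_le_mul_of_nonneg_left (le_abs_self _) hC₀

variable {γ : CurveSpace d M}

/-- A derivative is tested only on `H¹` fields, the only ones for which the integral formulas can be
manipulated. -/
theorem HasFirstDerivAt.congr_deriv {V : Type*} [NormedAddCommGroup V] [NormedSpace ℝ V]
    {f : CurveSpace d M → V} {L L' : (∀ t : ℝ, TangentSpace (𝓡 d) (γ.1 t)) → V}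
    (h : HasFirstDerivAt f γ L) (hL : ∀ X, IsH1Field γ.1 X → L X = L' X) :
    HasFirstDerivAt f γ L' := by
  intro P _ _ Γ X p₀ hv
  obtain ⟨D, hD, hf⟩ := h P Γ X p₀ hv
  exact ⟨D, fun p => (hD p).trans (hL _ (hv.tangent p)), hf⟩

theorem hasFirstDerivAt_const {V : Type*} [NormedAddCommGroup V] [NormedSpace ℝ V] (c : V) :
    HasFirstDerivAt (fun _ : CurveSpace d M => c) γ (fun _ => 0) := by
  intro P _ _ Γ X p₀ _
  exact ⟨0, fun p => rfl, hasFDerivAt_const c p₀⟩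

theorem HasFirstDerivAt.mul {𝔸 : Type*} [NormedRing 𝔸] [NormedAlgebra ℝ 𝔸]
    {f g : CurveSpace d M → 𝔸} {L L' : (∀ t : ℝ, TangentSpace (𝓡 d) (γ.1 t)) → 𝔸}
    (hf : HasFirstDerivAt f γ L) (hg : HasFirstDerivAt g γ L') :
    HasFirstDerivAt (fun σ => f σ * g σ) γ (fun X => L X * g γ + f γ * L' X) := by
  intro P _ _ Γ X p₀ hv
  obtain ⟨D, hD, hf⟩ := hf P Γ X p₀ hv
  obtain ⟨D', hD', hg⟩ := hg P Γ X p₀ hv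
  refine ⟨_, fun p => ?_, hf.mul' hg⟩
  simp [hv.base, hD, hD', add_comm]

/-- The derivative of the evaluation of a smooth function at a point of the curve. -/
theorem hasFirstDerivAt_eval [IsManifold (𝓡 d) ∞ M] {V : Type*} [NormedAddCommGroup V]
    [NormedSpace ℝ V] {f : M → V} {S : Set M} (hS : IsOpen S) (hf : ContMDiffOn (𝓡 d) 𝓘(ℝ, V) ∞ f S)
    {t : ℝ} (ht : t ∈ Icc (0 : ℝ) 1) (htS : γ.1 t ∈ S) :
    HasFirstDerivAt (fun σ : CurveSpace d M => f (σ.1 t)) γ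
      (fun X => mvfderiv (𝓡 d) f (γ.1 t) (X t)) := by
  intro P _ _ Γ X p₀ hv
  obtain ⟨φ, hφ, htφ, hφS⟩ := exists_chart_subset (d := d) (γ.1 t) hS htS
  obtain ⟨s, e, hs, hse, he, hst, hm⟩ := exists_interval_mapsTo γ.2.1 ht φ.open_source htφ
  have hfam := hv.h1Family hφ hs hse he hm φ.open_target fun τ hτ => φ.map_source (hm hτ)
  obtain ⟨D, hD, hDer⟩ := hfam.hasFDerivAt_apply (by rw [hv.base]) hst
  have hinv : φ.symm (φ (γ.1 t)) = γ.1 t := φ.left_inv htφ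
  have hfφ : HasFDerivAt (fun y => f (φ.symm y))
      (fderiv ℝ (fun y => f (φ.symm y)) (φ (γ.1 t))) (φ (γ.1 t)) :=
    (((contDiffOn_comp_symm hf hφ).contDiffAt ((isOpen_chart_preimage φ hS).mem_nhds
      (mem_chart_preimage htφ htS))).differentiableAt (by simp)).hasFDerivAt
  have hfφ' : HasFDerivAt (fun y => f (φ.symm y))
      (fderiv ℝ (fun y => f (φ.symm y)) (φ (γ.1 t))) (φ ((Γ p₀).1 t)) := by
    rw [hv.base]; exact hfφ
  have hcomp := hfφ'.comp p₀ hDer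
  refine ⟨_, fun p => ?_, hcomp.congr_of_eventuallyEq ?_⟩
  · rw [ContinuousLinearMap.comp_apply, hD]
    have hfd : MDifferentiableAt (𝓡 d) 𝓘(ℝ, V) f (γ.1 t) :=
      (hf.contMDiffAt (hS.mem_nhds htS)).mdifferentiableAt (by simp)
    refine (fderiv_comp_symm hφ (φ.map_source htφ) (by rwa [hinv]) _).trans ?_
    let D' : M → EuclideanSpace ℝ (Fin d) →L[ℝ] V := fun z => mvfderiv (𝓡 d) f z
    have h1 : D' (φ.symm (φ (γ.1 t))) = D' (γ.1 t) := by rw [hinv]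
    exact (DFunLike.congr_fun h1 _).trans
      (congrArg (D' (γ.1 t)) (mfderiv_symm_mfderiv hφ htφ (X p t)))
  · filter_upwards [hv.mapsTo φ hφ s e hs hse.le he hm] with p hp
    simp only [Function.comp]
    rw [φ.left_inv (hp hst)]

end FirstDeriv

/-! ### The first derivative of the parallel transport -/

section TransportDerivative

variable {d : ℕ} {M : Type*} [TopologicalSpace M] [ChartedSpace (EuclideanSpace ℝ (Fin d)) M]
  {N : ℕ} {G : Subgroup (Matrix.specialUnitaryGroup (Fin N) ℂ)}
  {E : M → Type*} [∀ x, AddCommGroup (E x)] [∀ x, Module ℂ (E x)] {B : GBundle d G E}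

namespace Connection

variable (A : Connection B)

/-- The matrix of `U_{e,t} F(X, γ̇) U_{t,c}`. -/
def transportedCurvature (γ : CurveSpace d M) (c e : ℝ) (a b : B.ι)
    (X : ∀ t : ℝ, TangentSpace (𝓡 d) (γ.1 t)) (t : ℝ) : Mat N :=
  B.matrixOf b a (A.parallelTransport γ.1 e t ∘ₗ
    A.curvature (γ.1 t) (X t) (velocity d γ.1 t) ∘ₗ A.parallelTransport γ.1 t c)

/-- The matrix of `U_{e,c}` as a function of the curve. -/
def transportMatrix (c e : ℝ) (a b : B.ι) (σ : CurveSpace d M) : Mat N :=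
  B.matrixOf b a (A.parallelTransport σ.1 e c)

/-- The formula for the derivative of the parallel transport. -/
structure HasTransportDeriv (γ : CurveSpace d M) (c e : ℝ) (a b : B.ι) : Prop where
  integrable : ∀ X, IsH1Field γ.1 X →
    IntervalIntegrable (A.transportedCurvature γ c e a b X) volume c e
  hasDeriv : HasFirstDerivAt (A.transportMatrix c e a b) γ fun X =>
    -(∫ t in c..e, A.transportedCurvature γ c e a b X t)
      - A.A b (γ.1 e) (X e) * A.transportMatrix c e a b γ
      + A.transportMatrix c e a b γ * A.A a (γ.1 c) (X c)

theorem transportMatrix_transition (c e : ℝ) (a b a' b' : B.ι) (σ : CurveSpace d M) :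
    A.transportMatrix c e a' b' σ
      = B.transition b' b (σ.1 e) * A.transportMatrix c e a b σ * B.transition a a' (σ.1 c) :=
  B.matrixOf_eq _ _ _ _ _

theorem transportedCurvature_transition (γ : CurveSpace d M) (c e : ℝ) (a b a' b' : B.ι)
    (X : ∀ t : ℝ, TangentSpace (𝓡 d) (γ.1 t)) (t : ℝ) :
    A.transportedCurvature γ c e a' b' X t
      = B.transition b' b (γ.1 e) * A.transportedCurvature γ c e a b X t
        * B.transition a a' (γ.1 c) :=
  B.matrixOf_eq _ _ _ _ _

/-- Separates the transports from the curvature by inserting any trivialization `k` at the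
intermediate point, so that transports can be split or joined there. -/
theorem transportedCurvature_eq (γ : CurveSpace d M) (c e : ℝ) (a b k : B.ι)
    (X : ∀ t : ℝ, TangentSpace (𝓡 d) (γ.1 t)) (t : ℝ) :
    A.transportedCurvature γ c e a b X t = A.transportMatrix t e k b γ
      * B.matrixOf k k (A.curvature (γ.1 t) (X t) (velocity d γ.1 t))
      * A.transportMatrix c t a k γ := by
  rw [transportedCurvature, B.matrixOf_comp a k b, B.matrixOf_comp a k k, ← mul_assoc]
  rfl

theorem integral_mul_mul_const {f : ℝ → Mat N} {c e : ℝ} (hf : IntervalIntegrable f volume c e)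
    (P Q : Mat N) : ∫ t in c..e, P * f t * Q = P * (∫ t in c..e, f t) * Q := by
  have h1 := (ContinuousLinearMap.mulLeftRight ℝ (Mat N) P Q).intervalIntegral_comp_comm hf
  simpa only [ContinuousLinearMap.mulLeftRight_apply] using h1

theorem intervalIntegrable_mul_mul_const {f : ℝ → Mat N} {c e : ℝ}
    (hf : IntervalIntegrable f volume c e) (P Q : Mat N) :
    IntervalIntegrable (fun t => P * f t * Q) volume c e :=
  (hf.continuousOn_mul continuousOn_const).mul_continuousOn continuousOn_const

variable [IsManifold (𝓡 d) ∞ M]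

theorem transportMatrix_mul (σ : CurveSpace d M) {r s t : ℝ} (hr : r ∈ Icc (0 : ℝ) 1)
    (hs : s ∈ Icc (0 : ℝ) 1) (ht : t ∈ Icc (0 : ℝ) 1) (a k b : B.ι) :
    A.transportMatrix s t k b σ * A.transportMatrix r s a k σ = A.transportMatrix r t a b σ := by
  rw [transportMatrix, transportMatrix, ← B.matrixOf_comp,
    (A.isParallelTransport_parallelTransport σ.2).comp t ht s hs r hr]
  rfl

theorem transportMatrix_self (σ : CurveSpace d M) {t : ℝ} (ht : t ∈ Icc (0 : ℝ) 1) (a : B.ι) :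
    A.transportMatrix t t a a σ = 1 := by
  rw [transportMatrix, (A.isParallelTransport_parallelTransport σ.2).init t ht, B.matrixOf_id,
    B.transition_self]

variable {A} {γ : CurveSpace d M}

/-- Leibniz rule for `ψ_b'b U ψ_aa'`. The transformation law writes each derivative of a transition
function as a difference of two connection terms: one cancels the old boundary term, the other is
the new one. -/
theorem HasTransportDeriv.change_trivialization {c e : ℝ} {a b a' b' : B.ι}
    (h : A.HasTransportDeriv γ c e a b) (hc : c ∈ Icc (0 : ℝ) 1) (he : e ∈ Icc (0 : ℝ) 1)
    (ha : γ.1 c ∈ B.W a ∩ B.W a') (hb : γ.1 e ∈ B.W b' ∩ B.W b) :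
    A.HasTransportDeriv γ c e a' b' := by
  have hI : ∀ X, A.transportedCurvature γ c e a' b' X = fun t => B.transition b' b (γ.1 e)
      * A.transportedCurvature γ c e a b X t * B.transition a a' (γ.1 c) := fun X =>
    funext fun t => A.transportedCurvature_transition γ c e a b a' b' X t
  refine ⟨fun X hX => ?_, ?_⟩
  · rw [hI]
    exact intervalIntegrable_mul_mul_const (h.integrable X hX) _ _
  have h1 : HasFirstDerivAt (fun σ : CurveSpace d M => B.transition b' b (σ.1 e)) γ
      (fun X => mvfderiv (𝓡 d) (B.transition b' b) (γ.1 e) (X e)) :=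
    hasFirstDerivAt_eval ((B.isOpen_W b').inter (B.isOpen_W b)) (B.transition_smooth b' b) he hb
  have h2 : HasFirstDerivAt (fun σ : CurveSpace d M => B.transition a a' (σ.1 c)) γ
      (fun X => mvfderiv (𝓡 d) (B.transition a a') (γ.1 c) (X c)) :=
    hasFirstDerivAt_eval ((B.isOpen_W a).inter (B.isOpen_W a')) (B.transition_smooth a a') hc ha
  have h3 := (h1.mul h.hasDeriv).mul h2
  rw [show A.transportMatrix c e a' b' = fun σ : CurveSpace d M => B.transition b' b (σ.1 e)
    * A.transportMatrix c e a b σ * B.transition a a' (σ.1 c) from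
    funext fun σ => A.transportMatrix_transition c e a b a' b' σ]
  refine h3.congr_deriv fun X hX => ?_
  have e1 : mvfderiv (𝓡 d) (B.transition b' b) (γ.1 e) (X e)
      = B.transition b' b (γ.1 e) * A.A b (γ.1 e) (X e)
        - A.A b' (γ.1 e) (X e) * B.transition b' b (γ.1 e) := by
    rw [A.transition_mul_form hb]; abel
  have e2 : mvfderiv (𝓡 d) (B.transition a a') (γ.1 c) (X c)
      = B.transition a a' (γ.1 c) * A.A a' (γ.1 c) (X c)
        - A.A a (γ.1 c) (X c) * B.transition a a' (γ.1 c) := by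
    rw [A.transition_mul_form ha]; abel
  rw [hI, integral_mul_mul_const (h.integrable X hX), e1, e2]
  noncomm_ring

/-- Leibniz rule for `U_{e,c} = U_{e,m} U_{m,c}`. The boundary terms at `m` occur with opposite
signs, both between the two factors, and cancel; multiplicativity merges the two integrals. -/
theorem HasTransportDeriv.trans {c m e : ℝ} {a k b : B.ι} (hc : 0 ≤ c) (hcm : c ≤ m) (hme : m ≤ e)
    (he : e ≤ 1) (h1 : A.HasTransportDeriv γ c m a k) (h2 : A.HasTransportDeriv γ m e k b) :
    A.HasTransportDeriv γ c e a b := by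
  have hc' : c ∈ Icc (0 : ℝ) 1 := ⟨hc, hcm.trans (hme.trans he)⟩
  have hm' : m ∈ Icc (0 : ℝ) 1 := ⟨hc.trans hcm, hme.trans he⟩
  have he' : e ∈ Icc (0 : ℝ) 1 := ⟨hc.trans (hcm.trans hme), he⟩
  have hI1 : ∀ X, ∀ t ∈ Icc c m, A.transportedCurvature γ c e a b X t
      = A.transportMatrix m e k b γ * A.transportedCurvature γ c m a k X t * 1 :=
    fun X t ht => by
      have ht' : t ∈ Icc (0 : ℝ) 1 := ⟨hc.trans ht.1, ht.2.trans hm'.2⟩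
      rw [A.transportedCurvature_eq γ c e a b k, A.transportedCurvature_eq γ c m a k k,
        ← A.transportMatrix_mul γ ht' hm' he' k k b]
      noncomm_ring
  have hI2 : ∀ X, ∀ t ∈ Icc m e, A.transportedCurvature γ c e a b X t
      = 1 * A.transportedCurvature γ m e k b X t * A.transportMatrix c m a k γ :=
    fun X t ht => by
      have ht' : t ∈ Icc (0 : ℝ) 1 := ⟨hm'.1.trans ht.1, ht.2.trans he⟩
      rw [A.transportedCurvature_eq γ c e a b k, A.transportedCurvature_eq γ m e k b k,
        ← A.transportMatrix_mul γ hc' hm' ht' a k k]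
      noncomm_ring
  have hi1 : ∀ X, IsH1Field γ.1 X →
      IntervalIntegrable (A.transportedCurvature γ c e a b X) volume c m := fun X hX =>
    (intervalIntegrable_mul_mul_const (h1.integrable X hX) (A.transportMatrix m e k b γ) 1).congr
      fun t ht => (hI1 X t (by
        rw [uIoc_of_le hcm] at ht; exact Ioc_subset_Icc_self ht)).symm
  have hi2 : ∀ X, IsH1Field γ.1 X →
      IntervalIntegrable (A.transportedCurvature γ c e a b X) volume m e := fun X hX =>
    (intervalIntegrable_mul_mul_const (h2.integrable X hX) 1 (A.transportMatrix c m a k γ)).congr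
      fun t ht => (hI2 X t (by
        rw [uIoc_of_le hme] at ht; exact Ioc_subset_Icc_self ht)).symm
  refine ⟨fun X hX => (hi1 X hX).trans (hi2 X hX), ?_⟩
  rw [show A.transportMatrix c e a b = fun σ : CurveSpace d M =>
    A.transportMatrix m e k b σ * A.transportMatrix c m a k σ from
    funext fun σ => (A.transportMatrix_mul σ hc' hm' he' a k b).symm]
  refine (h2.hasDeriv.mul h1.hasDeriv).congr_deriv fun X hX => ?_
  have j1 : ∫ t in c..m, A.transportedCurvature γ c e a b X t
      = A.transportMatrix m e k b γ * ∫ t in c..m, A.transportedCurvature γ c m a k X t := by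
    rw [intervalIntegral.integral_congr fun t ht => hI1 X t (by rwa [uIcc_of_le hcm] at ht),
      integral_mul_mul_const (h1.integrable X hX), mul_one]
  have j2 : ∫ t in m..e, A.transportedCurvature γ c e a b X t
      = (∫ t in m..e, A.transportedCurvature γ m e k b X t) * A.transportMatrix c m a k γ := by
    rw [intervalIntegral.integral_congr fun t ht => hI2 X t (by rwa [uIcc_of_le hme] at ht),
      integral_mul_mul_const (h2.integrable X hX), one_mul]
  rw [← intervalIntegral.integral_add_adjacent_intervals (hi1 X hX) (hi2 X hX), j1, j2]
  noncomm_ring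

variable (A)

/-- The parallel transport in a chart and a trivialization solves a linear equation. -/
theorem acDeriv_transportMatrix (σ : CurveSpace d M) {a : B.ι}
    {φ : OpenPartialHomeomorph M (EuclideanSpace ℝ (Fin d))} (hφ : φ ∈ charts d M)
    (hφa : φ.source ⊆ B.W a) {s e : ℝ} (hs : 0 ≤ s) (hse : s ≤ e) (he : e ≤ 1)
    (hm : MapsTo σ.1 (Icc s e) φ.source) :
    ACDeriv s e (fun t => A.transportMatrix s t a a σ) (fun t =>
      -(formCoord φ (A.A a) (φ (σ.1 t)) (deriv (fun τ => φ (σ.1 τ)) t)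
        * A.transportMatrix s t a a σ)) ∧
    ACDeriv s e (fun t => A.transportMatrix t s a a σ) (fun t =>
      A.transportMatrix t s a a σ
        * formCoord φ (A.A a) (φ (σ.1 t)) (deriv (fun τ => φ (σ.1 τ)) t)) := by
  have hU := A.isParallelTransport_parallelTransport σ.2
  have hmW : MapsTo σ.1 (Icc s e) (B.W a) := fun t ht => hφa (hm ht)
  have hv := ae_form_velocity σ.2 hφ hs hse he hm (A.A a)
  obtain ⟨f1, f2⟩ := hU.deriv_fst a s e hs hse he hmW s ⟨le_rfl, hse⟩
  obtain ⟨g1, g2⟩ := hU.deriv_snd a s e hs hse he hmW s ⟨le_rfl, hse⟩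
  rw [ae_restrict_iff' measurableSet_Icc] at f2 g2
  refine ⟨((H1Deriv.of_isH1On hse f1 f2).congr_deriv hse ?_).toACDeriv,
    ((H1Deriv.of_isH1On hse g1 g2).congr_deriv hse ?_).toACDeriv⟩
  · filter_upwards [hv] with t h1 ht
    rw [h1 ht, neg_mul]
    rfl
  · filter_upwards [hv] with t h1 ht
    rw [h1 ht]
    rfl

/-- The derivative formula for curves inside a chart and a trivialization. -/
theorem hasTransportDeriv_of_mapsTo {a : B.ι}
    {φ : OpenPartialHomeomorph M (EuclideanSpace ℝ (Fin d))} (hφ : φ ∈ charts d M)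
    (hφa : φ.source ⊆ B.W a) {s e : ℝ} (hs : 0 ≤ s) (hse : s ≤ e) (he : e ≤ 1)
    (hm : MapsTo γ.1 (Icc s e) φ.source) : A.HasTransportDeriv γ s e a a := by
  have hs' : s ∈ Icc (0 : ℝ) 1 := ⟨hs, hse.trans he⟩
  have he' : e ∈ Icc (0 : ℝ) 1 := ⟨hs.trans hse, he⟩
  have hsI : s ∈ Icc s e := ⟨le_rfl, hse⟩
  have heI : e ∈ Icc s e := ⟨hse, le_rfl⟩
  have hI01 : ∀ t ∈ Icc s e, t ∈ Icc (0 : ℝ) 1 := fun t ht => ⟨hs.trans ht.1, ht.2.trans he⟩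
  set O := φ.target ∩ φ.symm ⁻¹' B.W a
  have hO : IsOpen O := isOpen_chart_preimage φ (B.isOpen_W a)
  set α := formCoord φ (A.A a)
  have hα : ContDiffOn ℝ 1 α O := (A.smooth a φ hφ).of_le (by simp)
  set x : ℝ → EuclideanSpace ℝ (Fin d) := fun t => φ (γ.1 t)
  have hxO : MapsTo x (Icc s e) O := fun t ht => mem_chart_preimage (hm ht) (hφa (hm ht))
  have hx : IsH1On s e x := γ.2.2 φ hφ s e hs hse he hm
  have hc : ∀ {f : ℝ → EuclideanSpace ℝ (Fin d)}, IsH1On s e f → ContinuousOn f (Icc s e) :=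
    fun hf => by simpa [uIcc_of_le hse] using hf.1.continuousOn
  set Z : ℝ → Mat N := fun t => A.transportMatrix s t a a γ
  set W : ℝ → Mat N := fun t => A.transportMatrix t s a a γ
  obtain ⟨hZ, hW⟩ := A.acDeriv_transportMatrix γ hφ hφa hs hse he hm
  have hZW : ∀ t ∈ Icc s e, Z t * W t = 1 := fun t ht => by
    simp only [Z, W]
    rw [A.transportMatrix_mul γ (hI01 t ht) hs' (hI01 t ht), A.transportMatrix_self γ (hI01 t ht)]
  have hZc : ContinuousOn Z (Icc s e) := by simpa [uIcc_of_le hse] using hZ.continuousOn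
  have hWc : ContinuousOn W (Icc s e) := by simpa [uIcc_of_le hse] using hW.continuousOn
  -- `U_{e,t} = Z(e) W(t)`, so the integrand of the coordinate formula is the transported curvature
  -- at almost every `t`, where the velocity is the coordinate derivative.
  have hI : ∀ X, ∀ᵐ t, t ∈ Icc s e → Z e * W t * curvForm α (x t) (fieldCoord φ γ.1 X t)
      (deriv x t) * Z t = A.transportedCurvature γ s e a a X t := fun X => by
    filter_upwards [ae_mfderiv_velocity γ.2 hφ hs hse he hm] with t hv ht
    rw [A.transportedCurvature_eq γ s e a a a, A.matrixOf_curvature (hφa (hm ht)),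
      A.localCurvature_eq_curvForm hφ (hm ht) (hφa (hm ht)),
      ← A.transportMatrix_mul γ (hI01 t ht) hs' he' a a a]
    exact congrArg (fun w => Z e * W t * curvForm α (x t) (fieldCoord φ γ.1 X t) w * Z t)
      (hv ht).symm
  have hIoc : ∀ X, ∀ᵐ t, t ∈ uIoc s e → Z e * W t * curvForm α (x t) (fieldCoord φ γ.1 X t)
      (deriv x t) * Z t = A.transportedCurvature γ s e a a X t := fun X => by
    rw [uIoc_of_le hse]
    exact (hI X).mono fun t h ht => h (Ioc_subset_Icc_self ht)
  refine ⟨fun X hX => ?_, ?_⟩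
  · have hZW' : ContinuousOn (fun t => Z e * W t) (Icc s e) := continuousOn_const.mul hWc
    refine (intervalIntegrable_mul_mul hse hZW' hZc
      (intervalIntegrable_curvForm hse hO hα (hc hx) hxO (hx.acDeriv hse).int
        (hc (hX φ hφ s e hs hse he hm)))).congr_ae ?_
    exact (ae_restrict_iff' measurableSet_uIoc).2 (hIoc X)
  -- The Sobolev estimate needs an interval of positive length. On a degenerate one the transport is
  -- constantly `1` and the two boundary terms cancel.
  rcases hse.eq_or_lt with rfl | hlt
  · rw [show A.transportMatrix s s a a = fun _ : CurveSpace d M => (1 : Mat N) from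
      funext fun σ => A.transportMatrix_self σ hs' a]
    refine (hasFirstDerivAt_const (1 : Mat N)).congr_deriv fun X _ => ?_
    simp
  intro P _ _ Γ X p₀ hv
  have hfam := hv.h1Family hφ hs hlt he hm hO hxO
  have hY : ∀ᶠ p in 𝓝 p₀, ACDeriv s e (fun t => A.transportMatrix s t a a (Γ p)) (fun t =>
      -(α (φ ((Γ p).1 t)) (deriv (fun τ => φ ((Γ p).1 τ)) t)
        * A.transportMatrix s t a a (Γ p))) ∧ A.transportMatrix s s a a (Γ p) = 1 := by
    filter_upwards [hv.mapsTo φ hφ s e hs hse he hm] with p hp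
    exact ⟨(A.acDeriv_transportMatrix (Γ p) hφ hφa hs hse he hp).1,
      A.transportMatrix_self (Γ p) hs' a⟩
  obtain ⟨D, hD, hDer⟩ := hfam.hasFDerivAt_solution hα hW hZ hZW (A.transportMatrix_self γ hs' a)
    (A.transportMatrix_self γ hs' a) hY (by rw [hv.base])
  refine ⟨D, fun p => (hD p).trans ?_, hDer⟩
  have e1 : α (x e) (fieldCoord φ γ.1 (X p) e) = A.A a (γ.1 e) (X p e) :=
    formCoord_mfderiv hφ (A.A a) (hm heI) _
  have e2 : α (x s) (fieldCoord φ γ.1 (X p) s) = A.A a (γ.1 s) (X p s) :=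
    formCoord_mfderiv hφ (A.A a) (hm hsI) _
  exact congrArg₂ (· + ·) (congrArg₂ (· - ·)
    (congrArg Neg.neg (intervalIntegral.integral_congr_ae (hIoc (X p))))
    (congrArg (· * Z e) e1)) (congrArg (Z e * ·) e2)

theorem hasTransportDeriv (γ : CurveSpace d M) {c e : ℝ} (hc : 0 ≤ c) (hce : c ≤ e) (he : e ≤ 1)
    {a b : B.ι} (ha : γ.1 c ∈ B.W a) (hb : γ.1 e ∈ B.W b) : A.HasTransportDeriv γ c e a b := by
  -- The induction statement quantifies over all trivializations at both ends, so that at a division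
  -- point the same `k` can be chosen for both pieces.
  refine interval_induction hce (Q := fun s t => ∀ a b : B.ι, γ.1 s ∈ B.W a → γ.1 t ∈ B.W b →
    A.HasTransportDeriv γ s t a b) ?_ ?_ a b ha hb
  · intro t ht
    obtain ⟨k, hk⟩ := B.cover (γ.1 t)
    obtain ⟨φ, hφ, htφ, hφk⟩ := exists_chart_subset (d := d) (γ.1 t) (B.isOpen_W k) hk
    obtain ⟨r, hr, hball⟩ := exists_radius_mapsTo γ.2.1 ⟨hc.trans ht.1, ht.2.trans he⟩
      φ.open_source htφ
    refine ⟨Metric.ball t r, Metric.isOpen_ball, Metric.mem_ball_self hr, ?_⟩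
    intro s s' hcs hss hse hsub a b ha hb
    have hs0 := hc.trans hcs
    have hs1 := hse.trans he
    have hm : MapsTo γ.1 (Icc s s') φ.source := fun τ hτ =>
      hball τ ⟨hs0.trans hτ.1, hτ.2.trans hs1⟩ (le_of_lt (by simpa [Real.dist_eq] using hsub hτ))
    exact (A.hasTransportDeriv_of_mapsTo hφ hφk hs0 hss hs1 hm).change_trivialization
      ⟨hs0, hss.trans hs1⟩ ⟨hs0.trans hss, hs1⟩ ⟨hφk (hm ⟨le_rfl, hss⟩), ha⟩
      ⟨hb, hφk (hm ⟨hss, le_rfl⟩)⟩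
  · intro s m t hcs hsm hmt hte h1 h2 a b ha hb
    obtain ⟨k, hk⟩ := B.cover (γ.1 m)
    exact (h1 a k ha hk).trans (hc.trans hcs) hsm hmt (hte.trans he) (h2 k b hk hb)

end Connection

end TransportDerivative

end CurveTransport

end

open CurveTransport in
theorem proposition3p2 {d : ℕ} {M : Type*} [TopologicalSpace M]
    [ChartedSpace (EuclideanSpace ℝ (Fin d)) M] [IsManifold (𝓡 d) ∞ M]
    {N : ℕ} {G : Subgroup (Matrix.specialUnitaryGroup (Fin N) ℂ)}
    {E : M → Type*} [∀ x, AddCommGroup (E x)] [∀ x, Module ℂ (E x)]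
    (B : GBundle d G E) (A : Connection B) :
    -- the parallel transport along every `H¹`-curve exists
    (∀ γ : CurveSpace d M, A.IsParallelTransport γ.1 (A.parallelTransport γ.1)) ∧
    -- its first derivative, in arbitrary trivializations `ψ_a` near `γ(c)`, `ψ_b` near `γ(e)`
    ∀ (γ : CurveSpace d M) (c e : ℝ), 0 ≤ c → c ≤ e → e ≤ 1 →
      ∀ a b : B.ι, γ.1 c ∈ B.W a → γ.1 e ∈ B.W b →
      (∀ X : (∀ t : ℝ, TangentSpace (𝓡 d) (γ.1 t)), IsH1Field γ.1 X →
        IntervalIntegrable (fun t => B.matrixOf b a (A.parallelTransport γ.1 e t ∘ₗ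
          A.curvature (γ.1 t) (X t) (velocity d γ.1 t) ∘ₗ A.parallelTransport γ.1 t c))
          volume c e) ∧
      HasFirstDerivAt (fun σ : CurveSpace d M => B.matrixOf b a (A.parallelTransport σ.1 e c)) γ
        (fun X =>
          -(∫ t in c..e, B.matrixOf b a (A.parallelTransport γ.1 e t ∘ₗ
              A.curvature (γ.1 t) (X t) (velocity d γ.1 t) ∘ₗ A.parallelTransport γ.1 t c))
          - A.A b (γ.1 e) (X e) * B.matrixOf b a (A.parallelTransport γ.1 e c)
          + B.matrixOf b a (A.parallelTransport γ.1 e c) * A.A a (γ.1 c) (X c)) := by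
  refine ⟨fun γ => A.isParallelTransport_parallelTransport γ.2, ?_⟩
  intro γ c e hc hce he a b ha hb
  have h := A.hasTransportDeriv γ hc hce he ha hb
  exact ⟨h.integrable, h.hasDeriv⟩
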